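/- **Theorem 4.3.** Let $n\ge 2$, let $\omega\subset\mathbb{R}^{n-1}$ be a bounded domain with $C^1$ boundary, and let $h_\pm\in C(\overline\omega)\cap C^1(\omega)$ be such that $H:=h_-+h_+>0$ in $\omega$ and $H=0$ on $\partial\omega$. Put $d:=h_+-h_-$ and $p:=h_+h_-$. For $\varepsilon>0$ let $$\Omega_\varepsilon=\{(x',x_n): x'\in\omega,\ -\varepsilon h_-(x')<x_n<\varepsilon h_+(x')\},$$ and let $u_\varepsilon\in C^2(\Omega_\varepsilon)\cap C(\overline{\Omega_\varepsilon})$ be the solution of $-\Delta u_\varepsilon=2$ in $\Omega_\varepsilon$, $u_\varepsilon=0$ on $\partial\Omega_\varepsilon$. Assume: - (H1) there is a unique point $\overline x\in\omega$ at which $H$ achieves its global maximum $H_0$; - (H2) the Hessian matrix of $H$ at $\overline x$, denoted by $2H_2$, is negative definite; - (H3) $h_\pm$ are $5$ times continuously differentiable in a neighbourhood of $\overline x$. Let $d_0=d(\overline x)$, $d_1=\nabla d(\overline x)$, let $2D_2$ and $2P_2$ be the Hessian matrices of $d$ and $p$ at $\overline x$, and let $\Sigma_\delta,\Sigma_\pi\in\mathbb{R}^{n-1}$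 be the vectors with components $$(\Sigma_\delta)_k=\frac16\sum_{j=1}^{n-1}\partial_j^2\partial_k d(\overline x),\qquad (\Sigma_\pi)_k=\frac16\sum_{j=1}^{n-1}\partial_j^2\partial_k p(\overline x).$$ Define $$\overline x_2=-\frac14H_0\Big[\frac{\operatorname{tr}D_2}{2}H_2^{-1}d_1+3H_2^{-1}\big(\Sigma_\pi+\tfrac12 d_0\Sigma_\delta\big)\Big],$$ $$\xi_{n2}=-\frac18H_0\Big[\frac12\operatorname{tr}D_2\; d_1^{t}H_2^{-1}d_1+3d_1^{t}H_2^{-1}\big(\Sigma_\pi+\tfrac12 d_0\Sigma_\delta\big)\Big]+\frac1{24}H_0^2\operatorname{tr}D_2 .$$ Then, for all sufficiently small $\varepsilon>0$, $u_\varepsilon$ attains its maximum over $\Omega_\varepsilon$, and any maximizer $(x'_*,x_{n*})\in\Omega_\varepsilon$, written in the rescaled variables $(x'_*,\xi_{n*})$ with $\xi_{n*}=x_{n*}/\varepsilon$, satisfies $$(x'_*,\xi_{n*})=\Big(\overline x+\overline x_2\varepsilon^2,\ \frac{d_0}{2}+\xi_{n2}\varepsilon^2\Big)+\mathcal{O}(\varepsilon^3)\qquad(\varepsilon\to0),$$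 while the corresponding maximum satisfies $$\max_{\Omega_\varepsilon}u_\varepsilon=\frac14H_0^2\varepsilon^2+\frac18H_0^2\big[d_0\operatorname{tr}D_2+2\operatorname{tr}P_2\big]\varepsilon^4+\mathcal{O}(\varepsilon^5)\qquad(\varepsilon\to0).$$ The constants in the $\mathcal{O}$ terms do not depend on $\varepsilon$ or on the choice of the maximizer. -/

import Mathlib

namespace ThinDomain

noncomputable section

/-- The first `m` coordinates `x'` of a point `x = (x', x_n)` of `ℝⁿ`, where `n = m + 1`. -/
def base {m : ℕ} (x : EuclideanSpace ℝ (Fin (m + 1))) : EuclideanSpace ℝ (Fin m) :=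
  WithLp.toLp 2 fun i => x i.castSucc

/-- The last coordinate `x_n` of a point `x = (x', x_n)` of `ℝⁿ`, where `n = m + 1`. -/
def height {m : ℕ} (x : EuclideanSpace ℝ (Fin (m + 1))) : ℝ :=
  x (Fin.last m)

/-- `ω` has a boundary of class `C¹`: near each boundary point, `ω` is the negativity set of
a `C¹` function whose derivative does not vanish at the point. -/
def HasC1Boundary {m : ℕ} (ω : Set (EuclideanSpace ℝ (Fin m))) : Prop :=
  ∀ x ∈ frontier ω, ∃ (U : Set (EuclideanSpace ℝ (Fin m))) (φ : EuclideanSpace ℝ (Fin m) → ℝ),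
    IsOpen U ∧ x ∈ U ∧ ContDiffOn ℝ 1 φ U ∧ fderiv ℝ φ x ≠ 0 ∧ ω ∩ U = {y ∈ U | φ y < 0}

/-- The thin domain `{(x', x_n) : x' ∈ ω, -ε h₋(x') < x_n < ε h₊(x')}` in `ℝⁿ`, `n = m + 1`. -/
def thinDomain {m : ℕ} (ω : Set (EuclideanSpace ℝ (Fin m)))
    (hminus hplus : EuclideanSpace ℝ (Fin m) → ℝ) (ε : ℝ) :
    Set (EuclideanSpace ℝ (Fin (m + 1))) :=
  {x | base x ∈ ω ∧ -(ε * hminus (base x)) < height x ∧ height x < ε * hplus (base x)}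

/-- `u` is a classical solution, in `C²(Ω) ∩ C(closure Ω)`, of `-Δu = 2` in the open set `Ω`
with `u = 0` on `∂Ω`. -/
structure IsTorsionSolution {n : ℕ} (Ω : Set (EuclideanSpace ℝ (Fin n)))
    (u : EuclideanSpace ℝ (Fin n) → ℝ) : Prop where
  contDiffOn : ContDiffOn ℝ 2 u Ω
  continuousOn : ContinuousOn u (closure Ω)
  equation : ∀ x ∈ Ω, -(Laplacian.laplacian u x) = 2
  boundary : ∀ x ∈ frontier Ω, u x = 0

/-- The vector of first partial derivatives `∂ᵢ f(x)`. -/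
def grad {m : ℕ} (f : EuclideanSpace ℝ (Fin m) → ℝ) (x : EuclideanSpace ℝ (Fin m)) :
    Fin m → ℝ :=
  fun i => fderiv ℝ f x (EuclideanSpace.single i 1)

/-- One half of the Hessian matrix of `f` at `x`, i.e. the symmetric matrix `F₂` of the quadratic
Taylor term `(y - x)ᵗ F₂ (y - x)` of `f` at `x`. -/
def halfHessian {m : ℕ} (f : EuclideanSpace ℝ (Fin m) → ℝ) (x : EuclideanSpace ℝ (Fin m)) :
    Matrix (Fin m) (Fin m) ℝ :=
  Matrix.of fun i j =>
    (1 / 2 : ℝ) * iteratedFDeriv ℝ 2 f x ![EuclideanSpace.single i 1, EuclideanSpace.single j 1]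

/-- The coefficient `f_{ijk}` of the cubic Taylor term `∑ f_{ijk} zᵢ zⱼ zₖ`, `z = y - x`, of `f`
at `x`, normalized to be symmetric in its indices: one sixth of the third partial derivative. -/
def cubicCoeff {m : ℕ} (f : EuclideanSpace ℝ (Fin m) → ℝ) (x : EuclideanSpace ℝ (Fin m))
    (i j k : Fin m) : ℝ :=
  (1 / 6 : ℝ) * iteratedFDeriv ℝ 3 f x
    ![EuclideanSpace.single i 1, EuclideanSpace.single j 1, EuclideanSpace.single k 1]

/-- The vector with `k`-th entry `∑ⱼ f_{jjk}`, built from the symmetric cubic Taylor coefficients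
of `f` at `x`; it is `Σ_δ` for `f = d` and `Σ_π` for `f = p`. -/
def cubicSum {m : ℕ} (f : EuclideanSpace ℝ (Fin m) → ℝ) (x : EuclideanSpace ℝ (Fin m)) :
    Fin m → ℝ :=
  fun k => ∑ j, cubicCoeff f x j j k

/-- `-(1/4) H₀ [ (tr D₂ / 2) H₂⁻¹ d₁ + 3 H₂⁻¹ (Σ_π + (1/2) d₀ Σ_δ) ]`, where the letters stand for
the Taylor data at `x` of `H`, `d`, `p`. -/
def baseCorrection {m : ℕ} (H d p : EuclideanSpace ℝ (Fin m) → ℝ)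
    (x : EuclideanSpace ℝ (Fin m)) : EuclideanSpace ℝ (Fin m) :=
  WithLp.toLp 2 (-((1 / 4 : ℝ) * H x) •
    (((halfHessian d x).trace / 2) • Matrix.mulVec (halfHessian H x)⁻¹ (grad d x)
      + (3 : ℝ) • Matrix.mulVec (halfHessian H x)⁻¹
          (cubicSum p x + ((1 / 2 : ℝ) * d x) • cubicSum d x)))

/-- `-(1/8) H₀ [ (1/2) tr D₂ d₁ᵗ H₂⁻¹ d₁ + 3 d₁ᵗ H₂⁻¹ (Σ_π + (1/2) d₀ Σ_δ) ] + (1/24) H₀² tr D₂`,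
where the letters stand for the Taylor data at `x` of `H`, `d`, `p`. -/
def heightCorrection {m : ℕ} (H d p : EuclideanSpace ℝ (Fin m) → ℝ)
    (x : EuclideanSpace ℝ (Fin m)) : ℝ :=
  -((1 / 8 : ℝ) * H x) *
    ((1 / 2 : ℝ) * (halfHessian d x).trace
        * dotProduct (grad d x) (Matrix.mulVec (halfHessian H x)⁻¹ (grad d x))
      + 3 * dotProduct (grad d x) (Matrix.mulVec (halfHessian H x)⁻¹
          (cubicSum p x + ((1 / 2 : ℝ) * d x) • cubicSum d x)))
    + (1 / 24 : ℝ) * H x ^ 2 * (halfHessian d x).trace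

end

end ThinDomain

namespace ThinDomain

open Filter Topology Set InnerProductSpace Asymptotics

/-! ### Second derivatives along lines, and the comparison principle for the Laplacian -/

section MaximumPrinciple

variable {E : Type*} [NormedAddCommGroup E] [InnerProductSpace ℝ E]

/-! Write `s` for the height. Over each fibre the leading part of `u` is the parabola `(ε h₊ - s)(s
+ ε h₋) = ε² p + ε d s - s²`. Multiplying it by `1 + ε² a + ε b s`, with `a = Δp/2 + d Δd/6` and `b
= Δd/6`, cancels every term of the Laplacian below order `ε⁴` except the constant `-2`, and keeps
the zero boundary values. This product is `approx`, and the cancellation is `laplacian_approx`.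

Three facts come from comparison with explicit barriers. Away from the peak, a parabola with
slightly enlarged frozen heights shows that `u` is smaller than `ε² H₀²/4` by a fixed multiple of
`ε²` (`Profile.exists_le_of_lt`). Near the peak, a barrier with the weight `(Λ ε² + ‖y - y₀‖²)²`
gives `|u - approx| ≤ C ε² (ε² + ‖y - y₀‖²)²` (`Profile.exists_abs_sub_approx_le`): the error is
only `O(ε²)` on the lateral boundary but `O(ε⁶)` within distance `O(ε)` of `y₀`. Comparing the value
at a maximizer with the value at the middle of the thickest fibre, and using the quadratic decay of
`H`, then places every maximizer within `O(ε)` of that middle, in rescaled variables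
(`Peak.exists_maximizer_close`).

There a ball of radius comparable to `ε` fits inside the domain. The interior gradient estimate
`abs_fderiv_apply_le`, applied to `u - approx` with values `O(ε⁶)` and Laplacian `O(ε⁴)`, gives a
gradient `O(ε⁵)`. Since `∇u = 0` at a maximizer, `approx` is almost critical there
(`Peak.exists_abs_fderiv_approx_le`).

What remains is algebra on an explicit function. The vertical equation determines `d - 2ξ` to order
`ε²`. Inserting this into the horizontal equations and using `p = (H² - d²)/4` turns them into an
expansion of `∇H` at the maximizer. Inverting the Hessian of `H` gives the base point, in two passes
because the linearization error is the square of the current bound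
(`AlmostCritical.base_expansion_apply`). The height and the value follow by substitution.
Asymptotics are taken along `maximizerFilter`, which ranges over solutions and maximizers as well as
`ε`, so the constants are uniform. -/

theorem hasDerivAt_comp_line {f : E → ℝ} {x e : E} (hf : ContDiffAt ℝ 2 f x) :
    ∀ᶠ t : ℝ in 𝓝 0, HasDerivAt (fun t : ℝ => f (x + t • e)) (fderiv ℝ f (x + t • e) e) t := by
  have hcont : Tendsto (fun t : ℝ => x + t • e) (𝓝 0) (𝓝 x) := by
    have : Continuous fun t : ℝ => x + t • e := by fun_prop
    simpa using this.tendsto 0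
  filter_upwards [hcont.eventually (hf.eventually (by simp))] with t ht
  have h1 : HasDerivAt (fun t : ℝ => x + t • e) e t := by
    simpa using ((hasDerivAt_id t).smul_const e).const_add x
  exact (ht.differentiableAt (by simp)).hasFDerivAt.comp_hasDerivAt t h1

theorem hasDerivAt_fderiv_comp_line {f : E → ℝ} {x e : E} (hf : ContDiffAt ℝ 2 f x) :
    HasDerivAt (fun t : ℝ => fderiv ℝ f (x + t • e) e) (fderiv ℝ (fderiv ℝ f) x e e) 0 := by
  have h1 : HasDerivAt (fun t : ℝ => x + t • e) e 0 := by
    simpa using ((hasDerivAt_id (0 : ℝ)).smul_const e).const_add x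
  have h2 : DifferentiableAt ℝ (fderiv ℝ f) x :=
    (hf.fderiv_right (m := 1) (by norm_num)).differentiableAt (by simp)
  have h3 : HasFDerivAt (fderiv ℝ f) (fderiv ℝ (fderiv ℝ f) x) (x + (0 : ℝ) • e) := by
    simpa using h2.hasFDerivAt
  have h4 : HasDerivAt (fun t : ℝ => fderiv ℝ f (x + t • e)) (fderiv ℝ (fderiv ℝ f) x e) 0 :=
    h3.comp_hasDerivAt (0 : ℝ) h1
  simpa using h4.clm_apply (hasDerivAt_const (0 : ℝ) e)

/-- Second derivatives of `f` can be computed along lines. -/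
theorem fderiv_fderiv_eq_of_line {f : E → ℝ} {x e : E} (hf : ContDiffAt ℝ 2 f x)
    {φ : ℝ → ℝ} {c : ℝ}
    (h1 : ∀ᶠ t : ℝ in 𝓝 0, HasDerivAt (fun t : ℝ => f (x + t • e)) (φ t) t)
    (h2 : HasDerivAt φ c 0) : fderiv ℝ (fderiv ℝ f) x e e = c := by
  have h : φ =ᶠ[𝓝 0] fun t : ℝ => fderiv ℝ f (x + t • e) e := by
    filter_upwards [h1, hasDerivAt_comp_line (e := e) hf] with t ht ht'
    exact ht.unique ht'
  exact ((hasDerivAt_fderiv_comp_line hf).congr_of_eventuallyEq h).unique h2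

/-- A positive second derivative along a line would make the point a local minimum of the
restriction as well. The restriction would then be locally constant, with second derivative zero. -/
theorem fderiv_fderiv_nonpos_of_isLocalMax {f : E → ℝ} {x : E} (hf : ContDiffAt ℝ 2 f x)
    (hmax : IsLocalMax f x) (e : E) : fderiv ℝ (fderiv ℝ f) x e e ≤ 0 := by
  by_contra! hpos
  set φ : ℝ → ℝ := fun t => f (x + t • e) with hφ
  have hcont : Tendsto (fun t : ℝ => x + t • e) (𝓝 0) (𝓝 x) := by
    have : Continuous fun t : ℝ => x + t • e := by fun_prop
    simpa using this.tendsto 0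
  have hφmax : ∀ᶠ t in 𝓝 (0 : ℝ), φ t ≤ φ 0 := by
    simpa [hφ] using hcont.eventually hmax
  have hd : deriv φ =ᶠ[𝓝 0] fun t : ℝ => fderiv ℝ f (x + t • e) e := by
    filter_upwards [hasDerivAt_comp_line (e := e) hf] with t ht using ht.deriv
  have hdd : deriv (deriv φ) 0 = fderiv ℝ (fderiv ℝ f) x e e := by
    rw [hd.deriv_eq, (hasDerivAt_fderiv_comp_line hf).deriv]
  have hmax0 : IsLocalMax φ 0 := hφmax
  have hmin : IsLocalMin φ 0 := by
    refine isLocalMin_of_deriv_deriv_pos (by rw [hdd]; exact hpos) hmax0.deriv_eq_zero ?_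
    exact (hasDerivAt_comp_line (e := e) hf).self_of_nhds.continuousAt
  have hconst : φ =ᶠ[𝓝 0] fun _ => φ 0 := by
    filter_upwards [hmax0, hmin] with t h1 h2 using le_antisymm h1 h2
  have : deriv (deriv φ) 0 = 0 := by
    rw [hconst.deriv.deriv_eq]; simp
  linarith

variable [FiniteDimensional ℝ E]

theorem laplacian_eq_sum_fderiv {ι : Type*} [Fintype ι] (v : OrthonormalBasis ι ℝ E) (f : E → ℝ)
    (x : E) : Laplacian.laplacian f x = ∑ i, fderiv ℝ (fderiv ℝ f) x (v i) (v i) := by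
  simp [laplacian_eq_iteratedFDeriv_orthonormalBasis f v, iteratedFDeriv_two_apply]

theorem laplacian_nonpos_of_isLocalMax {f : E → ℝ} {x : E} (hf : ContDiffAt ℝ 2 f x)
    (hmax : IsLocalMax f x) : Laplacian.laplacian f x ≤ 0 := by
  rw [laplacian_eq_sum_fderiv (stdOrthonormalBasis ℝ E)]
  exact Finset.sum_nonpos fun i _ => fderiv_fderiv_nonpos_of_isLocalMax hf hmax _

/-- Comparison principle for the Laplacian with strict inequality. -/
theorem le_of_laplacian_lt {D : Set E} (hD : IsOpen D) (hb : Bornology.IsBounded D)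
    {u B : E → ℝ} (hu : ContinuousOn u (closure D)) (hB : ContinuousOn B (closure D))
    (hu2 : ∀ x ∈ D, ContDiffAt ℝ 2 u x) (hB2 : ∀ x ∈ D, ContDiffAt ℝ 2 B x)
    (hlap : ∀ x ∈ D, Laplacian.laplacian B x < Laplacian.laplacian u x)
    (hbd : ∀ x ∈ closure D, x ∉ D → u x ≤ B x) : ∀ x ∈ closure D, u x ≤ B x := by
  intro x hx
  obtain ⟨q, hq, hqmax⟩ := (hb.isCompact_closure).exists_isMaxOn ⟨x, hx⟩ (hu.sub hB)
  have hq0 : u q ≤ B q := by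
    by_cases hqD : q ∈ D
    · exfalso
      have hloc : IsLocalMax (u - B) q :=
        (hqmax.on_subset subset_closure).isLocalMax (hD.mem_nhds hqD)
      have := laplacian_nonpos_of_isLocalMax ((hu2 q hqD).sub (hB2 q hqD)) hloc
      have hsub := (hu2 q hqD).laplacian_sub (hB2 q hqD)
      change Laplacian.laplacian (u - B) q ≤ 0 at this
      linarith [hlap q hqD]
    · exact hbd q hq hqD
  have : u x - B x ≤ u q - B q := hqmax hx
  linarith

/-- The Laplacian of a quadratic function which depends on the norm and one coordinate. -/
theorem laplacian_quadratic (x₀ e : E) (he : ‖e‖ = 1) (α β γ : ℝ) (x : E) :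
    Laplacian.laplacian (fun y : E => α * ‖y - x₀‖ ^ 2 + β * inner ℝ e (y - x₀)
      + γ * inner ℝ e (y - x₀) ^ 2) x = 2 * Module.finrank ℝ E * α + 2 * γ := by
  have hC : ContDiff ℝ 2 (fun y : E => α * ‖y - x₀‖ ^ 2 + β * inner ℝ e (y - x₀)
      + γ * inner ℝ e (y - x₀) ^ 2) := by
    have h0 : ContDiff ℝ 2 fun y : E => y - x₀ := by fun_prop
    have h1 : ContDiff ℝ 2 fun y : E => ‖y - x₀‖ ^ 2 := h0.norm_sq ℝ
    have h2 : ContDiff ℝ 2 fun y : E => (inner ℝ e (y - x₀) : ℝ) := contDiff_const.inner ℝ h0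
    fun_prop
  rw [laplacian_eq_sum_fderiv (stdOrthonormalBasis ℝ E)]
  have key : ∀ v : E, ‖v‖ = 1 → fderiv ℝ (fderiv ℝ (fun y : E => α * ‖y - x₀‖ ^ 2
      + β * inner ℝ e (y - x₀) + γ * inner ℝ e (y - x₀) ^ 2)) x v v
      = 2 * α + 2 * γ * inner ℝ e v ^ 2 := by
    intro v hv
    refine fderiv_fderiv_eq_of_line hC.contDiffAt
      (φ := fun t => α * (2 * inner ℝ (x - x₀) v + 2 * t) + β * inner ℝ e v
        + γ * (2 * (inner ℝ e (x - x₀) + t * inner ℝ e v) * inner ℝ e v)) ?_ ?_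
    · refine Eventually.of_forall fun t => ?_
      have hfun : (fun t : ℝ => α * ‖x + t • v - x₀‖ ^ 2 + β * inner ℝ e (x + t • v - x₀)
          + γ * inner ℝ e (x + t • v - x₀) ^ 2)
          = fun t : ℝ => α * (‖x - x₀‖ ^ 2 + 2 * (t * inner ℝ (x - x₀) v) + t ^ 2)
            + β * (inner ℝ e (x - x₀) + t * inner ℝ e v)
            + γ * (inner ℝ e (x - x₀) + t * inner ℝ e v) ^ 2 := by
        funext t
        have : x + t • v - x₀ = (x - x₀) + t • v := by abel
        rw [this, norm_add_sq_real, inner_add_right, inner_smul_right, inner_smul_right, norm_smul,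
          hv, mul_one, Real.norm_eq_abs, sq_abs]
      rw [hfun]
      have hl : HasDerivAt (fun t : ℝ => t * (inner ℝ e v : ℝ)) (inner ℝ e v) t := by
        simpa using (hasDerivAt_id t).mul_const (inner ℝ e v : ℝ)
      have hl' : HasDerivAt (fun t : ℝ => t * (inner ℝ (x - x₀) v : ℝ)) (inner ℝ (x - x₀) v) t := by
        simpa using (hasDerivAt_id t).mul_const (inner ℝ (x - x₀) v : ℝ)
      refine HasDerivAt.congr_deriv ((((((hl'.const_mul 2).const_add (‖x - x₀‖ ^ 2)).add
        ((hasDerivAt_id t).pow 2)).const_mul α).add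
        ((hl.const_add (inner ℝ e (x - x₀))).const_mul β)).add
        (((hl.const_add (inner ℝ e (x - x₀))).pow 2).const_mul γ)) ?_
      simp
    · have hl : HasDerivAt (fun t : ℝ => t * (inner ℝ e v : ℝ)) (inner ℝ e v) 0 := by
        simpa using (hasDerivAt_id (0 : ℝ)).mul_const (inner ℝ e v : ℝ)
      refine HasDerivAt.congr_deriv ((((((hasDerivAt_id (0 : ℝ)).const_mul 2).const_add
        (2 * inner ℝ (x - x₀) v)).const_mul α).add_const (β * inner ℝ e v)).add
        (((((hl.const_add (inner ℝ e (x - x₀))).const_mul 2).mul_const (inner ℝ e v))).const_mul γ))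
        ?_
      ring
  rw [Finset.sum_congr rfl fun i _ => key _ ((stdOrthonormalBasis ℝ E).norm_eq_one i),
    Finset.sum_add_distrib]
  have hs : ∑ i, inner ℝ e (stdOrthonormalBasis ℝ E i) ^ 2 = ‖e‖ ^ 2 := by
    rw [← (stdOrthonormalBasis ℝ E).sum_sq_norm_inner_left e]
    simp
  rw [← Finset.mul_sum _ _ (2 * γ), hs, he]
  simp
  ring

/-- The Laplacian may be computed in any orthonormal basis. Taking the image under `R` of the
standard one matches the second derivatives term by term. -/
theorem laplacian_comp_isometry {w : E → ℝ} {x₀ : E} (R : E ≃ₗᵢ[ℝ] E) {y : E}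
    (hw : ContDiffAt ℝ 2 w (x₀ + R (y - x₀))) :
    Laplacian.laplacian (fun y => w (x₀ + R (y - x₀))) y
      = Laplacian.laplacian w (x₀ + R (y - x₀)) := by
  have hσ : ContDiff ℝ 2 fun y => x₀ + R (y - x₀) :=
    contDiff_const.add (R.contDiff.comp (contDiff_id.sub contDiff_const))
  rw [laplacian_eq_sum_fderiv (stdOrthonormalBasis ℝ E),
    laplacian_eq_sum_fderiv ((stdOrthonormalBasis ℝ E).map R)]
  refine Finset.sum_congr rfl fun i _ => ?_
  set v := stdOrthonormalBasis ℝ E i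
  have hR : ((stdOrthonormalBasis ℝ E).map R) i = R v := by simp [v]
  rw [hR]
  have hcomp : ContDiffAt ℝ 2 (fun y => w (x₀ + R (y - x₀))) y := hw.comp y hσ.contDiffAt
  refine fderiv_fderiv_eq_of_line hcomp ?_ (hasDerivAt_fderiv_comp_line hw)
  have hfun : (fun t : ℝ => w (x₀ + R (y + t • v - x₀)))
      = fun t : ℝ => w (x₀ + R (y - x₀) + t • R v) := by
    funext t
    have : y + t • v - x₀ = (y - x₀) + t • v := by abel
    rw [this, map_add, map_smul, add_assoc]
  rw [hfun]
  exact hasDerivAt_comp_line hw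

end MaximumPrinciple

/-! ### Interior gradient estimate by reflection -/

section GradientEstimate

variable {E : Type*} [NormedAddCommGroup E] [InnerProductSpace ℝ E] [FiniteDimensional ℝ E]

/-- The difference of `w` and its reflection in the hyperplane through `x₀` orthogonal to `e`
vanishes on that hyperplane. On the half ball `D` it can be compared with a quadratic that vanishes
at `x₀`, so the difference quotient in direction `e` is controlled. -/
theorem apply_add_sub_apply_sub_le {w : E → ℝ} {x₀ e : E} {ρ M N : ℝ} (hρ : 0 < ρ) (he : ‖e‖ = 1)
    (hw : ∀ y ∈ Metric.closedBall x₀ ρ, ContDiffAt ℝ 2 w y)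
    (hM : ∀ y ∈ Metric.closedBall x₀ ρ, |w y| ≤ M)
    (hN : ∀ y ∈ Metric.closedBall x₀ ρ, |Laplacian.laplacian w y| < N) {t : ℝ} (ht0 : 0 ≤ t)
    (htρ : t ≤ ρ) :
    w (x₀ + t • e) - w (x₀ - t • e) ≤
      2 * M / ρ ^ 2 * (t ^ 2 + Module.finrank ℝ E * (t * (ρ - t))) + N * (t * (ρ - t)) := by
  set R : E ≃ₗᵢ[ℝ] E := (ℝ ∙ e)ᗮ.reflection with hR
  have hRv : ∀ v : E, R v = v - (2 * inner ℝ e v) • e := by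
    intro v
    rw [hR, Submodule.reflection_orthogonal_apply, Submodule.reflection_singleton_apply, he]
    simp [two_smul, two_mul, add_smul]
  set n : ℝ := (Module.finrank ℝ E : ℝ) with hn
  set D : Set E := {y | dist y x₀ < ρ ∧ 0 < inner ℝ e (y - x₀)} with hDdef
  -- With `σ = ⟪e, y - x₀⟫` this is `(2M/ρ²)(‖y - x₀‖² + n σ (ρ - σ)) + N σ (ρ - σ)`. Its Laplacian
  -- is exactly `-2N`, strictly below that of the difference of `w` and its reflection.
  set B : E → ℝ := fun y => (2 * M / ρ ^ 2) * ‖y - x₀‖ ^ 2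
    + ((2 * M / ρ ^ 2) * n * ρ + N * ρ) * inner ℝ e (y - x₀)
    + (-((2 * M / ρ ^ 2) * n + N)) * inner ℝ e (y - x₀) ^ 2 with hB
  have hM0 : 0 ≤ M := (abs_nonneg _).trans (hM x₀ (Metric.mem_closedBall_self hρ.le))
  have hN0 : 0 < N := (abs_nonneg _).trans_lt (hN x₀ (Metric.mem_closedBall_self hρ.le))
  have hn0 : 0 ≤ n := Nat.cast_nonneg _
  have hDo : IsOpen D := by
    have h1 : Continuous fun y : E => dist y x₀ := by fun_prop
    have h2 : Continuous fun y : E => (inner ℝ e (y - x₀) : ℝ) := by fun_prop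
    exact (isOpen_lt h1 continuous_const).inter (isOpen_lt continuous_const h2)
  have hDcl : closure D ⊆ {y | dist y x₀ ≤ ρ ∧ 0 ≤ inner ℝ e (y - x₀)} := by
    have h1 : Continuous fun y : E => dist y x₀ := by fun_prop
    have h2 : Continuous fun y : E => (inner ℝ e (y - x₀) : ℝ) := by fun_prop
    exact closure_minimal (fun y hy => ⟨hy.1.le, hy.2.le⟩)
      ((isClosed_le h1 continuous_const).inter (isClosed_le continuous_const h2))
  have hDb : Bornology.IsBounded D := Metric.isBounded_ball.subset fun y hy => hy.1
  have hσ : ∀ y ∈ Metric.closedBall x₀ ρ, x₀ + R (y - x₀) ∈ Metric.closedBall x₀ ρ := by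
    intro y hy
    rw [Metric.mem_closedBall, dist_eq_norm] at hy ⊢
    rwa [add_sub_cancel_left, R.norm_map]
  have hσC : ContDiff ℝ 2 fun y => x₀ + R (y - x₀) :=
    contDiff_const.add (R.contDiff.comp (contDiff_id.sub contDiff_const))
  have hC2 : ∀ y ∈ Metric.closedBall x₀ ρ,
      ContDiffAt ℝ 2 (fun y => w (x₀ + R (y - x₀))) y := fun y hy =>
    (hw _ (hσ y hy)).comp y hσC.contDiffAt
  have hu2 : ∀ y ∈ Metric.closedBall x₀ ρ,
      ContDiffAt ℝ 2 (w - fun y => w (x₀ + R (y - x₀))) y := fun y hy =>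
    (hw y hy).sub (hC2 y hy)
  have hBC : ContDiff ℝ 2 B := by
    have h0 : ContDiff ℝ 2 fun y : E => y - x₀ := by fun_prop
    have h1 : ContDiff ℝ 2 fun y : E => ‖y - x₀‖ ^ 2 := h0.norm_sq ℝ
    have h2 : ContDiff ℝ 2 fun y : E => (inner ℝ e (y - x₀) : ℝ) := contDiff_const.inner ℝ h0
    fun_prop
  have hle : ∀ y ∈ closure D, (w - fun y => w (x₀ + R (y - x₀))) y ≤ B y := by
    refine le_of_laplacian_lt hDo hDb
      (fun y hy => (hu2 y (hDcl hy).1).continuousAt.continuousWithinAt)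
      hBC.continuous.continuousOn (fun y hy => hu2 y hy.1.le) (fun y _ => hBC.contDiffAt) ?_ ?_
    · intro y hy
      have hyc : y ∈ Metric.closedBall x₀ ρ := hy.1.le
      rw [hB, laplacian_quadratic x₀ e he, (hw y hyc).laplacian_sub (hC2 y hyc),
        laplacian_comp_isometry R (hw _ (hσ y hyc))]
      have h1 := abs_lt.1 (hN y hyc)
      have h2 := abs_lt.1 (hN _ (hσ y hyc))
      linarith [h1.1, h2.2]
    · intro y hy hyD
      obtain ⟨h1, h2⟩ := hDcl hy
      have hs : (inner ℝ e (y - x₀) : ℝ) ≤ ‖y - x₀‖ := by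
        simpa [he] using real_inner_le_norm e (y - x₀)
      rw [dist_eq_norm] at h1
      have hBeq : B y = (2 * M / ρ ^ 2) * ‖y - x₀‖ ^ 2 + ((2 * M / ρ ^ 2) * n + N)
          * (inner ℝ e (y - x₀) * (ρ - inner ℝ e (y - x₀))) := by
        simp only [hB]; ring
      have hprod : 0 ≤ ((2 * M / ρ ^ 2) * n + N)
          * (inner ℝ e (y - x₀) * (ρ - inner ℝ e (y - x₀))) := by
        have : (0 : ℝ) ≤ ρ - inner ℝ e (y - x₀) := by linarith
        positivity
      by_cases h0 : (inner ℝ e (y - x₀) : ℝ) = 0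
      · have hfix : x₀ + R (y - x₀) = y := by rw [hRv, h0]; simp
        rw [hBeq]
        simp only [Pi.sub_apply, hfix, sub_self]
        positivity
      -- Off the hyperplane only the spherical part of the boundary is left; there the first term of
      -- `B` equals `2M`, enough for a difference of two values bounded by `M`.
      · have hρy : ‖y - x₀‖ = ρ := by
          refine le_antisymm h1 (not_lt.1 fun hlt => hyD ⟨by rwa [dist_eq_norm], ?_⟩)
          exact lt_of_le_of_ne h2 (Ne.symm h0)
        have hyc : y ∈ Metric.closedBall x₀ ρ := by
          rw [Metric.mem_closedBall, dist_eq_norm]; exact h1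
        have h3 := abs_le.1 (hM y hyc)
        have h4 := abs_le.1 (hM _ (hσ y hyc))
        have h5 : (2 * M / ρ ^ 2) * ‖y - x₀‖ ^ 2 = 2 * M := by rw [hρy]; field_simp
        rw [hBeq, h5]
        simp only [Pi.sub_apply]
        linarith [h3.2, h4.1]
  have hee : (inner ℝ e e : ℝ) = 1 := by rw [real_inner_self_eq_norm_sq, he]; norm_num
  have hmem : x₀ + t • e ∈ closure D := by
    rcases ht0.eq_or_lt with h0 | h0
    · refine mem_closure_of_tendsto (f := fun s : ℝ => x₀ + s • e) (b := 𝓝[>] 0) ?_ ?_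
      · have : Continuous fun s : ℝ => x₀ + s • e := by fun_prop
        simpa [← h0] using (this.tendsto 0).mono_left nhdsWithin_le_nhds
      · filter_upwards [Ioo_mem_nhdsGT hρ] with s hs
        refine ⟨?_, ?_⟩
        · simpa [dist_eq_norm, norm_smul, he, abs_of_pos hs.1] using hs.2
        · simpa [inner_smul_right, he] using hs.1
    · refine mem_closure_of_tendsto (f := fun s : ℝ => x₀ + s • e) (b := 𝓝[<] t) ?_ ?_
      · have : Continuous fun s : ℝ => x₀ + s • e := by fun_prop
        exact (this.tendsto t).mono_left nhdsWithin_le_nhds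
      · filter_upwards [Ioo_mem_nhdsLT h0] with s hs
        refine ⟨?_, ?_⟩
        · simpa [dist_eq_norm, norm_smul, he, abs_of_pos hs.1] using hs.2.trans_le htρ
        · simpa [inner_smul_right, he] using hs.1
  have := hle _ hmem
  have hRe : x₀ + R (x₀ + t • e - x₀) = x₀ - t • e := by
    rw [add_sub_cancel_left, hRv]; simp only [inner_smul_right, hee]; module
  rw [Pi.sub_apply, hRe] at this
  simp only [hB, add_sub_cancel_left, inner_smul_right, hee, norm_smul, he,
    Real.norm_eq_abs, mul_one, sq_abs] at this
  linarith

/-- Interior gradient estimate for the Poisson equation. -/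
theorem abs_fderiv_apply_le {w : E → ℝ} {x₀ e : E} {ρ M N : ℝ} (hρ : 0 < ρ) (he : ‖e‖ = 1)
    (hw : ∀ y ∈ Metric.closedBall x₀ ρ, ContDiffAt ℝ 2 w y)
    (hM : ∀ y ∈ Metric.closedBall x₀ ρ, |w y| ≤ M)
    (hN : ∀ y ∈ Metric.closedBall x₀ ρ, |Laplacian.laplacian w y| < N) :
    |fderiv ℝ w x₀ e| ≤ Module.finrank ℝ E * M / ρ + N * ρ / 2 := by
  have key : ∀ e : E, ‖e‖ = 1 →
      fderiv ℝ w x₀ e ≤ Module.finrank ℝ E * M / ρ + N * ρ / 2 := by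
    intro e he
    set n : ℝ := (Module.finrank ℝ E : ℝ)
    have hd : HasFDerivAt w (fderiv ℝ w x₀) x₀ :=
      ((hw x₀ (Metric.mem_closedBall_self hρ.le)).differentiableAt (by simp)).hasFDerivAt
    have hl1 : HasDerivAt (fun t : ℝ => w (x₀ + t • e)) (fderiv ℝ w x₀ e) 0 := by
      have h1 : HasDerivAt (fun t : ℝ => x₀ + t • e) e 0 := by
        simpa using ((hasDerivAt_id (0 : ℝ)).smul_const e).const_add x₀
      exact HasFDerivAt.comp_hasDerivAt (0 : ℝ) (by simpa using hd) h1
    have hl2 : HasDerivAt (fun t : ℝ => w (x₀ - t • e)) (fderiv ℝ w x₀ (-e)) 0 := by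
      have h1 : HasDerivAt (fun t : ℝ => x₀ - t • e) (-e) 0 := by
        simpa using ((hasDerivAt_id (0 : ℝ)).smul_const e).const_sub x₀
      exact HasFDerivAt.comp_hasDerivAt (0 : ℝ) (by simpa using hd) h1
    have hl3 : HasDerivAt (fun t : ℝ => 2 * M / ρ ^ 2 * (t ^ 2 + n * (t * (ρ - t)))
        + N * (t * (ρ - t))) (2 * M / ρ ^ 2 * (n * ρ) + N * ρ) 0 := by
      have h1 : HasDerivAt (fun t : ℝ => t * (ρ - t)) ρ 0 := by
        refine HasDerivAt.congr_deriv ((hasDerivAt_id (0 : ℝ)).mul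
          ((hasDerivAt_id (0 : ℝ)).const_sub ρ)) (by simp)
      have h2 : HasDerivAt (fun t : ℝ => t ^ 2) 0 0 := by simpa using hasDerivAt_pow 2 (0 : ℝ)
      refine HasDerivAt.congr_deriv (((h2.add (h1.const_mul n)).const_mul (2 * M / ρ ^ 2)).add
        (h1.const_mul N)) (by ring)
    have hl := (hl3.sub (hl1.sub hl2))
    -- Both sides of `apply_add_sub_apply_sub_le` vanish at `t = 0`, so the inequality passes to
    -- right derivatives there; the left side contributes twice the derivative of `w` in direction
    -- `e`.
    have hpos : 0 ≤ 2 * M / ρ ^ 2 * (n * ρ) + N * ρ - (fderiv ℝ w x₀ e - fderiv ℝ w x₀ (-e)) := by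
      have hslope := (hasDerivAt_iff_tendsto_slope.1 hl).mono_left
        (nhdsWithin_mono (0 : ℝ) (s := Ioi 0) (fun s (hs : 0 < s) => hs.ne'))
      refine ge_of_tendsto hslope ?_
      filter_upwards [Ioo_mem_nhdsGT hρ] with t ht
      have := apply_add_sub_apply_sub_le hρ he hw hM hN ht.1.le ht.2.le
      rw [slope_def_field]
      refine div_nonneg ?_ (by linarith [ht.1])
      simp only [Pi.sub_apply]
      simp only [zero_smul, add_zero, sub_zero, sub_self, zero_mul, mul_zero, ne_eq,
        OfNat.ofNat_ne_zero, not_false_eq_true, zero_pow]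
      linarith
    rw [map_neg] at hpos
    have h5 : 2 * M / ρ ^ 2 * (n * ρ) = 2 * (n * M / ρ) := by field_simp
    linarith
  refine abs_le.2 ⟨?_, key e he⟩
  have := key (-e) (by simpa using he)
  rw [map_neg] at this
  linarith

end GradientEstimate

/-! ### Splitting a point into base and height; Laplacians of products -/

section Product

variable {m : ℕ}

/-- `base` as a continuous linear map. -/
noncomputable def baseL (m : ℕ) : EuclideanSpace ℝ (Fin (m + 1)) →L[ℝ] EuclideanSpace ℝ (Fin m) :=
  LinearMap.toContinuousLinearMap
    { toFun := base
      map_add' := fun x y => by ext i; simp [base]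
      map_smul' := fun c x => by ext i; simp [base] }

/-- `height` as a continuous linear map. -/
noncomputable def heightL (m : ℕ) : EuclideanSpace ℝ (Fin (m + 1)) →L[ℝ] ℝ :=
  LinearMap.toContinuousLinearMap
    { toFun := height
      map_add' := fun x y => by simp [height]
      map_smul' := fun c x => by simp [height] }

@[simp] theorem baseL_apply (x : EuclideanSpace ℝ (Fin (m + 1))) : baseL m x = base x := rfl

@[simp] theorem heightL_apply (x : EuclideanSpace ℝ (Fin (m + 1))) : heightL m x = height x := rfl

theorem contDiff_base {n : WithTop ℕ∞} :
    ContDiff ℝ n (base : EuclideanSpace ℝ (Fin (m + 1)) → EuclideanSpace ℝ (Fin m)) :=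
  (baseL m).contDiff

theorem contDiff_height {n : WithTop ℕ∞} :
    ContDiff ℝ n (height : EuclideanSpace ℝ (Fin (m + 1)) → ℝ) :=
  (heightL m).contDiff

theorem continuous_base :
    Continuous (base : EuclideanSpace ℝ (Fin (m + 1)) → EuclideanSpace ℝ (Fin m)) :=
  (baseL m).continuous

theorem continuous_height : Continuous (height : EuclideanSpace ℝ (Fin (m + 1)) → ℝ) :=
  (heightL m).continuous

theorem norm_sq_eq_base_height (x : EuclideanSpace ℝ (Fin (m + 1))) :
    ‖x‖ ^ 2 = ‖base x‖ ^ 2 + height x ^ 2 := by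
  simp [EuclideanSpace.norm_sq_eq, Fin.sum_univ_castSucc, base, height]

/-- The point of `ℝⁿ` with given base point and height. -/
noncomputable def join (y : EuclideanSpace ℝ (Fin m)) (s : ℝ) : EuclideanSpace ℝ (Fin (m + 1)) :=
  WithLp.toLp 2 (Fin.snoc (α := fun _ => ℝ) y.ofLp s)

@[simp] theorem base_join (y : EuclideanSpace ℝ (Fin m)) (s : ℝ) : base (join y s) = y := by
  ext i; simp [base, join]

@[simp] theorem height_join (y : EuclideanSpace ℝ (Fin m)) (s : ℝ) : height (join y s) = s := by
  simp [height, join]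

theorem norm_join_zero (y : EuclideanSpace ℝ (Fin m)) : ‖join y 0‖ = ‖y‖ := by
  have := norm_sq_eq_base_height (join y 0)
  simp only [base_join, height_join, ne_eq, OfNat.ofNat_ne_zero, not_false_eq_true, zero_pow,
    add_zero] at this
  exact (pow_left_inj₀ (norm_nonneg _) (norm_nonneg _) two_ne_zero).1 this

theorem norm_join_base_zero (s : ℝ) : ‖join (0 : EuclideanSpace ℝ (Fin m)) s‖ = |s| := by
  have := norm_sq_eq_base_height (join (0 : EuclideanSpace ℝ (Fin m)) s)
  simp only [base_join, height_join, norm_zero, ne_eq, OfNat.ofNat_ne_zero, not_false_eq_true,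
    zero_pow, zero_add] at this
  rw [← sq_abs s] at this
  exact (pow_left_inj₀ (norm_nonneg _) (abs_nonneg _) two_ne_zero).1 this

theorem single_castSucc_eq (i : Fin m) : (EuclideanSpace.single i.castSucc (1 : ℝ))
    = join (EuclideanSpace.single i 1) 0 := by
  ext j
  refine Fin.lastCases ?_ (fun k => ?_) j
  · simp [join, (Fin.castSucc_ne_last i).symm]
  · simp [join, Pi.single_apply]

theorem single_last_eq : (EuclideanSpace.single (Fin.last m) (1 : ℝ)) = join 0 1 := by
  ext j
  refine Fin.lastCases ?_ (fun k => ?_) j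
  · simp [join]
  · simp [join, Fin.castSucc_ne_last]

theorem norm_base_sub_le (x y : EuclideanSpace ℝ (Fin (m + 1))) :
    ‖base x - base y‖ ≤ ‖x - y‖ := by
  have h := norm_sq_eq_base_height (x - y)
  have hb : base (x - y) = base x - base y := map_sub (baseL m) x y
  rw [hb] at h
  exact (pow_le_pow_iff_left₀ (norm_nonneg _) (norm_nonneg _) two_ne_zero).1
    (by nlinarith [sq_nonneg (height (x - y))])

theorem abs_height_sub_le (x y : EuclideanSpace ℝ (Fin (m + 1))) :
    |height x - height y| ≤ ‖x - y‖ := by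
  have h := norm_sq_eq_base_height (x - y)
  have hb : height (x - y) = height x - height y := map_sub (heightL m) x y
  rw [hb] at h
  refine abs_le_of_sq_le_sq (by nlinarith [sq_nonneg ‖base (x - y)‖]) (norm_nonneg _)

theorem contDiffAt_mul_comp {f : EuclideanSpace ℝ (Fin m) → ℝ} {g : ℝ → ℝ} {n : WithTop ℕ∞}
    {x : EuclideanSpace ℝ (Fin (m + 1))}
    (hf : ContDiffAt ℝ n f (base x)) (hg : ContDiffAt ℝ n g (height x)) :
    ContDiffAt ℝ n (fun x => f (base x) * g (height x)) x :=
  (hf.comp x contDiff_base.contDiffAt).mul (hg.comp x contDiff_height.contDiffAt)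

theorem base_add_smul (x v : EuclideanSpace ℝ (Fin (m + 1))) (t : ℝ) :
    base (x + t • v) = base x + t • base v := by
  simpa using map_add (baseL m) x (t • v)

theorem height_add_smul (x v : EuclideanSpace ℝ (Fin (m + 1))) (t : ℝ) :
    height (x + t • v) = height x + t * height v := by
  simpa using map_add (heightL m) x (t • v)

/-- The Laplacian of a product of a function of the base and a function of the height. -/
theorem laplacian_mul_comp {f : EuclideanSpace ℝ (Fin m) → ℝ} {g g' : ℝ → ℝ} {c : ℝ}
    {x : EuclideanSpace ℝ (Fin (m + 1))}
    (hf : ContDiffAt ℝ 2 f (base x)) (hg : ContDiffAt ℝ 2 g (height x))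
    (hg1 : ∀ s, HasDerivAt g (g' s) s) (hg2 : HasDerivAt g' c (height x)) :
    Laplacian.laplacian (fun x => f (base x) * g (height x)) x
      = Laplacian.laplacian f (base x) * g (height x) + f (base x) * c := by
  have hF := contDiffAt_mul_comp hf hg
  rw [laplacian_eq_sum_fderiv (EuclideanSpace.basisFun (Fin (m + 1)) ℝ),
    laplacian_eq_sum_fderiv (EuclideanSpace.basisFun (Fin m) ℝ), Fin.sum_univ_castSucc,
    Finset.sum_mul]
  congr 1
  · refine Finset.sum_congr rfl fun i _ => ?_
    simp only [EuclideanSpace.basisFun_apply, single_castSucc_eq]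
    refine fderiv_fderiv_eq_of_line hF ?_
      ((hasDerivAt_fderiv_comp_line (e := EuclideanSpace.single i (1 : ℝ)) hf).mul_const
        (g (height x)))
    simp only [base_add_smul, height_add_smul, base_join, height_join, mul_zero, add_zero]
    filter_upwards [hasDerivAt_comp_line (e := EuclideanSpace.single i (1 : ℝ)) hf] with t ht
    exact ht.mul_const _
  · simp only [EuclideanSpace.basisFun_apply, single_last_eq]
    have hg2' : HasDerivAt (fun t => g' (height x + t)) c 0 :=
      HasDerivAt.comp_const_add (height x) 0 (by simpa using hg2)
    refine fderiv_fderiv_eq_of_line hF ?_ (hg2'.const_mul (f (base x)))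
    simp only [base_add_smul, height_add_smul, base_join, height_join, mul_one, smul_zero, add_zero]
    exact Eventually.of_forall fun t => ((hg1 _).comp_const_add (height x) t).const_mul _

/-- The Laplacian of a function of the base times a power of the height. -/
theorem laplacian_mul_pow {f : EuclideanSpace ℝ (Fin m) → ℝ} {x : EuclideanSpace ℝ (Fin (m + 1))}
    (hf : ContDiffAt ℝ 2 f (base x)) (k : ℕ) :
    Laplacian.laplacian (fun x => f (base x) * height x ^ k) x
      = Laplacian.laplacian f (base x) * height x ^ k
        + f (base x) * (k * ((k - 1 : ℕ) * height x ^ (k - 1 - 1))) :=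
  laplacian_mul_comp (g := fun s => s ^ k) (g' := fun s => k * s ^ (k - 1)) hf
    (contDiff_id.pow k).contDiffAt (fun s => hasDerivAt_pow k s)
    ((hasDerivAt_pow (k - 1) _).const_mul _)

/-- The Laplacian of `(s + ‖y - y₀‖²)²`. -/
theorem laplacian_quartic (y₀ y : EuclideanSpace ℝ (Fin m)) (s : ℝ) :
    Laplacian.laplacian (fun y => (s + ‖y - y₀‖ ^ 2) ^ 2) y
      = 8 * ‖y - y₀‖ ^ 2 + 4 * m * (s + ‖y - y₀‖ ^ 2) := by
  have hC : ContDiff ℝ 2 (fun y : EuclideanSpace ℝ (Fin m) => (s + ‖y - y₀‖ ^ 2) ^ 2) := by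
    have h0 : ContDiff ℝ 2 fun y : EuclideanSpace ℝ (Fin m) => y - y₀ := by fun_prop
    have h1 : ContDiff ℝ 2 fun y : EuclideanSpace ℝ (Fin m) => ‖y - y₀‖ ^ 2 := h0.norm_sq ℝ
    fun_prop
  rw [laplacian_eq_sum_fderiv (EuclideanSpace.basisFun (Fin m) ℝ)]
  have key : ∀ i : Fin m, fderiv ℝ (fderiv ℝ (fun y : EuclideanSpace ℝ (Fin m) =>
      (s + ‖y - y₀‖ ^ 2) ^ 2)) y (EuclideanSpace.single i 1) (EuclideanSpace.single i 1)
      = 8 * (y - y₀) i ^ 2 + 4 * (s + ‖y - y₀‖ ^ 2) := by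
    intro i
    set b : ℝ := (y - y₀) i with hb
    refine fderiv_fderiv_eq_of_line hC.contDiffAt
      (φ := fun t => 2 * (s + ‖y - y₀‖ ^ 2 + (2 * t * b + t ^ 2)) * (2 * b + 2 * t)) ?_ ?_
    · refine Eventually.of_forall fun t => ?_
      have hfun : (fun t : ℝ => (s + ‖y + t • EuclideanSpace.single i (1 : ℝ) - y₀‖ ^ 2) ^ 2)
          = fun t : ℝ => (s + ‖y - y₀‖ ^ 2 + (2 * t * b + t ^ 2)) ^ 2 := by
        funext t
        have : y + t • EuclideanSpace.single i (1 : ℝ) - y₀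
          = (y - y₀) + t • EuclideanSpace.single i (1 : ℝ) := by abel
        rw [this, norm_add_sq_real, inner_smul_right, norm_smul, EuclideanSpace.inner_single_right]
        simp [← hb]
        ring
      rw [hfun]
      have h1 : HasDerivAt (fun t : ℝ => 2 * t * b + t ^ 2) (2 * b + 2 * t) t := by
        refine HasDerivAt.congr_deriv ((((hasDerivAt_id t).const_mul 2).mul_const b).add
          ((hasDerivAt_id t).pow 2)) (by simp)
      refine HasDerivAt.congr_deriv ((h1.const_add (s + ‖y - y₀‖ ^ 2)).pow 2) (by simp)
    · have h1 : HasDerivAt (fun t : ℝ => 2 * t * b + t ^ 2) (2 * b) 0 := by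
        refine HasDerivAt.congr_deriv ((((hasDerivAt_id (0 : ℝ)).const_mul 2).mul_const b).add
          ((hasDerivAt_id (0 : ℝ)).pow 2)) (by simp)
      have h2 : HasDerivAt (fun t : ℝ => 2 * b + 2 * t) 2 0 := by
        simpa using ((hasDerivAt_id (0 : ℝ)).const_mul 2).const_add (2 * b)
      refine HasDerivAt.congr_deriv (((h1.const_add (s + ‖y - y₀‖ ^ 2)).const_mul 2).mul h2) ?_
      simp
      ring
  simp only [EuclideanSpace.basisFun_apply]
  rw [Finset.sum_congr rfl fun i _ => key i, Finset.sum_add_distrib, ← Finset.mul_sum,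
    EuclideanSpace.real_norm_sq_eq]
  simp
  ring

end Product

/-! ### The thin domain: topology, comparison over a ball, and a priori bounds -/

section Geometry

variable {m : ℕ}

/-- The Laplacian of a cubic polynomial in the height with coefficients depending on the base. -/
theorem laplacian_cubic {c₀ c₁ c₂ c₃ : EuclideanSpace ℝ (Fin m) → ℝ}
    {x : EuclideanSpace ℝ (Fin (m + 1))}
    (h₀ : ContDiffAt ℝ 2 c₀ (base x)) (h₁ : ContDiffAt ℝ 2 c₁ (base x))
    (h₂ : ContDiffAt ℝ 2 c₂ (base x)) (h₃ : ContDiffAt ℝ 2 c₃ (base x)) :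
    ContDiffAt ℝ 2 (fun x => c₀ (base x) + c₁ (base x) * height x + c₂ (base x) * height x ^ 2
      + c₃ (base x) * height x ^ 3) x ∧
    Laplacian.laplacian (fun x => c₀ (base x) + c₁ (base x) * height x + c₂ (base x) * height x ^ 2
      + c₃ (base x) * height x ^ 3) x
      = Laplacian.laplacian c₀ (base x) + Laplacian.laplacian c₁ (base x) * height x
        + (Laplacian.laplacian c₂ (base x) * height x ^ 2 + 2 * c₂ (base x))
        + (Laplacian.laplacian c₃ (base x) * height x ^ 3 + 6 * c₃ (base x) * height x) := by
  have hC : ∀ {c : EuclideanSpace ℝ (Fin m) → ℝ} (k : ℕ), ContDiffAt ℝ 2 c (base x) →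
      ContDiffAt ℝ 2 (fun x => c (base x) * height x ^ k) x := fun k hc =>
    contDiffAt_mul_comp (g := fun s => s ^ k) hc (contDiff_id.pow k).contDiffAt
  have e : (fun x : EuclideanSpace ℝ (Fin (m + 1)) => c₀ (base x) + c₁ (base x) * height x
      + c₂ (base x) * height x ^ 2 + c₃ (base x) * height x ^ 3)
      = (((fun x => c₀ (base x) * height x ^ 0) + fun x => c₁ (base x) * height x ^ 1)
        + fun x => c₂ (base x) * height x ^ 2) + fun x => c₃ (base x) * height x ^ 3 := by
    funext x; simp
  rw [e]
  have h01 : ContDiffAt ℝ 2 ((fun x : EuclideanSpace ℝ (Fin (m + 1)) => c₀ (base x) * height x ^ 0)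
      + fun x => c₁ (base x) * height x ^ 1) x := (hC 0 h₀).add (hC 1 h₁)
  have h012 : ContDiffAt ℝ 2 (((fun x : EuclideanSpace ℝ (Fin (m + 1)) =>
      c₀ (base x) * height x ^ 0) + fun x => c₁ (base x) * height x ^ 1)
      + fun x => c₂ (base x) * height x ^ 2) x := h01.add (hC 2 h₂)
  refine ⟨h012.add (hC 3 h₃), ?_⟩
  rw [h012.laplacian_add (hC 3 h₃), h01.laplacian_add (hC 2 h₂), (hC 0 h₀).laplacian_add (hC 1 h₁),
    laplacian_mul_pow h₀, laplacian_mul_pow h₁, laplacian_mul_pow h₂, laplacian_mul_pow h₃]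
  norm_num
  ring

variable {ω : Set (EuclideanSpace ℝ (Fin m))} {hminus hplus : EuclideanSpace ℝ (Fin m) → ℝ}
  {ε : ℝ} {u : EuclideanSpace ℝ (Fin (m + 1)) → ℝ}

theorem isOpen_thinDomain (hω : IsOpen ω) (hm : ContinuousOn hminus (closure ω))
    (hp : ContinuousOn hplus (closure ω)) : IsOpen (thinDomain ω hminus hplus ε) := by
  rw [isOpen_iff_mem_nhds]
  intro x hx
  have hn : closure ω ∈ 𝓝 (base x) := mem_of_superset (hω.mem_nhds hx.1) subset_closure
  have h1 : ContinuousAt (fun x => hminus (base x)) x :=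
    ContinuousAt.comp (hm.continuousAt hn) continuous_base.continuousAt
  have h2 : ContinuousAt (fun x => hplus (base x)) x :=
    ContinuousAt.comp (hp.continuousAt hn) continuous_base.continuousAt
  have hh : ContinuousAt (height : EuclideanSpace ℝ (Fin (m + 1)) → ℝ) x :=
    continuous_height.continuousAt
  filter_upwards [continuous_base.continuousAt.eventually (hω.mem_nhds hx.1),
    ((h1.const_mul ε).neg).eventually_lt hh hx.2.1, hh.eventually_lt (h2.const_mul ε) hx.2.2]
    with y a b c using ⟨a, b, c⟩

theorem closure_thinDomain_subset (hm : ContinuousOn hminus (closure ω))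
    (hp : ContinuousOn hplus (closure ω)) {x : EuclideanSpace ℝ (Fin (m + 1))}
    (hx : x ∈ closure (thinDomain ω hminus hplus ε)) :
    base x ∈ closure ω ∧ -(ε * hminus (base x)) ≤ height x ∧ height x ≤ ε * hplus (base x) := by
  have hb : base x ∈ closure ω :=
    map_mem_closure continuous_base hx fun y hy => hy.1
  have : (𝓝[thinDomain ω hminus hplus ε] x).NeBot := mem_closure_iff_nhdsWithin_neBot.1 hx
  have ht : Tendsto base (𝓝[thinDomain ω hminus hplus ε] x) (𝓝[closure ω] (base x)) := by
    refine tendsto_nhdsWithin_iff.2 ⟨?_, ?_⟩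
    · exact (continuous_base.tendsto x).mono_left nhdsWithin_le_nhds
    · filter_upwards [self_mem_nhdsWithin] with y hy using subset_closure hy.1
  have h1 := (hm (base x) hb).tendsto.comp ht
  have h2 := (hp (base x) hb).tendsto.comp ht
  have hh : Tendsto height (𝓝[thinDomain ω hminus hplus ε] x) (𝓝 (height x)) :=
    (continuous_height.tendsto x).mono_left nhdsWithin_le_nhds
  refine ⟨hb, ?_, ?_⟩
  · refine le_of_tendsto_of_tendsto (h1.const_mul ε).neg hh ?_
    filter_upwards [self_mem_nhdsWithin] with y hy using hy.2.1.le
  · refine le_of_tendsto_of_tendsto hh (h2.const_mul ε) ?_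
    filter_upwards [self_mem_nhdsWithin] with y hy using hy.2.2.le

theorem abs_height_le {M : ℝ} (hε : 0 < ε)
    (hMm : ∀ y ∈ closure ω, |hminus y| ≤ M) (hMp : ∀ y ∈ closure ω, |hplus y| ≤ M)
    {x : EuclideanSpace ℝ (Fin (m + 1))}
    (hx : base x ∈ closure ω ∧ -(ε * hminus (base x)) ≤ height x ∧
      height x ≤ ε * hplus (base x)) : |height x| ≤ ε * M := by
  obtain ⟨hb, h1, h2⟩ := hx
  have h3 := (abs_le.1 (hMm _ hb)).2
  have h4 := (abs_le.1 (hMp _ hb)).2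
  exact abs_le.2 ⟨by nlinarith, by nlinarith⟩

theorem isBounded_thinDomain {M : ℝ} (hε : 0 < ε) (hb : Bornology.IsBounded ω)
    (hMm : ∀ y ∈ closure ω, |hminus y| ≤ M) (hMp : ∀ y ∈ closure ω, |hplus y| ≤ M) :
    Bornology.IsBounded (thinDomain ω hminus hplus ε) := by
  obtain ⟨R, hR⟩ := hb.exists_norm_le
  refine isBounded_iff_forall_norm_le.2 ⟨R + ε * M, fun x hx => ?_⟩
  have h1 : |height x| ≤ ε * M :=
    abs_height_le hε hMm hMp ⟨subset_closure hx.1, hx.2.1.le, hx.2.2.le⟩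
  have h2 := hR _ hx.1
  have h3 := norm_sq_eq_base_height x
  have h4 := norm_nonneg (base x)
  have h5 := abs_nonneg (height x)
  rw [← sq_abs (height x)] at h3
  refine (pow_le_pow_iff_left₀ (norm_nonneg _) (by linarith) two_ne_zero).1 ?_
  nlinarith

/-- Comparison principle on the part of the thin domain over a ball. -/
theorem le_of_laplacian_lt_on_cylinder (hε : 0 < ε) (hω : IsOpen ω)
    (hωb : Bornology.IsBounded ω) (hm : ContinuousOn hminus (closure ω))
    (hp : ContinuousOn hplus (closure ω)) {M : ℝ}
    (hMm : ∀ y ∈ closure ω, |hminus y| ≤ M) (hMp : ∀ y ∈ closure ω, |hplus y| ≤ M)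
    {y₀ : EuclideanSpace ℝ (Fin m)} {r : ℝ} {w B : EuclideanSpace ℝ (Fin (m + 1)) → ℝ}
    (hw : ContinuousOn w (closure (thinDomain ω hminus hplus ε) ∩ {x | dist (base x) y₀ ≤ r}))
    (hB : ContinuousOn B (closure (thinDomain ω hminus hplus ε) ∩ {x | dist (base x) y₀ ≤ r}))
    (hw2 : ∀ x ∈ thinDomain ω hminus hplus ε, dist (base x) y₀ < r → ContDiffAt ℝ 2 w x)
    (hB2 : ∀ x ∈ thinDomain ω hminus hplus ε, dist (base x) y₀ < r → ContDiffAt ℝ 2 B x)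
    (hlap : ∀ x ∈ thinDomain ω hminus hplus ε, dist (base x) y₀ < r →
      Laplacian.laplacian B x < Laplacian.laplacian w x)
    (hfr : ∀ x ∈ frontier (thinDomain ω hminus hplus ε), dist (base x) y₀ ≤ r → w x ≤ B x)
    (hlat : ∀ x ∈ thinDomain ω hminus hplus ε, dist (base x) y₀ = r → w x ≤ B x)
    {x : EuclideanSpace ℝ (Fin (m + 1))} (hx : x ∈ thinDomain ω hminus hplus ε)
    (hxr : dist (base x) y₀ < r) : w x ≤ B x := by
  set Ω := thinDomain ω hminus hplus ε with hΩ
  have hΩo : IsOpen Ω := isOpen_thinDomain hω hm hp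
  have hcont : Continuous fun x : EuclideanSpace ℝ (Fin (m + 1)) => dist (base x) y₀ :=
    continuous_base.dist continuous_const
  set D := Ω ∩ {x | dist (base x) y₀ < r}
  have hDo : IsOpen D := hΩo.inter (isOpen_lt hcont continuous_const)
  have hDcl : closure D ⊆ closure Ω ∩ {x | dist (base x) y₀ ≤ r} := fun y hy =>
    ⟨closure_mono inter_subset_left hy,
      closure_minimal (fun z hz => (hz.2 : dist (base z) y₀ < r).le)
        (isClosed_le hcont continuous_const) hy⟩
  refine le_of_laplacian_lt hDo
    ((isBounded_thinDomain hε hωb hMm hMp).subset inter_subset_left)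
    (hw.mono hDcl) (hB.mono hDcl) (fun y hy => hw2 y hy.1 hy.2) (fun y hy => hB2 y hy.1 hy.2)
    (fun y hy => hlap y hy.1 hy.2) (fun y hy hyD => ?_) x (subset_closure ⟨hx, hxr⟩)
  obtain ⟨h1, h2⟩ := hDcl hy
  by_cases hyΩ : y ∈ Ω
  · exact hlat y hyΩ (le_antisymm h2 (not_lt.1 fun h => hyD ⟨hyΩ, h⟩))
  · exact hfr y (by rw [hΩo.frontier_eq]; exact ⟨h1, hyΩ⟩) h2

theorem IsTorsionSolution.contDiffAt {n : ℕ} {Ω : Set (EuclideanSpace ℝ (Fin n))}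
    {u : EuclideanSpace ℝ (Fin n) → ℝ} (hu : IsTorsionSolution Ω u) (hΩ : IsOpen Ω)
    {x : EuclideanSpace ℝ (Fin n)} (hx : x ∈ Ω) : ContDiffAt ℝ 2 u x :=
  hu.contDiffOn.contDiffAt (hΩ.mem_nhds hx)

theorem IsTorsionSolution.laplacian {n : ℕ} {Ω : Set (EuclideanSpace ℝ (Fin n))}
    {u : EuclideanSpace ℝ (Fin n) → ℝ} (hu : IsTorsionSolution Ω u)
    {x : EuclideanSpace ℝ (Fin n)} (hx : x ∈ Ω) : Laplacian.laplacian u x = -2 := by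
  linarith [hu.equation x hx]

theorem IsTorsionSolution.nonneg (hε : 0 < ε) (hω : IsOpen ω)
    (hωb : Bornology.IsBounded ω) (hm : ContinuousOn hminus (closure ω))
    (hp : ContinuousOn hplus (closure ω)) {M : ℝ}
    (hMm : ∀ y ∈ closure ω, |hminus y| ≤ M) (hMp : ∀ y ∈ closure ω, |hplus y| ≤ M)
    (hu : IsTorsionSolution (thinDomain ω hminus hplus ε) u)
    {x : EuclideanSpace ℝ (Fin (m + 1))} (hx : x ∈ closure (thinDomain ω hminus hplus ε)) :
    0 ≤ u x := by
  have hΩo : IsOpen (thinDomain ω hminus hplus ε) := isOpen_thinDomain hω hm hp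
  refine le_of_laplacian_lt (u := fun _ => (0 : ℝ)) hΩo (isBounded_thinDomain hε hωb hMm hMp)
    continuousOn_const hu.continuousOn (fun y hy => contDiffAt_const)
    (fun y hy => hu.contDiffAt hΩo hy) (fun y hy => ?_) (fun y hy hyD => ?_) x hx
  · rw [hu.laplacian hy]; simp
  · rw [hu.boundary y (by rw [hΩo.frontier_eq]; exact ⟨hy, hyD⟩)]

/-- The barrier is `2 M² ε² - 2 s²`. It is nonnegative on the closure because `|s| ≤ ε M`, and the
coefficient `2` makes its Laplacian `-4`, strictly below `-2`. -/
theorem IsTorsionSolution.le (hε : 0 < ε) (hω : IsOpen ω)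
    (hωb : Bornology.IsBounded ω) (hm : ContinuousOn hminus (closure ω))
    (hp : ContinuousOn hplus (closure ω)) {M : ℝ}
    (hMm : ∀ y ∈ closure ω, |hminus y| ≤ M) (hMp : ∀ y ∈ closure ω, |hplus y| ≤ M)
    (hu : IsTorsionSolution (thinDomain ω hminus hplus ε) u)
    {x : EuclideanSpace ℝ (Fin (m + 1))} (hx : x ∈ closure (thinDomain ω hminus hplus ε)) :
    u x ≤ 2 * M ^ 2 * ε ^ 2 := by
  have hΩo : IsOpen (thinDomain ω hminus hplus ε) := isOpen_thinDomain hω hm hp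
  have hC := fun x : EuclideanSpace ℝ (Fin (m + 1)) =>
    laplacian_cubic (c₀ := fun _ => 2 * M ^ 2 * ε ^ 2) (c₁ := fun _ => 0) (c₂ := fun _ => -2)
      (c₃ := fun _ => 0) (x := x) contDiffAt_const contDiffAt_const contDiffAt_const
      contDiffAt_const
  have h := le_of_laplacian_lt hΩo (isBounded_thinDomain hε hωb hMm hMp)
    hu.continuousOn (fun y _ => (hC y).1.continuousAt.continuousWithinAt)
    (fun y hy => hu.contDiffAt hΩo hy) (fun y hy => (hC y).1) (fun y hy => ?_)
    (fun y hy hyD => ?_) x hx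
  · nlinarith [sq_nonneg (height x)]
  · rw [hu.laplacian hy, (hC y).2]; simp
  · rw [hu.boundary y (by rw [hΩo.frontier_eq]; exact ⟨hy, hyD⟩)]
    have h1 := abs_height_le hε hMm hMp (closure_thinDomain_subset hm hp hy)
    have h2 : height y ^ 2 ≤ (ε * M) ^ 2 := sq_le_sq' (abs_le.1 h1).1 (abs_le.1 h1).2
    nlinarith

end Geometry

/-! ### Smallness away from the peak, and the two-term expansion -/

section Estimates

variable {m : ℕ}

/-- Both localizing barriers use this function: `s = 0` gives the pure quartic around a point away
from the peak, and `s = Λ ε²` gives the weight around the peak. -/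
theorem laplacian_const_add_mul_quartic (y₀ y : EuclideanSpace ℝ (Fin m)) (c k s : ℝ) :
    ContDiffAt ℝ 2 (fun y => c + k * (s + ‖y - y₀‖ ^ 2) ^ 2) y ∧
    Laplacian.laplacian (fun y => c + k * (s + ‖y - y₀‖ ^ 2) ^ 2) y
      = k * (8 * ‖y - y₀‖ ^ 2 + 4 * m * (s + ‖y - y₀‖ ^ 2)) := by
  have hC : ContDiffAt ℝ 2 (fun y : EuclideanSpace ℝ (Fin m) => (s + ‖y - y₀‖ ^ 2) ^ 2) y := by
    have h0 : ContDiff ℝ 2 fun y : EuclideanSpace ℝ (Fin m) => y - y₀ := by fun_prop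
    have h1 : ContDiff ℝ 2 fun y : EuclideanSpace ℝ (Fin m) => ‖y - y₀‖ ^ 2 := h0.norm_sq ℝ
    exact ((contDiff_const.add h1).pow 2).contDiffAt
  have hk : ContDiffAt ℝ 2 (k • fun y : EuclideanSpace ℝ (Fin m) => (s + ‖y - y₀‖ ^ 2) ^ 2) y :=
    hC.const_smul k
  have hc : ContDiffAt ℝ 2 (fun _ : EuclideanSpace ℝ (Fin m) => c) y := contDiffAt_const
  have e : (fun y : EuclideanSpace ℝ (Fin m) => c + k * (s + ‖y - y₀‖ ^ 2) ^ 2)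
      = (fun _ => c) + k • fun y => (s + ‖y - y₀‖ ^ 2) ^ 2 := by
    funext y; simp
  rw [e]
  refine ⟨hc.add hk, ?_⟩
  rw [hc.laplacian_add hk, laplacian_smul k hC, laplacian_quartic]
  simp

theorem laplacian_const_add_mul_add_mul {f g : EuclideanSpace ℝ (Fin m) → ℝ}
    {y : EuclideanSpace ℝ (Fin m)} (hf : ContDiffAt ℝ 2 f y) (hg : ContDiffAt ℝ 2 g y)
    (c k l : ℝ) :
    ContDiffAt ℝ 2 (fun y => c + k * f y + l * g y) y ∧
    Laplacian.laplacian (fun y => c + k * f y + l * g y) y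
      = k * Laplacian.laplacian f y + l * Laplacian.laplacian g y := by
  have hc : ContDiffAt ℝ 2 (fun _ : EuclideanSpace ℝ (Fin m) => c) y := contDiffAt_const
  have hk : ContDiffAt ℝ 2 (k • f) y := hf.const_smul k
  have hl : ContDiffAt ℝ 2 (l • g) y := hg.const_smul l
  have hck : ContDiffAt ℝ 2 ((fun _ => c) + k • f) y := hc.add hk
  have e : (fun y : EuclideanSpace ℝ (Fin m) => c + k * f y + l * g y)
      = ((fun _ => c) + k • f) + l • g := by
    funext y; simp
  rw [e]
  refine ⟨hck.add hl, ?_⟩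
  rw [hck.laplacian_add hl, hc.laplacian_add hk, laplacian_smul k hf, laplacian_smul l hg]
  simp

/-- The standing assumptions on the profile of a thin domain, with a bound `M` for the profile
functions. -/
structure Profile (ω : Set (EuclideanSpace ℝ (Fin m)))
    (hminus hplus : EuclideanSpace ℝ (Fin m) → ℝ) (M : ℝ) : Prop where
  isOpen : IsOpen ω
  isBounded : Bornology.IsBounded ω
  continuousOn_minus : ContinuousOn hminus (closure ω)
  continuousOn_plus : ContinuousOn hplus (closure ω)
  abs_minus_le : ∀ y ∈ closure ω, |hminus y| ≤ M
  abs_plus_le : ∀ y ∈ closure ω, |hplus y| ≤ M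
  pos : 0 < M

variable {ω : Set (EuclideanSpace ℝ (Fin m))} {hminus hplus : EuclideanSpace ℝ (Fin m) → ℝ} {M : ℝ}

set_option maxHeartbeats 1000000 in
/-- Away from the maximum of the thickness the solution is strictly smaller than its expected
maximum. -/
theorem Profile.exists_le_of_lt (T : Profile ω hminus hplus M)
    {S : Set (EuclideanSpace ℝ (Fin m))} (hS : IsCompact S) (hSω : S ⊆ closure ω) {H₀ : ℝ}
    (hH₀ : 0 < H₀) (hlt : ∀ y ∈ S, hminus y + hplus y < H₀) :
    ∃ η > 0, ∃ ε₁ > 0, ∀ ε : ℝ, 0 < ε → ε < ε₁ → ∀ u : EuclideanSpace ℝ (Fin (m + 1)) → ℝ,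
      IsTorsionSolution (thinDomain ω hminus hplus ε) u →
      ∀ x ∈ thinDomain ω hminus hplus ε, base x ∈ S → u x ≤ ε ^ 2 * (H₀ ^ 2 / 4 - η) := by
  -- Nonnegativity of `κ` is imposed by hand, so that `κ < H₀` implies `κ² < H₀²`, also when `S` is
  -- empty.
  obtain ⟨κ, hκ0, hκ, hκS⟩ : ∃ κ, 0 ≤ κ ∧ κ < H₀ ∧ ∀ y ∈ S, hminus y + hplus y ≤ κ := by
    rcases S.eq_empty_or_nonempty with rfl | hne
    · exact ⟨0, le_rfl, hH₀, by simp⟩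
    · obtain ⟨y, hy, hmax⟩ := hS.exists_isMaxOn hne
        ((T.continuousOn_minus.mono hSω).add (T.continuousOn_plus.mono hSω))
      exact ⟨max 0 (hminus y + hplus y), le_max_left _ _, max_lt hH₀ (hlt y hy),
        fun z hz => (hmax hz).trans (le_max_right _ _)⟩
  obtain ⟨τ, hτ, hτ0⟩ : ∃ τ : ℝ, (1 + τ) * (κ + 2 * τ) ^ 2 < H₀ ^ 2 ∧ 0 < τ := by
    have hc : Continuous fun τ : ℝ => (1 + τ) * (κ + 2 * τ) ^ 2 := by fun_prop
    have h1 : ∀ᶠ τ in 𝓝[>] (0 : ℝ), (1 + τ) * (κ + 2 * τ) ^ 2 < H₀ ^ 2 := by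
      refine ((hc.tendsto 0).mono_left nhdsWithin_le_nhds).eventually (gt_mem_nhds ?_)
      simp only [add_zero, mul_zero, one_mul]
      nlinarith
    exact (h1.and self_mem_nhdsWithin).exists
  have hcomp : IsCompact (closure ω) := T.isBounded.isCompact_closure
  obtain ⟨δ₁, hδ₁, h1⟩ := Metric.uniformContinuousOn_iff.1
    (hcomp.uniformContinuousOn_of_continuous T.continuousOn_minus) τ hτ0
  obtain ⟨δ₂, hδ₂, h2⟩ := Metric.uniformContinuousOn_iff.1
    (hcomp.uniformContinuousOn_of_continuous T.continuousOn_plus) τ hτ0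
  set ρ := min δ₁ δ₂ / 2 with hρ
  have hρ0 : 0 < ρ := by have := lt_min hδ₁ hδ₂; positivity
  have hρ1 : ρ < δ₁ := by have := min_le_left δ₁ δ₂; linarith
  have hρ2 : ρ < δ₂ := by have := min_le_right δ₁ δ₂; linarith
  have hM := T.pos
  refine ⟨(H₀ ^ 2 - (1 + τ) * (κ + 2 * τ) ^ 2) / 4, by linarith,
    min 1 (τ * ρ ^ 2 / (M ^ 2 * (8 + 4 * m))), lt_min one_pos (by positivity), ?_⟩
  intro ε hε hε1 u hu x hx hxS
  have hε2 : ε ^ 2 < τ * ρ ^ 2 / (M ^ 2 * (8 + 4 * m)) := by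
    have := lt_min_iff.1 hε1
    nlinarith
  rw [lt_div_iff₀ (by positivity)] at hε2
  set y₀ := base x with hy₀
  have hy₀ω : y₀ ∈ closure ω := subset_closure hx.1
  -- The profile is frozen at the base point of `x` and enlarged by `τ`; by uniform continuity it
  -- lies outside the true profile within distance `ρ`.
  set a := hplus y₀ + τ with ha
  set b := hminus y₀ + τ with hb
  -- At distance `ρ` the quartic `k ‖y - y₀‖⁴` equals the a priori bound of `IsTorsionSolution.le`,
  -- which settles the lateral boundary. The bound on `ε` keeps its Laplacian below `2τ`.
  set k := 2 * M ^ 2 * ε ^ 2 / ρ ^ 4 with hk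
  have hk0 : 0 < k := by positivity
  have hkρ : k * ρ ^ 4 = 2 * M ^ 2 * ε ^ 2 := by rw [hk]; field_simp
  have hkρ2 : k * (8 + 4 * m) * ρ ^ 2 < 2 * τ := by
    have : k * (8 + 4 * m) * ρ ^ 2 * ρ ^ 2 < 2 * τ * ρ ^ 2 := by
      calc _ = (k * ρ ^ 4) * (8 + 4 * m) := by ring
        _ < 2 * τ * ρ ^ 2 := by rw [hkρ]; linarith
    exact lt_of_mul_lt_mul_right this (by positivity)
  -- The barrier is `(1 + τ)(ε a - s)(s + ε b) + k ‖y - y₀‖⁴`. The parabola contributes `-2 - 2τ` to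
  -- its Laplacian, which leaves room for the quartic.
  have hC := fun x : EuclideanSpace ℝ (Fin (m + 1)) =>
    laplacian_cubic (c₀ := fun y => (1 + τ) * (ε ^ 2 * (a * b)) + k * (0 + ‖y - y₀‖ ^ 2) ^ 2)
      (c₁ := fun _ => (1 + τ) * (ε * (a - b))) (c₂ := fun _ => -(1 + τ))
      (c₃ := fun _ => 0) (x := x) (laplacian_const_add_mul_quartic y₀ (base x) _ k 0).1
      contDiffAt_const contDiffAt_const contDiffAt_const
  have hΩo : IsOpen (thinDomain ω hminus hplus ε) :=
    isOpen_thinDomain T.isOpen T.continuousOn_minus T.continuousOn_plus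
  have hBnn : ∀ z ∈ closure (thinDomain ω hminus hplus ε), dist (base z) y₀ ≤ ρ →
      k * (‖base z - y₀‖ ^ 2) ^ 2 ≤ (1 + τ) * (ε ^ 2 * (a * b))
        + k * (0 + ‖base z - y₀‖ ^ 2) ^ 2 + (1 + τ) * (ε * (a - b)) * height z
        + -(1 + τ) * height z ^ 2 + 0 * height z ^ 3 := by
    intro z hz hzρ
    obtain ⟨g1, g2, g3⟩ := closure_thinDomain_subset T.continuousOn_minus T.continuousOn_plus hz
    have h3 := abs_lt.1 (h1 _ g1 _ hy₀ω (hzρ.trans_lt hρ1))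
    have h4 := abs_lt.1 (h2 _ g1 _ hy₀ω (hzρ.trans_lt hρ2))
    have h5 : 0 ≤ ε * a - height z := by nlinarith [h4.2]
    have h6 : 0 ≤ height z + ε * b := by nlinarith [h3.2]
    have h7 : 0 ≤ (1 + τ) * ((ε * a - height z) * (height z + ε * b)) := by positivity
    linarith
  have hmain := le_of_laplacian_lt_on_cylinder hε T.isOpen T.isBounded T.continuousOn_minus
    T.continuousOn_plus T.abs_minus_le T.abs_plus_le (y₀ := y₀) (r := ρ)
    (hu.continuousOn.mono inter_subset_left)
    (fun z _ => (hC z).1.continuousAt.continuousWithinAt) (fun z hz _ => hu.contDiffAt hΩo hz)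
    (fun z _ _ => (hC z).1) (fun z hz hzρ => ?_) (fun z hz hzρ => ?_) (fun z hz hzρ => ?_) hx
    (by simpa [hy₀] using hρ0)
  -- Over `y₀` itself the quartic vanishes, and the product of the two distances is at most the
  -- square of half their sum `ε (a + b)`.
  · have hAM : (1 + τ) * ((ε * a - height x) * (height x + ε * b))
        ≤ (1 + τ) * (ε ^ 2 * (κ + 2 * τ) ^ 2 / 4) := by
      have g1 : a + b ≤ κ + 2 * τ := by have := hκS _ hxS; linarith
      have g2 : 0 < a + b := by
        have h3 := hx.2.1
        have h4 := hx.2.2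
        have : 0 < ε * (hplus y₀ + hminus y₀) := by linarith
        have := pos_of_mul_pos_right this hε.le
        linarith
      refine mul_le_mul_of_nonneg_left ?_ (by linarith)
      have g3 : ε ^ 2 * (a + b) ^ 2 ≤ ε ^ 2 * (κ + 2 * τ) ^ 2 :=
        mul_le_mul_of_nonneg_left (pow_le_pow_left₀ g2.le g1 2) (sq_nonneg ε)
      have g4 := sq_nonneg ((ε * a - height x) - (height x + ε * b))
      linarith
    rw [← hy₀] at hmain
    simp only [sub_self, norm_zero] at hmain
    linarith
  · rw [hu.laplacian hz, (hC z).2, (laplacian_const_add_mul_quartic y₀ (base z) _ k 0).2]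
    rw [dist_eq_norm] at hzρ
    have h3 : ‖base z - y₀‖ ^ 2 ≤ ρ ^ 2 := by nlinarith [norm_nonneg (base z - y₀)]
    have h4 : k * (8 + 4 * m) * ‖base z - y₀‖ ^ 2 ≤ k * (8 + 4 * m) * ρ ^ 2 :=
      mul_le_mul_of_nonneg_left h3 (by positivity)
    simp
    linarith
  · rw [hu.boundary z hz]
    exact (by positivity : (0 : ℝ) ≤ k * (‖base z - y₀‖ ^ 2) ^ 2).trans
      (hBnn z (frontier_subset_closure hz) hzρ)
  · refine le_trans ?_ (hBnn z (subset_closure hz) hzρ.le)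
    rw [dist_eq_norm] at hzρ
    have : k * (‖base z - y₀‖ ^ 2) ^ 2 = 2 * M ^ 2 * ε ^ 2 := by rw [hzρ, ← hkρ]; ring
    rw [this]
    exact hu.le hε T.isOpen T.isBounded T.continuousOn_minus T.continuousOn_plus T.abs_minus_le
      T.abs_plus_le (subset_closure hz)

/-- The coefficient of `1` in the factor of the second term of the expansion. -/
noncomputable def corrConst (d p : EuclideanSpace ℝ (Fin m) → ℝ)
    (y : EuclideanSpace ℝ (Fin m)) : ℝ :=
  Laplacian.laplacian p y / 2 + d y * Laplacian.laplacian d y / 6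

/-- The coefficient of the rescaled height in the factor of the second term of the expansion. -/
noncomputable def corrLin (d : EuclideanSpace ℝ (Fin m) → ℝ)
    (y : EuclideanSpace ℝ (Fin m)) : ℝ :=
  Laplacian.laplacian d y / 6

/-- The two-term expansion of the solution in the thin domain. -/
noncomputable def approx (d p : EuclideanSpace ℝ (Fin m) → ℝ) (ε : ℝ)
    (x : EuclideanSpace ℝ (Fin (m + 1))) : ℝ :=
  (ε ^ 2 * p (base x) + ε * d (base x) * height x - height x ^ 2)
    * (1 + ε ^ 2 * corrConst d p (base x) + ε * corrLin d (base x) * height x)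

/-- The choice of `corrConst` and `corrLin` makes two cancellations: the terms of order `ε²`
independent of the height vanish because `Δp + 2 (d b - a) = 0`, and those of the form `ε s` because
`Δd = 6 b`. Since `s = O(ε)`, everything left besides `-2` has order `ε⁴`. -/
theorem laplacian_approx {d p : EuclideanSpace ℝ (Fin m) → ℝ} {ε : ℝ}
    {x : EuclideanSpace ℝ (Fin (m + 1))} (hd : ContDiffAt ℝ 2 d (base x))
    (hp : ContDiffAt ℝ 2 p (base x)) (ha : ContDiffAt ℝ 2 (corrConst d p) (base x))
    (hb : ContDiffAt ℝ 2 (corrLin d) (base x)) :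
    ContDiffAt ℝ 2 (approx d p ε) x ∧ Laplacian.laplacian (approx d p ε) x = -2 +
      (ε ^ 4 * Laplacian.laplacian (fun y => p y * corrConst d p y) (base x)
        + ε ^ 3 * Laplacian.laplacian (fun y => d y * corrConst d p y + p y * corrLin d y) (base x)
          * height x
        + ε ^ 2 * Laplacian.laplacian (fun y => d y * corrLin d y - corrConst d p y) (base x)
          * height x ^ 2
        - ε * Laplacian.laplacian (corrLin d) (base x) * height x ^ 3) := by
  have h0 := laplacian_const_add_mul_add_mul hp (hp.mul ha) 0 (ε ^ 2) (ε ^ 4)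
  have h1 := laplacian_const_add_mul_add_mul hd ((hd.mul ha).add (hp.mul hb)) 0 ε (ε ^ 3)
  have h2 := laplacian_const_add_mul_add_mul ((hd.mul hb).sub ha) (contDiffAt_const (c := (0 : ℝ)))
    (-1) (ε ^ 2) 0
  have h3 := laplacian_const_add_mul_add_mul hb (contDiffAt_const (c := (0 : ℝ))) 0 (-ε) 0
  have h := laplacian_cubic h0.1 h1.1 h2.1 h3.1
  have e : approx d p ε = fun x => (0 + ε ^ 2 * p (base x)
      + ε ^ 4 * (p (base x) * corrConst d p (base x)))
      + (0 + ε * d (base x) + ε ^ 3 * (d (base x) * corrConst d p (base x)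
        + p (base x) * corrLin d (base x))) * height x
      + (-1 + ε ^ 2 * (d (base x) * corrLin d (base x) - corrConst d p (base x)) + 0 * 0)
        * height x ^ 2
      + (0 + -ε * corrLin d (base x) + 0 * 0) * height x ^ 3 := by
    funext x; simp only [approx]; ring
  rw [e]
  refine ⟨h.1, ?_⟩
  rw [h.2, h0.2, h1.2, h2.2, h3.2]
  simp only [corrConst, corrLin]
  ring

end Estimates

/-! ### Accuracy of the two-term expansion near the peak -/

section LocalEstimates

variable {m : ℕ}

theorem contDiffAt_laplacian {f : EuclideanSpace ℝ (Fin m) → ℝ} {y : EuclideanSpace ℝ (Fin m)}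
    {n k l : WithTop ℕ∞} (hf : ContDiffAt ℝ n f y) (hkn : k + 1 ≤ n) (hlk : l + 1 ≤ k) :
    ContDiffAt ℝ l (Laplacian.laplacian f) y := by
  have e : Laplacian.laplacian f = fun y => ∑ i, fderiv ℝ (fderiv ℝ f) y
      (EuclideanSpace.basisFun (Fin m) ℝ i) (EuclideanSpace.basisFun (Fin m) ℝ i) := by
    funext y; exact laplacian_eq_sum_fderiv _ f y
  rw [e]
  have h2 : ContDiffAt ℝ l (fderiv ℝ (fderiv ℝ f)) y := (hf.fderiv_right hkn).fderiv_right hlk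
  exact ContDiffAt.sum fun i _ => (h2.clm_apply contDiffAt_const).clm_apply contDiffAt_const

/-- Smoothness and bounds which make `approx` a good approximation over the point `y`. -/
structure ApproxRegular (d p : EuclideanSpace ℝ (Fin m) → ℝ) (K : ℝ)
    (y : EuclideanSpace ℝ (Fin m)) : Prop where
  contDiffAt_d : ContDiffAt ℝ 2 d y
  contDiffAt_p : ContDiffAt ℝ 2 p y
  contDiffAt_corrConst : ContDiffAt ℝ 2 (corrConst d p) y
  contDiffAt_corrLin : ContDiffAt ℝ 2 (corrLin d) y
  abs_d_le : |d y| ≤ K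
  abs_p_le : |p y| ≤ K
  abs_corrConst_le : |corrConst d p y| ≤ K
  abs_corrLin_le : |corrLin d y| ≤ K
  abs_laplacian_zero_le : |Laplacian.laplacian (fun y => p y * corrConst d p y) y| ≤ K
  abs_laplacian_one_le :
    |Laplacian.laplacian (fun y => d y * corrConst d p y + p y * corrLin d y) y| ≤ K
  abs_laplacian_two_le :
    |Laplacian.laplacian (fun y => d y * corrLin d y - corrConst d p y) y| ≤ K
  abs_laplacian_three_le : |Laplacian.laplacian (corrLin d) y| ≤ K

theorem contDiffAt_corrLin {d : EuclideanSpace ℝ (Fin m) → ℝ}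
    {y : EuclideanSpace ℝ (Fin m)} (hd : ContDiffAt ℝ 5 d y) : ContDiffAt ℝ 3 (corrLin d) y :=
  (contDiffAt_laplacian (k := 4) hd (by norm_num) (by norm_num)).div_const 6

theorem contDiffAt_corrConst {d p : EuclideanSpace ℝ (Fin m) → ℝ}
    {y : EuclideanSpace ℝ (Fin m)} (hd : ContDiffAt ℝ 5 d y) (hp : ContDiffAt ℝ 5 p y) :
    ContDiffAt ℝ 3 (corrConst d p) y :=
  ((contDiffAt_laplacian (k := 4) hp (by norm_num) (by norm_num)).div_const 2).add
    (((hd.of_le (by norm_num)).mul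
      (contDiffAt_laplacian (k := 4) hd (by norm_num) (by norm_num))).div_const 6)

/-- Since `corrConst` and `corrLin` involve Laplacians of `C⁵` functions, they are `C³`. The
Laplacians of their products with `d` and `p` are therefore continuous at `y₀`, and hence bounded
nearby. -/
theorem exists_eventually_approxRegular {d p : EuclideanSpace ℝ (Fin m) → ℝ}
    {y₀ : EuclideanSpace ℝ (Fin m)} (hd : ContDiffAt ℝ 5 d y₀) (hp : ContDiffAt ℝ 5 p y₀) :
    ∃ K, 0 < K ∧ ∀ᶠ y in 𝓝 y₀, ApproxRegular d p K y := by
  have ha := contDiffAt_corrConst hd hp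
  have hb := contDiffAt_corrLin hd
  have hd3 : ContDiffAt ℝ 3 d y₀ := hd.of_le (by norm_num)
  have hp3 : ContDiffAt ℝ 3 p y₀ := hp.of_le (by norm_num)
  have hbd : ∀ {f : EuclideanSpace ℝ (Fin m) → ℝ}, ContinuousAt f y₀ →
      ∃ K, ∀ᶠ y in 𝓝 y₀, |f y| ≤ K := fun {f} hf =>
    ⟨|f y₀| + 1, (hf.abs.eventually (gt_mem_nhds (lt_add_one _))).mono fun y hy => hy.le⟩
  have hlap : ∀ {f : EuclideanSpace ℝ (Fin m) → ℝ}, ContDiffAt ℝ 3 f y₀ →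
      ContinuousAt (Laplacian.laplacian f) y₀ := fun hf =>
    (contDiffAt_laplacian (k := 2) (l := 1) hf (by norm_num) (by norm_num)).continuousAt
  obtain ⟨K1, h1⟩ := hbd hd.continuousAt
  obtain ⟨K2, h2⟩ := hbd hp.continuousAt
  obtain ⟨K3, h3⟩ := hbd ha.continuousAt
  obtain ⟨K4, h4⟩ := hbd hb.continuousAt
  obtain ⟨K5, h5⟩ := hbd (hlap (hp3.mul ha))
  obtain ⟨K6, h6⟩ := hbd (hlap ((hd3.mul ha).add (hp3.mul hb)))
  obtain ⟨K7, h7⟩ := hbd (hlap ((hd3.mul hb).sub ha))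
  obtain ⟨K8, h8⟩ := hbd (hlap hb)
  have hle : ∃ K, 0 < K ∧ K1 ≤ K ∧ K2 ≤ K ∧ K3 ≤ K ∧ K4 ≤ K ∧ K5 ≤ K ∧ K6 ≤ K ∧ K7 ≤ K ∧
      K8 ≤ K := by
    refine ⟨1 + |K1| + |K2| + |K3| + |K4| + |K5| + |K6| + |K7| + |K8|, by positivity, ?_⟩
    refine ⟨?_, ?_, ?_, ?_, ?_, ?_, ?_, ?_⟩ <;>
    linarith [le_abs_self K1, le_abs_self K2, le_abs_self K3, le_abs_self K4, le_abs_self K5,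
      le_abs_self K6, le_abs_self K7, le_abs_self K8, abs_nonneg K1, abs_nonneg K2, abs_nonneg K3,
      abs_nonneg K4, abs_nonneg K5, abs_nonneg K6, abs_nonneg K7, abs_nonneg K8]
  obtain ⟨K, hK, k1, k2, k3, k4, k5, k6, k7, k8⟩ := hle
  refine ⟨K, hK, ?_⟩
  have c2 : ∀ {f : EuclideanSpace ℝ (Fin m) → ℝ}, ContDiffAt ℝ 3 f y₀ →
      ∀ᶠ y in 𝓝 y₀, ContDiffAt ℝ 2 f y := fun hf =>
    (hf.of_le (by norm_num : (2 : WithTop ℕ∞) ≤ 3)).eventually (by simp)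
  filter_upwards [h1, h2, h3, h4, h5, h6, h7, h8, c2 hd3, c2 hp3, c2 ha, c2 hb] with
    y g1 g2 g3 g4 g5 g6 g7 g8 s1 s2 s3 s4
  exact ⟨s1, s2, s3, s4, g1.trans k1, g2.trans k2, g3.trans k3, g4.trans k4, g5.trans k5,
    g6.trans k6, g7.trans k7, g8.trans k8⟩

theorem abs_leading_le {ε s M K p d : ℝ} (hε : 0 < ε) (hs : |s| ≤ ε * M)
    (hp : |p| ≤ K) (hd : |d| ≤ K) :
    |ε ^ 2 * p + ε * d * s - s ^ 2| ≤ ε ^ 2 * (K + K * M + M ^ 2) := by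
  have hK : 0 ≤ K := (abs_nonneg _).trans hp
  calc |ε ^ 2 * p + ε * d * s - s ^ 2| ≤ |ε ^ 2 * p| + |ε * d * s| + |s ^ 2| :=
        (abs_sub _ _).trans (add_le_add_left (abs_add_le _ _) _)
    _ = ε ^ 2 * |p| + ε * |d| * |s| + |s| ^ 2 := by
        simp only [abs_mul, abs_pow, abs_of_pos hε]
    _ ≤ ε ^ 2 * K + ε * K * (ε * M) + (ε * M) ^ 2 := by gcongr
    _ = _ := by ring

theorem abs_factor_le {ε s M K a b : ℝ} (hε : 0 < ε) (hs : |s| ≤ ε * M)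
    (ha : |a| ≤ K) (hb : |b| ≤ K) :
    |ε ^ 2 * a + ε * b * s| ≤ ε ^ 2 * (K + K * M) := by
  have hK : 0 ≤ K := (abs_nonneg _).trans ha
  calc |ε ^ 2 * a + ε * b * s| ≤ |ε ^ 2 * a| + |ε * b * s| := abs_add_le _ _
    _ = ε ^ 2 * |a| + ε * |b| * |s| := by simp only [abs_mul, abs_pow, abs_of_pos hε]
    _ ≤ ε ^ 2 * K + ε * K * (ε * M) := by gcongr
    _ = _ := by ring

theorem abs_residual_le {ε s M K l₀ l₁ l₂ l₃ : ℝ} (hε : 0 < ε) (hs : |s| ≤ ε * M)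
    (h₀ : |l₀| ≤ K) (h₁ : |l₁| ≤ K) (h₂ : |l₂| ≤ K) (h₃ : |l₃| ≤ K) :
    |ε ^ 4 * l₀ + ε ^ 3 * l₁ * s + ε ^ 2 * l₂ * s ^ 2 - ε * l₃ * s ^ 3|
      ≤ ε ^ 4 * (K * (1 + M + M ^ 2 + M ^ 3)) := by
  have hK : 0 ≤ K := (abs_nonneg _).trans h₀
  calc _ ≤ |ε ^ 4 * l₀| + |ε ^ 3 * l₁ * s| + |ε ^ 2 * l₂ * s ^ 2| + |ε * l₃ * s ^ 3| := by
        refine (abs_sub _ _).trans (add_le_add_left ?_ _)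
        exact (abs_add_le _ _).trans (add_le_add_left (abs_add_le _ _) _)
    _ = ε ^ 4 * |l₀| + ε ^ 3 * |l₁| * |s| + ε ^ 2 * |l₂| * |s| ^ 2 + ε * |l₃| * |s| ^ 3 := by
        simp only [abs_mul, abs_pow, abs_of_pos hε]
    _ ≤ ε ^ 4 * K + ε ^ 3 * K * (ε * M) + ε ^ 2 * K * (ε * M) ^ 2 + ε * K * (ε * M) ^ 3 := by
        gcongr
    _ = _ := by ring

variable {ω : Set (EuclideanSpace ℝ (Fin m))} {hminus hplus : EuclideanSpace ℝ (Fin m) → ℝ} {M : ℝ}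

theorem Profile.abs_height_le (T : Profile ω hminus hplus M) {ε : ℝ} (hε : 0 < ε)
    {x : EuclideanSpace ℝ (Fin (m + 1))} (hx : x ∈ closure (thinDomain ω hminus hplus ε)) :
    |height x| ≤ ε * M :=
  ThinDomain.abs_height_le hε T.abs_minus_le T.abs_plus_le
    (closure_thinDomain_subset T.continuousOn_minus T.continuousOn_plus hx)

/-- The expansion vanishes on the boundary of the thin domain over interior points of the base. -/
theorem Profile.approx_eq_zero (T : Profile ω hminus hplus M) {d p : EuclideanSpace ℝ (Fin m) → ℝ}
    (hd : ∀ y, d y = hplus y - hminus y) (hp : ∀ y, p y = hplus y * hminus y) {ε : ℝ}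
    {x : EuclideanSpace ℝ (Fin (m + 1))} (hx : x ∈ frontier (thinDomain ω hminus hplus ε))
    (hxω : base x ∈ ω) : approx d p ε x = 0 := by
  have hΩo : IsOpen (thinDomain ω hminus hplus ε) :=
    isOpen_thinDomain T.isOpen T.continuousOn_minus T.continuousOn_plus
  rw [hΩo.frontier_eq] at hx
  obtain ⟨_, h1, h2⟩ := closure_thinDomain_subset T.continuousOn_minus T.continuousOn_plus hx.1
  have h : (ε * hplus (base x) - height x) * (height x + ε * hminus (base x)) = 0 := by
    by_contra hne
    refine hx.2 ⟨hxω, lt_of_le_of_ne h1 fun h => hne ?_, lt_of_le_of_ne h2 fun h => hne ?_⟩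
    · rw [← h]; ring
    · rw [h]; ring
  have : ε ^ 2 * p (base x) + ε * d (base x) * height x - height x ^ 2 = 0 := by
    rw [hd, hp, ← h]; ring
  rw [approx, this, zero_mul]

/-- These are the crude pointwise inputs for the later comparison. The bound `C ε²` on `u - approx`
uses only the size of each function; it serves on the lateral boundary, where nothing better is
available. -/
theorem Profile.exists_abs_laplacian_sub_approx_le (T : Profile ω hminus hplus M)
    {d p : EuclideanSpace ℝ (Fin m) → ℝ} {K : ℝ} (hK : 0 < K) :
    ∃ C > 0, ∀ ε : ℝ, 0 < ε → ε ≤ 1 → ∀ u : EuclideanSpace ℝ (Fin (m + 1)) → ℝ,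
      IsTorsionSolution (thinDomain ω hminus hplus ε) u →
      ∀ x ∈ thinDomain ω hminus hplus ε, ApproxRegular d p K (base x) →
        ContDiffAt ℝ 2 (u - approx d p ε) x ∧
        |Laplacian.laplacian (u - approx d p ε) x| ≤ C * ε ^ 4 ∧
        |u x - approx d p ε x| ≤ C * ε ^ 2 ∧
        |approx d p ε x - (ε ^ 2 * p (base x) + ε * d (base x) * height x - height x ^ 2)|
          ≤ C * ε ^ 4 := by
  have hM := T.pos
  refine ⟨K * (1 + M + M ^ 2 + M ^ 3) + (2 * M ^ 2 + (K + K * M + M ^ 2) * (1 + (K + K * M)))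
    + (K + K * M + M ^ 2) * (K + K * M), by positivity, ?_⟩
  intro ε hε hε1 u hu x hx hreg
  have hΩo : IsOpen (thinDomain ω hminus hplus ε) :=
    isOpen_thinDomain T.isOpen T.continuousOn_minus T.continuousOn_plus
  have hs := T.abs_height_le hε (subset_closure hx)
  have hA := laplacian_approx (ε := ε) hreg.contDiffAt_d hreg.contDiffAt_p
    hreg.contDiffAt_corrConst hreg.contDiffAt_corrLin
  have hlead := abs_leading_le hε hs hreg.abs_p_le hreg.abs_d_le
  have hfac := abs_factor_le hε hs hreg.abs_corrConst_le hreg.abs_corrLin_le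
  have hres := abs_residual_le hε hs hreg.abs_laplacian_zero_le hreg.abs_laplacian_one_le
    hreg.abs_laplacian_two_le hreg.abs_laplacian_three_le
  have hε2 : 0 < ε ^ 2 := by positivity
  have hε4 : 0 < ε ^ 4 := by positivity
  refine ⟨(hu.contDiffAt hΩo hx).sub hA.1, ?_, ?_, ?_⟩
  · rw [(hu.contDiffAt hΩo hx).laplacian_sub hA.1, hu.laplacian hx, hA.2]
    rw [show ∀ q : ℝ, -2 - (-2 + q) = -q by intro q; ring, abs_neg]
    refine hres.trans ?_
    rw [mul_comm]
    refine mul_le_mul_of_nonneg_right ?_ hε4.le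
    have h4 : 0 ≤ (2 * M ^ 2 + (K + K * M + M ^ 2) * (1 + (K + K * M)))
      + (K + K * M + M ^ 2) * (K + K * M) := by positivity
    linarith
  · have h0 := hu.nonneg hε T.isOpen T.isBounded T.continuousOn_minus T.continuousOn_plus
      T.abs_minus_le T.abs_plus_le (subset_closure hx)
    have h1 := hu.le hε T.isOpen T.isBounded T.continuousOn_minus T.continuousOn_plus
      T.abs_minus_le T.abs_plus_le (subset_closure hx)
    have h2 : |approx d p ε x| ≤ ε ^ 2 * (K + K * M + M ^ 2) * (1 + (K + K * M)) := by
      rw [approx, abs_mul]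
      refine mul_le_mul hlead ?_ (abs_nonneg _) (by positivity)
      rw [add_assoc]
      refine (abs_add_le _ _).trans ?_
      rw [abs_one]
      have : ε ^ 2 * (K + K * M) ≤ 1 * (K + K * M) :=
        mul_le_mul_of_nonneg_right (pow_le_one₀ hε.le hε1) (by positivity)
      linarith
    have h3 : |u x - approx d p ε x| ≤ 2 * M ^ 2 * ε ^ 2
        + ε ^ 2 * (K + K * M + M ^ 2) * (1 + (K + K * M)) := by
      refine (abs_sub _ _).trans (add_le_add ?_ h2)
      rw [abs_of_nonneg h0]; exact h1
    refine h3.trans ?_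
    have h4 : 0 ≤ (K * (1 + M + M ^ 2 + M ^ 3)
      + (K + K * M + M ^ 2) * (K + K * M)) * ε ^ 2 := by positivity
    linarith
  · have h1 : approx d p ε x - (ε ^ 2 * p (base x) + ε * d (base x) * height x - height x ^ 2)
        = (ε ^ 2 * p (base x) + ε * d (base x) * height x - height x ^ 2)
          * (ε ^ 2 * corrConst d p (base x) + ε * corrLin d (base x) * height x) := by
      rw [approx]; ring
    rw [h1, abs_mul]
    refine (mul_le_mul hlead hfac (abs_nonneg _) (by positivity)).trans ?_
    have h4 : 0 ≤ (K * (1 + M + M ^ 2 + M ^ 3)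
      + (2 * M ^ 2 + (K + K * M + M ^ 2) * (1 + (K + K * M)))) * ε ^ 4 := by positivity
    linarith

/-- Over a neighbourhood of the maximum of the thickness, the two-term expansion approximates the
solution with an error of sixth order, up to a weight coming from the lateral boundary. -/
theorem Profile.exists_abs_sub_approx_le (T : Profile ω hminus hplus M)
    {d p : EuclideanSpace ℝ (Fin m) → ℝ} (hd : ∀ y, d y = hplus y - hminus y)
    (hp : ∀ y, p y = hplus y * hminus y) {K r : ℝ} (hK : 0 < K) (hr : 0 < r)
    {y₀ : EuclideanSpace ℝ (Fin m)} (hball : Metric.closedBall y₀ r ⊆ ω)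
    (hreg : ∀ y ∈ Metric.closedBall y₀ r, ApproxRegular d p K y) :
    ∃ C > 0, ∀ ε : ℝ, 0 < ε → ε ≤ 1 → ∀ u : EuclideanSpace ℝ (Fin (m + 1)) → ℝ,
      IsTorsionSolution (thinDomain ω hminus hplus ε) u →
      ∀ x ∈ thinDomain ω hminus hplus ε, dist (base x) y₀ < r →
        |u x - approx d p ε x| ≤ C * ε ^ 2 * (ε ^ 2 + ‖base x - y₀‖ ^ 2) ^ 2 := by
  obtain ⟨C, hC, hCε⟩ := T.exists_abs_laplacian_sub_approx_le (d := d) (p := p) hK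
  have hM := T.pos
  -- Large enough that `(8 + 4m) · 2 M² ε²` is at most `W = Λ ε² + ‖y - y₀‖²`; the added `1` gives
  -- `ε² ≤ W`.
  set Λ : ℝ := (8 + 4 * m) * (2 * M ^ 2) + 1 with hΛ
  have hΛ1 : 1 ≤ Λ := by rw [hΛ]; exact le_add_of_nonneg_left (by positivity)
  -- The three summands serve the Laplacian inequality, the lateral boundary `‖y - y₀‖ = r`, and
  -- strictness.
  set κ : ℝ := C + C / (r ^ 4 * M ^ 2) + 1 with hκ
  have hκ1 : C < κ := by
    have : 0 < C / (r ^ 4 * M ^ 2) := by positivity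
    linarith
  have hκ0 : 0 < κ := hC.trans hκ1
  have hκ2 : C ≤ κ * (r ^ 4 * M ^ 2) := by
    have : C / (r ^ 4 * M ^ 2) ≤ κ := by rw [hκ]; linarith
    rwa [div_le_iff₀ (by positivity)] at this
  refine ⟨κ * (2 * M ^ 2) * Λ ^ 2, by positivity, ?_⟩
  intro ε hε hε1 u hu x hx hxr
  have hΩo : IsOpen (thinDomain ω hminus hplus ε) :=
    isOpen_thinDomain T.isOpen T.continuousOn_minus T.continuousOn_plus
  set φ : EuclideanSpace ℝ (Fin m) → ℝ := fun y => (Λ * ε ^ 2 + ‖y - y₀‖ ^ 2) ^ 2 with hφ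
  have hφC : ∀ k y, _ := fun k y => laplacian_const_add_mul_quartic y₀ y 0 k (Λ * ε ^ 2)
  have hBC := fun x : EuclideanSpace ℝ (Fin (m + 1)) =>
    laplacian_cubic (x := x) (hφC (κ * (2 * M ^ 2 * ε ^ 2)) (base x)).1
      (contDiffAt_const (c := (0 : ℝ))) (hφC (-κ) (base x)).1 (contDiffAt_const (c := (0 : ℝ)))
  -- A product of the weight and the vertical profile `2 M² ε² - s²`. The profile lies between `M²
  -- ε²` and `2 M² ε²` on the domain, and its second derivative `-2` supplies the negative
  -- Laplacian.
  set B : EuclideanSpace ℝ (Fin (m + 1)) → ℝ := fun x =>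
    0 + κ * (2 * M ^ 2 * ε ^ 2) * (Λ * ε ^ 2 + ‖base x - y₀‖ ^ 2) ^ 2 + 0 * height x
      + (0 + -κ * (Λ * ε ^ 2 + ‖base x - y₀‖ ^ 2) ^ 2) * height x ^ 2 + 0 * height x ^ 3 with hB
  have hBeq : ∀ x, B x = κ * (φ (base x) * (2 * M ^ 2 * ε ^ 2 - height x ^ 2)) := fun x => by
    simp only [hB, hφ]; ring
  have hheight : ∀ z ∈ closure (thinDomain ω hminus hplus ε), height z ^ 2 ≤ M ^ 2 * ε ^ 2 := by
    intro z hz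
    have h1 := T.abs_height_le hε hz
    have h2 := sq_le_sq' (abs_le.1 h1).1 (abs_le.1 h1).2
    linarith
  have hBnn : ∀ z ∈ closure (thinDomain ω hminus hplus ε),
      κ * (φ (base z) * (M ^ 2 * ε ^ 2)) ≤ B z := by
    intro z hz
    rw [hBeq]
    have h1 := hheight z hz
    have h2 : 0 ≤ φ (base z) := sq_nonneg _
    exact mul_le_mul_of_nonneg_left (mul_le_mul_of_nonneg_left (by linarith) h2) hκ0.le
  have hBlap : ∀ z ∈ thinDomain ω hminus hplus ε, Laplacian.laplacian B z < -(C * ε ^ 4) := by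
    intro z hz
    rw [(hBC z).2, (hφC _ _).2, (hφC _ _).2]
    have h1 := hheight z (subset_closure hz)
    have h2 : 0 ≤ height z ^ 2 := sq_nonneg _
    set N := ‖base z - y₀‖ ^ 2 with hN
    have hN0 : 0 ≤ N := sq_nonneg _
    set W := Λ * ε ^ 2 + N with hW
    have hWε : ε ^ 2 ≤ W := by nlinarith
    have hW0 : 0 < W := by positivity
    -- Differentiating the weight costs at most `W²`, while the vertical profile contributes `-2
    -- W²`. Hence `ΔB ≤ -κ W²`, which lies below `-C ε⁴`.
    have h3 : (8 * N + 4 * m * W) * (2 * M ^ 2 * ε ^ 2 - height z ^ 2) ≤ W * W := by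
      have g1 : 8 * N + 4 * m * W ≤ (8 + 4 * m) * W := by
        have : 0 ≤ Λ * ε ^ 2 := by positivity
        linarith
      have g2 : (8 + 4 * m) * W * (2 * M ^ 2 * ε ^ 2) ≤ W * W := by
        have : (8 + 4 * m) * (2 * M ^ 2) * ε ^ 2 ≤ W := by nlinarith
        nlinarith
      refine le_trans ?_ g2
      exact mul_le_mul g1 (by linarith) (by linarith) (by positivity)
    have h4 : ε ^ 4 ≤ W ^ 2 := by nlinarith
    have h5 : C * ε ^ 4 < κ * W ^ 2 := by
      have : 0 < W ^ 2 := by positivity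
      have := mul_le_mul_of_nonneg_left h4 hC.le
      nlinarith
    have h6 := mul_le_mul_of_nonneg_left h3 hκ0.le
    simp
    nlinarith
  have hreg' : ∀ z, dist (base z) y₀ ≤ r → ApproxRegular d p K (base z) := fun z hz => hreg _ hz
  have hAcont : ContinuousOn (approx d p ε)
      (closure (thinDomain ω hminus hplus ε) ∩ {x | dist (base x) y₀ ≤ r}) := by
    intro z hz
    have hr := hreg' z hz.2
    exact (laplacian_approx hr.contDiffAt_d hr.contDiffAt_p hr.contDiffAt_corrConst
      hr.contDiffAt_corrLin).1.continuousAt.continuousWithinAt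
  have hwcont : ContinuousOn (u - approx d p ε)
      (closure (thinDomain ω hminus hplus ε) ∩ {x | dist (base x) y₀ ≤ r}) :=
    (hu.continuousOn.mono inter_subset_left).sub hAcont
  have hBcont : ContinuousOn B
      (closure (thinDomain ω hminus hplus ε) ∩ {x | dist (base x) y₀ ≤ r}) :=
    fun z _ => (hBC z).1.continuousAt.continuousWithinAt
  have hfr : ∀ z ∈ frontier (thinDomain ω hminus hplus ε), dist (base z) y₀ ≤ r →
      (u - approx d p ε) z = 0 ∧ 0 ≤ B z := by
    intro z hz hzr
    refine ⟨?_, le_trans ?_ (hBnn z (frontier_subset_closure hz))⟩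
    · rw [Pi.sub_apply, hu.boundary z hz, T.approx_eq_zero hd hp hz (hball hzr), sub_zero]
    · positivity
  have hlat : ∀ z ∈ thinDomain ω hminus hplus ε, dist (base z) y₀ = r →
      |(u - approx d p ε) z| ≤ B z := by
    intro z hz hzr
    refine ((hCε ε hε hε1 u hu z hz (hreg' z hzr.le)).2.2.1).trans
      (le_trans ?_ (hBnn z (subset_closure hz)))
    have h1 : r ^ 4 ≤ φ (base z) := by
      rw [dist_eq_norm] at hzr
      simp only [hφ, hzr]
      have : 0 ≤ Λ * ε ^ 2 := by positivity
      nlinarith [sq_nonneg (r ^ 2), sq_nonneg r]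
    have h2 : κ * (r ^ 4 * (M ^ 2 * ε ^ 2)) ≤ κ * (φ (base z) * (M ^ 2 * ε ^ 2)) := by gcongr
    have h3 := mul_le_mul_of_nonneg_right hκ2 (sq_nonneg ε)
    linarith
  have hfin : B x ≤ κ * (2 * M ^ 2) * Λ ^ 2 * ε ^ 2 * (ε ^ 2 + ‖base x - y₀‖ ^ 2) ^ 2 := by
    rw [hBeq]
    have h1 : φ (base x) ≤ (Λ * (ε ^ 2 + ‖base x - y₀‖ ^ 2)) ^ 2 := by
      refine pow_le_pow_left₀ (by positivity) ?_ 2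
      nlinarith [sq_nonneg ‖base x - y₀‖]
    have h2 : φ (base x) * (2 * M ^ 2 * ε ^ 2 - height x ^ 2)
        ≤ (Λ * (ε ^ 2 + ‖base x - y₀‖ ^ 2)) ^ 2 * (2 * M ^ 2 * ε ^ 2) := by
      refine mul_le_mul h1 (by linarith [sq_nonneg (height x)]) ?_ (by positivity)
      have := hheight x (subset_closure hx)
      have : 0 ≤ M ^ 2 * ε ^ 2 := by positivity
      linarith
    have h3 := mul_le_mul_of_nonneg_left h2 hκ0.le
    linarith
  refine (abs_le.2 ⟨?_, ?_⟩ : |u x - approx d p ε x| ≤ B x).trans hfin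
  · have := le_of_laplacian_lt_on_cylinder hε T.isOpen T.isBounded T.continuousOn_minus
      T.continuousOn_plus T.abs_minus_le T.abs_plus_le (y₀ := y₀) (r := r)
      (w := -(u - approx d p ε)) (B := B) hwcont.neg hBcont
      (fun z hz hzr => (hCε ε hε hε1 u hu z hz (hreg' z hzr.le)).1.neg)
      (fun z _ _ => (hBC z).1) (fun z hz hzr => ?_) (fun z hz hzr => ?_) (fun z hz hzr => ?_) hx hxr
    · simp only [Pi.neg_apply, Pi.sub_apply] at this; linarith
    · rw [laplacian_neg]
      have h1 := (abs_le.1 (hCε ε hε hε1 u hu z hz (hreg' z hzr.le)).2.1).2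
      have h2 := hBlap z hz
      simp only [Pi.neg_apply]
      linarith
    · obtain ⟨h1, h2⟩ := hfr z hz hzr
      rw [Pi.neg_apply, h1, neg_zero]; exact h2
    · exact (neg_le_abs _).trans (hlat z hz hzr)
  · refine le_of_laplacian_lt_on_cylinder hε T.isOpen T.isBounded T.continuousOn_minus
      T.continuousOn_plus T.abs_minus_le T.abs_plus_le (y₀ := y₀) (r := r)
      (w := u - approx d p ε) (B := B) hwcont hBcont
      (fun z hz hzr => (hCε ε hε hε1 u hu z hz (hreg' z hzr.le)).1)
      (fun z _ _ => (hBC z).1) (fun z hz hzr => ?_) (fun z hz hzr => ?_) (fun z hz hzr => ?_) hx hxr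
    · have h1 := (abs_le.1 (hCε ε hε hε1 u hu z hz (hreg' z hzr.le)).2.1).1
      have h2 := hBlap z hz
      linarith
    · obtain ⟨h1, h2⟩ := hfr z hz hzr
      rw [h1]; exact h2
    · exact (le_abs_self _).trans (hlat z hz hzr)

end LocalEstimates

/-! ### Taylor estimates, and the Hessian and cubic coefficients in coordinates -/

section Calculus

/-- The derivative is differentiable at `x₀`, so its increment from `x₀` is `O(‖x - x₀‖)`. The mean
value inequality on the closed ball of radius `‖x - x₀‖` supplies the second factor. -/
theorem isBigO_taylor_two {E F : Type*} [NormedAddCommGroup E] [NormedSpace ℝ E]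
    [NormedAddCommGroup F] [NormedSpace ℝ F] {f : E → F} {x₀ : E} (hf : ContDiffAt ℝ 2 f x₀) :
    (fun x => f x - f x₀ - fderiv ℝ f x₀ (x - x₀)) =O[𝓝 x₀] fun x => ‖x - x₀‖ ^ 2 := by
  have hd : DifferentiableAt ℝ (fderiv ℝ f) x₀ :=
    (hf.fderiv_right (m := 1) (by norm_num)).differentiableAt (by simp)
  obtain ⟨C, hC⟩ := hd.hasFDerivAt.isBigO_sub.bound
  have hev : ∀ᶠ x in 𝓝 x₀, DifferentiableAt ℝ f x ∧
      ‖fderiv ℝ f x - fderiv ℝ f x₀‖ ≤ C * ‖x - x₀‖ := by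
    filter_upwards [hC, hf.eventually (by simp)] with x h1 h2
    exact ⟨h2.differentiableAt (by simp), h1⟩
  obtain ⟨δ, hδ, hball⟩ := Metric.eventually_nhds_iff_ball.1 hev
  refine Asymptotics.IsBigO.of_bound |C| ?_
  filter_upwards [Metric.ball_mem_nhds x₀ hδ] with x hx
  have hsub : Metric.closedBall x₀ ‖x - x₀‖ ⊆ Metric.ball x₀ δ :=
    Metric.closedBall_subset_ball (by simpa [dist_eq_norm] using hx)
  have h := (convex_closedBall x₀ ‖x - x₀‖).norm_image_sub_le_of_norm_fderiv_le'
    (f := f) (φ := fderiv ℝ f x₀) (C := |C| * ‖x - x₀‖) (𝕜 := ℝ) (x := x₀) (y := x)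
    (fun y hy => (hball y (hsub hy)).1) (fun y hy => ?_)
    (Metric.mem_closedBall_self (norm_nonneg _)) (by simp [dist_eq_norm])
  · rw [Real.norm_eq_abs, abs_of_nonneg (by positivity : (0 : ℝ) ≤ ‖x - x₀‖ ^ 2)]
    refine h.trans_eq (by ring)
  · refine (hball y (hsub hy)).2.trans ?_
    have : ‖y - x₀‖ ≤ ‖x - x₀‖ := by simpa [dist_eq_norm] using hy
    exact mul_le_mul (le_abs_self C) this (norm_nonneg _) (abs_nonneg C)

/-- At a critical point with negative definite Hessian, a function decreases quadratically. -/
theorem eventually_le_sub_sq {E : Type*} [NormedAddCommGroup E] [NormedSpace ℝ E]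
    {f : E → ℝ} {x₀ : E} (hf : ContDiffAt ℝ 2 f x₀) (h0 : fderiv ℝ f x₀ = 0) {c : ℝ} (hc : 0 < c)
    (hneg : ∀ v, fderiv ℝ (fderiv ℝ f) x₀ v v ≤ -(c * ‖v‖ ^ 2)) :
    ∀ᶠ x in 𝓝 x₀, f x ≤ f x₀ - c / 4 * ‖x - x₀‖ ^ 2 := by
  have hd : DifferentiableAt ℝ (fderiv ℝ f) x₀ :=
    (hf.fderiv_right (m := 1) (by norm_num)).differentiableAt (by simp)
  have hlit := hd.hasFDerivAt.isLittleO.bound (half_pos hc)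
  have hev : ∀ᶠ x in 𝓝 x₀, DifferentiableAt ℝ f x ∧
      ‖fderiv ℝ f x - fderiv ℝ (fderiv ℝ f) x₀ (x - x₀)‖ ≤ c / 2 * ‖x - x₀‖ := by
    filter_upwards [hlit, hf.eventually (by simp)] with x h1 h2
    refine ⟨h2.differentiableAt (by simp), ?_⟩
    rwa [h0, sub_zero] at h1
  obtain ⟨δ, hδ, hball⟩ := Metric.eventually_nhds_iff_ball.1 hev
  filter_upwards [Metric.ball_mem_nhds x₀ hδ] with x hx
  set v := x - x₀ with hv
  have hvδ : ‖v‖ < δ := by simpa [dist_eq_norm] using hx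
  have hmem : ∀ t ∈ Icc (0 : ℝ) 1, x₀ + t • v ∈ Metric.ball x₀ δ := by
    intro t ht
    rw [Metric.mem_ball, dist_eq_norm, add_sub_cancel_left, norm_smul, Real.norm_eq_abs,
      abs_of_nonneg ht.1]
    exact (mul_le_of_le_one_left (norm_nonneg _) ht.2).trans_lt hvδ
  -- Along the segment the Hessian contributes at most `-c t ‖v‖²` to the derivative, and the
  -- linearization error at most `(c/2) t ‖v‖²`. The coefficient `c/4` uses up the remaining `(c/2)
  -- t ‖v‖²`, so `ψ` is nonincreasing.
  set ψ : ℝ → ℝ := fun t => f (x₀ + t • v) + c / 4 * ‖v‖ ^ 2 * t ^ 2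
  have hder : ∀ t ∈ Icc (0 : ℝ) 1, HasDerivAt ψ (fderiv ℝ f (x₀ + t • v) v
      + c / 4 * ‖v‖ ^ 2 * (2 * t)) t := by
    intro t ht
    have h1 : HasDerivAt (fun t : ℝ => x₀ + t • v) v t := by
      simpa using ((hasDerivAt_id t).smul_const v).const_add x₀
    have h2 := (hball _ (hmem t ht)).1.hasFDerivAt.comp_hasDerivAt t h1
    have h3 : HasDerivAt (fun t : ℝ => t ^ 2) (2 * t) t := by simpa using hasDerivAt_pow 2 t
    exact h2.add (h3.const_mul _)
  have hanti : AntitoneOn ψ (Icc 0 1) := by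
    refine antitoneOn_of_deriv_nonpos (convex_Icc 0 1)
      (fun t ht => (hder t ht).continuousAt.continuousWithinAt)
      (fun t ht => (hder t (interior_subset ht)).differentiableAt.differentiableWithinAt) ?_
    intro t ht
    have ht' := interior_subset ht
    rw [(hder t ht').deriv]
    have h1 := (hball _ (hmem t ht')).2
    rw [add_sub_cancel_left, norm_smul, Real.norm_eq_abs, abs_of_nonneg ht'.1, map_smul] at h1
    have h2 := (ContinuousLinearMap.le_opNorm (fderiv ℝ f (x₀ + t • v)
      - t • fderiv ℝ (fderiv ℝ f) x₀ v) v).trans (mul_le_mul_of_nonneg_right h1 (norm_nonneg v))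
    have h3 := (le_abs_self _).trans h2
    simp only [_root_.sub_apply, _root_.smul_apply, smul_eq_mul] at h3
    have h4 := mul_le_mul_of_nonneg_left (hneg v) ht'.1
    linarith
  have h := hanti (left_mem_Icc.2 zero_le_one) (right_mem_Icc.2 zero_le_one) zero_le_one
  simp only [ψ, one_smul, zero_smul, add_zero, hv, add_sub_cancel] at h
  rw [hv]
  linarith

variable {m : ℕ}

theorem halfHessian_apply (f : EuclideanSpace ℝ (Fin m) → ℝ) (x : EuclideanSpace ℝ (Fin m))
    (i j : Fin m) : halfHessian f x i j = 1 / 2 *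
      fderiv ℝ (fderiv ℝ f) x (EuclideanSpace.single i 1) (EuclideanSpace.single j 1) := by
  simp [halfHessian, iteratedFDeriv_two_apply]

theorem sum_smul_single (v : EuclideanSpace ℝ (Fin m)) :
    ∑ i, v i • EuclideanSpace.single i (1 : ℝ) = v := by
  simpa using (EuclideanSpace.basisFun (Fin m) ℝ).sum_repr v

theorem sum_mul_apply_single (L : EuclideanSpace ℝ (Fin m) →L[ℝ] ℝ)
    (v : EuclideanSpace ℝ (Fin m)) :
    L v = ∑ i, v i * L (EuclideanSpace.single i 1) := by
  conv_lhs => rw [← sum_smul_single v]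
  simp

theorem fderiv_fderiv_apply_single (f : EuclideanSpace ℝ (Fin m) → ℝ)
    (x v : EuclideanSpace ℝ (Fin m)) (j : Fin m) :
    fderiv ℝ (fderiv ℝ f) x v (EuclideanSpace.single j 1)
      = 2 * ∑ i, v i * halfHessian f x i j := by
  conv_lhs => rw [← sum_smul_single v]
  simp only [map_sum, map_smul, halfHessian_apply, _root_.sum_apply,
    _root_.smul_apply, smul_eq_mul, Finset.mul_sum]
  refine Finset.sum_congr rfl fun i _ => ?_
  ring

theorem fderiv_fderiv_apply_self (f : EuclideanSpace ℝ (Fin m) → ℝ)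
    (x v : EuclideanSpace ℝ (Fin m)) :
    fderiv ℝ (fderiv ℝ f) x v v
      = 2 * dotProduct v.ofLp (Matrix.mulVec (halfHessian f x) v.ofLp) := by
  rw [sum_mul_apply_single (fderiv ℝ (fderiv ℝ f) x v) v]
  simp only [fderiv_fderiv_apply_single, dotProduct, Matrix.mulVec, Finset.mul_sum]
  rw [Finset.sum_comm]
  refine Finset.sum_congr rfl fun i _ => Finset.sum_congr rfl fun j _ => ?_
  ring

/-- The quadratic form attains a negative maximum on the compact unit sphere, and homogeneity does
the rest. An empty sphere forces every vector to be zero and is treated separately. -/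
theorem exists_fderiv_fderiv_le_of_posDef {f : EuclideanSpace ℝ (Fin m) → ℝ}
    {x : EuclideanSpace ℝ (Fin m)} (h : (-halfHessian f x).PosDef) :
    ∃ c > 0, ∀ v, fderiv ℝ (fderiv ℝ f) x v v ≤ -(c * ‖v‖ ^ 2) := by
  have hneg : ∀ v : EuclideanSpace ℝ (Fin m), v ≠ 0 → fderiv ℝ (fderiv ℝ f) x v v < 0 := by
    intro v hv
    have h1 := h.dotProduct_mulVec_pos (x := v.ofLp) (by simpa using hv)
    rw [fderiv_fderiv_apply_self]
    simp only [star_trivial, Matrix.neg_mulVec, dotProduct_neg] at h1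
    linarith
  have hcont : Continuous fun v => fderiv ℝ (fderiv ℝ f) x v v := by fun_prop
  rcases (Metric.sphere (0 : EuclideanSpace ℝ (Fin m)) 1).eq_empty_or_nonempty with he | hne
  · refine ⟨1, one_pos, fun v => ?_⟩
    have hv : v = 0 := by
      by_contra hv
      have : (‖v‖⁻¹ • v) ∈ Metric.sphere (0 : EuclideanSpace ℝ (Fin m)) 1 := by
        simp [norm_smul, hv]
      rw [he] at this
      exact this
    simp [hv]
  · obtain ⟨w, hw, hmax⟩ := (isCompact_sphere (0 : EuclideanSpace ℝ (Fin m)) 1).exists_isMaxOn hne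
      hcont.continuousOn
    have hw0 : w ≠ 0 := by
      rintro rfl
      simp at hw
    refine ⟨-fderiv ℝ (fderiv ℝ f) x w w, by linarith [hneg w hw0], fun v => ?_⟩
    by_cases hv : v = 0
    · simp [hv]
    have h1 : fderiv ℝ (fderiv ℝ f) x (‖v‖⁻¹ • v) (‖v‖⁻¹ • v) ≤ fderiv ℝ (fderiv ℝ f) x w w :=
      hmax (by simp [norm_smul, hv])
    simp only [map_smul, _root_.smul_apply, smul_eq_mul] at h1
    have hvn : 0 < ‖v‖ := norm_pos_iff.2 hv
    have h2 := mul_le_mul_of_nonneg_left h1 (sq_nonneg ‖v‖)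
    have h3 : ‖v‖ ^ 2 * (‖v‖⁻¹ * (‖v‖⁻¹ * fderiv ℝ (fderiv ℝ f) x v v))
        = fderiv ℝ (fderiv ℝ f) x v v := by field_simp
    linarith

theorem laplacian_eq_two_mul_trace (f : EuclideanSpace ℝ (Fin m) → ℝ)
    (x : EuclideanSpace ℝ (Fin m)) : Laplacian.laplacian f x = 2 * (halfHessian f x).trace := by
  rw [laplacian_eq_sum_fderiv (EuclideanSpace.basisFun (Fin m) ℝ), Matrix.trace, Finset.mul_sum]
  refine Finset.sum_congr rfl fun i _ => ?_
  rw [Matrix.diag_apply, halfHessian_apply]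
  simp

/-- Differentiating the trace of the Hessian puts the new direction in the first slot of the third
derivative, whereas `cubicSum` has it in the last. Two transpositions move it: one is symmetry of
the second derivative of `fderiv ℝ f`, the other is symmetry of the Hessian differentiated once. -/
theorem fderiv_laplacian_single {f : EuclideanSpace ℝ (Fin m) → ℝ}
    {x : EuclideanSpace ℝ (Fin m)} (hf : ContDiffAt ℝ 3 f x) (k : Fin m) :
    fderiv ℝ (Laplacian.laplacian f) x (EuclideanSpace.single k 1) = 6 * cubicSum f x k := by
  set e : Fin m → EuclideanSpace ℝ (Fin m) := fun i => EuclideanSpace.single i 1 with he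
  have h1 : ContDiffAt ℝ 2 (fderiv ℝ f) x := hf.fderiv_right (by norm_num)
  have h2 : ContDiffAt ℝ 1 (fderiv ℝ (fderiv ℝ f)) x := h1.fderiv_right (by norm_num)
  have h2d : HasFDerivAt (fderiv ℝ (fderiv ℝ f)) (fderiv ℝ (fderiv ℝ (fderiv ℝ f)) x) x :=
    (h2.differentiableAt (by simp)).hasFDerivAt
  have hap : ∀ u v : EuclideanSpace ℝ (Fin m), HasFDerivAt (fun y => fderiv ℝ (fderiv ℝ f) y u v)
      (((fderiv ℝ (fderiv ℝ (fderiv ℝ f)) x).flip u).flip v) x := fun u v =>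
    ((h2d.clm_apply (hasFDerivAt_const u x)).clm_apply (hasFDerivAt_const v x)).congr_fderiv
      (by ext; simp)
  have hsymm1 : ∀ u v w : EuclideanSpace ℝ (Fin m),
      fderiv ℝ (fderiv ℝ (fderiv ℝ f)) x u v w = fderiv ℝ (fderiv ℝ (fderiv ℝ f)) x v u w := by
    intro u v w
    rw [(h1.isSymmSndFDerivAt (by simp)).eq u v]
  have hsymm2 : ∀ u v w : EuclideanSpace ℝ (Fin m),
      fderiv ℝ (fderiv ℝ (fderiv ℝ f)) x u v w = fderiv ℝ (fderiv ℝ (fderiv ℝ f)) x u w v := by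
    intro u v w
    have hev : (fun y => fderiv ℝ (fderiv ℝ f) y v w) =ᶠ[𝓝 x]
        fun y => fderiv ℝ (fderiv ℝ f) y w v := by
      filter_upwards [(hf.of_le (by norm_num : (2 : WithTop ℕ∞) ≤ 3)).eventually (by simp)]
        with y hy
      exact (hy.isSymmSndFDerivAt (by simp)).eq v w
    have := hev.fderiv_eq (𝕜 := ℝ)
    rw [(hap v w).fderiv, (hap w v).fderiv] at this
    simpa using congrArg (fun L => L u) this
  have hlap : Laplacian.laplacian f = fun y => ∑ i, fderiv ℝ (fderiv ℝ f) y (e i) (e i) := by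
    funext y
    rw [laplacian_eq_sum_fderiv (EuclideanSpace.basisFun (Fin m) ℝ)]
    simp [he]
  have hsum := HasFDerivAt.fun_sum (u := Finset.univ) fun i (_ : i ∈ Finset.univ) =>
    hap (e i) (e i)
  rw [hlap, hsum.fderiv, cubicSum, Finset.mul_sum]
  simp only [_root_.sum_apply]
  refine Finset.sum_congr rfl fun j _ => ?_
  have h3 : iteratedFDeriv ℝ 3 f x ![e j, e j, e k]
      = fderiv ℝ (fderiv ℝ (fderiv ℝ f)) x (e j) (e j) (e k) := by
    rw [iteratedFDeriv_succ_apply_right, iteratedFDeriv_two_apply]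
    rfl
  rw [cubicCoeff, h3, hsymm2 (e j) (e j) (e k), hsymm1 (e j) (e k) (e j)]
  simp only [ContinuousLinearMap.flip_apply]
  ring

end Calculus

/-! ### Location of the maximizers and near-criticality of the expansion -/

section Maximizers

variable {m : ℕ}

/-- The thickness `H` of a thin domain has a unique, nondegenerate maximum at `y₀`, and the profile
is regular over the ball of radius `r` around `y₀`. -/
structure Peak (ω : Set (EuclideanSpace ℝ (Fin m)))
    (hminus hplus H d p : EuclideanSpace ℝ (Fin m) → ℝ) (y₀ : EuclideanSpace ℝ (Fin m))
    (M K r c : ℝ) : Prop where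
  profile : Profile ω hminus hplus M
  H_eq : ∀ y, H y = hminus y + hplus y
  d_eq : ∀ y, d y = hplus y - hminus y
  p_eq : ∀ y, p y = hplus y * hminus y
  K_pos : 0 < K
  r_pos : 0 < r
  c_pos : 0 < c
  ball_subset : Metric.closedBall y₀ r ⊆ ω
  regular : ∀ y ∈ Metric.closedBall y₀ r, ApproxRegular d p K y
  H_pos : ∀ y ∈ ω, 0 < H y
  H_lt : ∀ y ∈ closure ω, y ≠ y₀ → H y < H y₀
  H_le : ∀ y ∈ Metric.closedBall y₀ r, H y ≤ H y₀ - c * ‖y - y₀‖ ^ 2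
  minus_close : ∀ y ∈ Metric.closedBall y₀ r, |hminus y - hminus y₀| ≤ H y₀ / 8
  plus_close : ∀ y ∈ Metric.closedBall y₀ r, |hplus y - hplus y₀| ≤ H y₀ / 8

variable {ω : Set (EuclideanSpace ℝ (Fin m))}
  {hminus hplus H d p : EuclideanSpace ℝ (Fin m) → ℝ} {y₀ : EuclideanSpace ℝ (Fin m)}
  {M K r c : ℝ}

theorem Peak.mem (P : Peak ω hminus hplus H d p y₀ M K r c) : y₀ ∈ ω :=
  P.ball_subset (Metric.mem_closedBall_self P.r_pos.le)

theorem Peak.pos (P : Peak ω hminus hplus H d p y₀ M K r c) : 0 < H y₀ := P.H_pos _ P.mem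

theorem Peak.isOpen (P : Peak ω hminus hplus H d p y₀ M K r c) (ε : ℝ) :
    IsOpen (thinDomain ω hminus hplus ε) :=
  isOpen_thinDomain P.profile.isOpen P.profile.continuousOn_minus P.profile.continuousOn_plus

/-- Completing the square in the height separates the two competing effects: the thickness of the
fibre, and the offset from its midpoint `d/2`. -/
theorem Peak.leading_eq (P : Peak ω hminus hplus H d p y₀ M K r c) {ε : ℝ} (hε : 0 < ε)
    (x : EuclideanSpace ℝ (Fin (m + 1))) :
    ε ^ 2 * p (base x) + ε * d (base x) * height x - height x ^ 2
      = ε ^ 2 * (H (base x) ^ 2 / 4 - (height x / ε - d (base x) / 2) ^ 2) := by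
  rw [P.H_eq, P.d_eq, P.p_eq]
  field_simp
  ring

/-- Lower bound for the solution at the middle of the thickest fibre. -/
theorem Peak.exists_lower_bound (P : Peak ω hminus hplus H d p y₀ M K r c) :
    ∃ C > 0, ∀ ε : ℝ, 0 < ε → ε ≤ 1 → ∀ u : EuclideanSpace ℝ (Fin (m + 1)) → ℝ,
      IsTorsionSolution (thinDomain ω hminus hplus ε) u →
      join y₀ (ε * (d y₀ / 2)) ∈ thinDomain ω hminus hplus ε ∧
      ε ^ 2 * (H y₀ ^ 2 / 4 - C * ε ^ 2) ≤ u (join y₀ (ε * (d y₀ / 2))) := by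
  obtain ⟨C₁, hC₁, h1⟩ := P.profile.exists_abs_laplacian_sub_approx_le (d := d) (p := p) P.K_pos
  obtain ⟨C₂, hC₂, h2⟩ := P.profile.exists_abs_sub_approx_le P.d_eq P.p_eq P.K_pos P.r_pos
    P.ball_subset P.regular
  refine ⟨C₁ + C₂, by positivity, fun ε hε hε1 u hu => ?_⟩
  set x := join y₀ (ε * (d y₀ / 2)) with hx
  have hmem : x ∈ thinDomain ω hminus hplus ε := by
    have h3 := P.pos
    rw [P.H_eq] at h3
    refine ⟨by simpa [hx] using P.mem, ?_, ?_⟩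
    · rw [hx, base_join, height_join, P.d_eq]; nlinarith
    · rw [hx, base_join, height_join, P.d_eq]; nlinarith
  refine ⟨hmem, ?_⟩
  have hb : base x = y₀ := by simp [hx]
  have hh : height x = ε * (d y₀ / 2) := by simp [hx]
  have g1 := (h1 ε hε hε1 u hu x hmem (by
    rw [hb]; exact P.regular _ (Metric.mem_closedBall_self P.r_pos.le))).2.2.2
  have g2 := h2 ε hε hε1 u hu x hmem (by rw [hb, dist_self]; exact P.r_pos)
  rw [P.leading_eq hε, hb, hh, mul_div_cancel_left₀ _ hε.ne', sub_self] at g1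
  rw [hb, sub_self, norm_zero] at g2
  have g3 := (abs_le.1 g1).1
  have g4 := (abs_le.1 g2).1
  have g5 : C₂ * (ε ^ 4 * ε ^ 2) ≤ C₂ * (ε ^ 4 * 1) := by
    have : ε ^ 2 ≤ 1 := pow_le_one₀ hε.le hε1
    gcongr
  linarith

/-- The solution attains its maximum inside the thin domain. -/
theorem Peak.exists_isMaxOn (P : Peak ω hminus hplus H d p y₀ M K r c) :
    ∃ ε₁ > 0, ∀ ε : ℝ, 0 < ε → ε < ε₁ → ∀ u : EuclideanSpace ℝ (Fin (m + 1)) → ℝ,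
      IsTorsionSolution (thinDomain ω hminus hplus ε) u →
      ∃ x ∈ thinDomain ω hminus hplus ε, IsMaxOn u (thinDomain ω hminus hplus ε) x := by
  obtain ⟨C, hC, h1⟩ := P.exists_lower_bound
  have hH := P.pos
  refine ⟨min 1 (H y₀ ^ 2 / (4 * C)), lt_min one_pos (by positivity), fun ε hε hε1 u hu => ?_⟩
  obtain ⟨hε1, hε2⟩ := lt_min_iff.1 hε1
  rw [lt_div_iff₀ (by positivity)] at hε2
  obtain ⟨hmem, hlow⟩ := h1 ε hε hε1.le u hu
  have hpos : 0 < u (join y₀ (ε * (d y₀ / 2))) := by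
    refine lt_of_lt_of_le ?_ hlow
    have : C * ε ^ 2 ≤ C * ε := by
      have : ε ^ 2 ≤ ε := by nlinarith
      gcongr
    have : 0 < H y₀ ^ 2 / 4 - C * ε ^ 2 := by linarith
    positivity
  have hb := isBounded_thinDomain hε P.profile.isBounded P.profile.abs_minus_le
    P.profile.abs_plus_le
  obtain ⟨q, hq, hmax⟩ := hb.isCompact_closure.exists_isMaxOn ⟨_, subset_closure hmem⟩
    hu.continuousOn
  refine ⟨q, ?_, hmax.on_subset subset_closure⟩
  by_contra hqn
  have h2 : u q = 0 := hu.boundary q (by rw [(P.isOpen ε).frontier_eq]; exact ⟨hq, hqn⟩)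
  have h3 : u (join y₀ (ε * (d y₀ / 2))) ≤ u q := hmax (subset_closure hmem)
  linarith

set_option maxHeartbeats 1000000 in
/-- Any maximizer is close to the middle of the thickest fibre. -/
theorem Peak.exists_maximizer_close (P : Peak ω hminus hplus H d p y₀ M K r c) :
    ∃ C > 0, ∃ ε₁ > 0, ∀ ε : ℝ, 0 < ε → ε < ε₁ → ∀ u : EuclideanSpace ℝ (Fin (m + 1)) → ℝ,
      IsTorsionSolution (thinDomain ω hminus hplus ε) u →
      ∀ x ∈ thinDomain ω hminus hplus ε, IsMaxOn u (thinDomain ω hminus hplus ε) x →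
        ‖base x - y₀‖ ^ 2 ≤ C * ε ^ 2 ∧ (height x / ε - d (base x) / 2) ^ 2 ≤ C * ε ^ 2 := by
  obtain ⟨C₀, hC₀, h0⟩ := P.exists_lower_bound
  obtain ⟨C₁, hC₁, h1⟩ := P.profile.exists_abs_laplacian_sub_approx_le (d := d) (p := p) P.K_pos
  obtain ⟨C₂, hC₂, h2⟩ := P.profile.exists_abs_sub_approx_le P.d_eq P.p_eq P.K_pos P.r_pos
    P.ball_subset P.regular
  have hH := P.pos
  have hc := P.c_pos
  set c' := c * H y₀ / 4 with hc'
  have hc'0 : 0 < c' := by positivity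
  -- On this smaller ball the part `2 C₂ ‖y - y₀‖⁴` of the error weight is at most half of the gain
  -- `c' ‖y - y₀‖²` from the decay of `H²/4`.
  obtain ⟨r', hr', hr'r, hr'c⟩ : ∃ r' > 0, r' ≤ r ∧ 2 * C₂ * r' ^ 2 ≤ c' / 2 := by
    refine ⟨min r (min 1 (c' / (4 * C₂))), lt_min P.r_pos (lt_min one_pos (by positivity)),
      min_le_left _ _, ?_⟩
    set s := min r (min 1 (c' / (4 * C₂))) with hs
    have hs0 : 0 < s := lt_min P.r_pos (lt_min one_pos (by positivity))
    have hs1 : s ≤ 1 := (min_le_right _ _).trans (min_le_left _ _)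
    have hs2 : s ≤ c' / (4 * C₂) := (min_le_right _ _).trans (min_le_right _ _)
    rw [le_div_iff₀ (by positivity)] at hs2
    have : s ^ 2 ≤ s := by nlinarith
    nlinarith
  have hScomp : IsCompact (closure ω ∩ (Metric.ball y₀ r')ᶜ) :=
    P.profile.isBounded.isCompact_closure.inter_right Metric.isOpen_ball.isClosed_compl
  obtain ⟨η, hη, ε₂, hε₂, h3⟩ := P.profile.exists_le_of_lt hScomp inter_subset_left hH
    (fun y hy => by
      rw [← P.H_eq]
      refine P.H_lt y hy.1 ?_
      rintro rfl
      exact hy.2 (Metric.mem_ball_self hr'))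
  set A := C₀ + C₁ + 2 * C₂ with hA
  have hA0 : 0 < A := by positivity
  refine ⟨A + A / (c' / 2), by positivity, min ε₂ (min 1 (η / C₀)),
    lt_min hε₂ (lt_min one_pos (by positivity)), fun ε hε hεlt u hu x hx hmax => ?_⟩
  obtain ⟨hεε₂, hεlt⟩ := lt_min_iff.1 hεlt
  obtain ⟨hε1, hεη⟩ := lt_min_iff.1 hεlt
  rw [lt_div_iff₀ hC₀] at hεη
  obtain ⟨hmem, hlow⟩ := h0 ε hε hε1.le u hu
  have hlow' : ε ^ 2 * (H y₀ ^ 2 / 4 - C₀ * ε ^ 2) ≤ u x := hlow.trans (hmax hmem)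
  have hε2 : 0 < ε ^ 2 := by positivity
  have hzr : dist (base x) y₀ < r' := by
    by_contra hcon
    have := hlow'.trans (h3 ε hε hεε₂ u hu x hx ⟨subset_closure hx.1, hcon⟩)
    have h4 := le_of_mul_le_mul_left this hε2
    have : C₀ * ε ^ 2 ≤ C₀ * ε := by
      have : ε ^ 2 ≤ ε := by nlinarith
      gcongr
    linarith
  have hzr2 : dist (base x) y₀ ≤ r := hzr.le.trans hr'r
  have g1 := (h1 ε hε hε1.le u hu x hx (P.regular _ hzr2)).2.2.2
  have g2 := h2 ε hε hε1.le u hu x hx (hzr.trans_le hr'r)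
  rw [P.leading_eq hε] at g1
  have g3 := (abs_le.1 g1).2
  have g4 := (abs_le.1 g2).2
  set N := ‖base x - y₀‖ ^ 2 with hN
  set X := (height x / ε - d (base x) / 2) ^ 2 with hX
  have hN0 : 0 ≤ N := sq_nonneg _
  have hX0 : 0 ≤ X := sq_nonneg _
  have hNr : N ≤ r' ^ 2 := by
    rw [dist_eq_norm] at hzr
    exact pow_le_pow_left₀ (norm_nonneg _) hzr.le 2
  have hHx : H (base x) ^ 2 / 4 ≤ H y₀ ^ 2 / 4 - c' * N := by
    have k1 := P.H_le _ hzr2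
    have k2 := P.H_pos _ hx.1
    have k3 : H (base x) * H (base x) ≤ H y₀ * (H y₀ - c * N) := by
      have : 0 ≤ c * N := by positivity
      exact mul_le_mul (by linarith) k1 k2.le hH.le
    rw [hc']; nlinarith
  -- This chains `ε² (H₀²/4 - C₀ ε²) ≤ u x` with `u x ≤ ε² (H²/4 - X) + C₁ ε⁴ + C₂ ε² (ε² + N)²`;
  -- the `N²` part is absorbed by the choice of `r'`.
  have key : ε ^ 2 * (c' / 2 * N + X) ≤ ε ^ 2 * (A * ε ^ 2) := by
    have k1 : (ε ^ 2 + N) ^ 2 ≤ 2 * ε ^ 2 + 2 * (r' ^ 2 * N) := by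
      have k2 : N * N ≤ r' ^ 2 * N := mul_le_mul_of_nonneg_right hNr hN0
      have k3 : ε ^ 2 * ε ^ 2 ≤ 1 * ε ^ 2 :=
        mul_le_mul_of_nonneg_right (pow_le_one₀ hε.le hε1.le) hε2.le
      nlinarith [sq_nonneg (ε ^ 2 - N)]
    have k2 := mul_le_mul_of_nonneg_left k1 (by positivity : 0 ≤ C₂ * ε ^ 2)
    have k3 := mul_le_mul_of_nonneg_left hHx hε2.le
    have k4 : ε ^ 2 * N * (2 * C₂ * r' ^ 2) ≤ ε ^ 2 * N * (c' / 2) :=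
      mul_le_mul_of_nonneg_left hr'c (by positivity)
    rw [hA]
    linarith
  have key2 := le_of_mul_le_mul_left key hε2
  have hpos : 0 ≤ c' / 2 * N := by positivity
  constructor
  · have : N ≤ A / (c' / 2) * ε ^ 2 := by
      rw [div_mul_eq_mul_div, le_div_iff₀ (by positivity)]
      linarith
    have : 0 ≤ A * ε ^ 2 := by positivity
    linarith
  · have : 0 ≤ A / (c' / 2) * ε ^ 2 := by positivity
    linarith

/-- At a maximizer, the two-term expansion is accurate and almost critical. -/
theorem Peak.exists_abs_fderiv_approx_le (P : Peak ω hminus hplus H d p y₀ M K r c) :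
    ∃ C > 0, ∃ ε₁ > 0, ∀ ε : ℝ, 0 < ε → ε < ε₁ → ∀ u : EuclideanSpace ℝ (Fin (m + 1)) → ℝ,
      IsTorsionSolution (thinDomain ω hminus hplus ε) u →
      ∀ x ∈ thinDomain ω hminus hplus ε, IsMaxOn u (thinDomain ω hminus hplus ε) x →
        |u x - approx d p ε x| ≤ C * ε ^ 6 ∧
        ∀ e, ‖e‖ = 1 → |fderiv ℝ (approx d p ε) x e| ≤ C * ε ^ 5 := by
  obtain ⟨C₀, hC₀, ε₀, hε₀, h0⟩ := P.exists_maximizer_close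
  obtain ⟨C₁, hC₁, h1⟩ := P.profile.exists_abs_laplacian_sub_approx_le (d := d) (p := p) P.K_pos
  obtain ⟨C₂, hC₂, h2⟩ := P.profile.exists_abs_sub_approx_le P.d_eq P.p_eq P.K_pos P.r_pos
    P.ball_subset P.regular
  have hH := P.pos
  have hr := P.r_pos
  set B := √C₀ with hB
  have hB0 : 0 < B := Real.sqrt_pos.2 hC₀
  have hB2 : B ^ 2 = C₀ := Real.sq_sqrt hC₀.le
  set a := H y₀ / 8 with ha
  have ha0 : 0 < a := by positivity
  set C₄ := C₂ * (1 + (B + a) ^ 2) ^ 2 with hC₄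
  have hC₄0 : 0 < C₄ := by positivity
  -- The output of the gradient estimate at radius `a ε`, with values `C₄ ε⁶` and Laplacian bound
  -- `(C₁ + 1) ε⁴`; the `+ 1` is there because that bound must be strict.
  set C₅ := (m + 1 : ℕ) * C₄ / a + (C₁ + 1) * a / 2 with hC₅
  have hC₅0 : 0 < C₅ := by positivity
  refine ⟨C₄ + C₅, by positivity, min ε₀ (min 1 (min (a / (2 * B)) (r / (2 * (B + a))))),
    lt_min hε₀ (lt_min one_pos (lt_min (by positivity) (by positivity))),
    fun ε hε hεlt u hu x hx hmax => ?_⟩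
  obtain ⟨hεε₀, hεlt⟩ := lt_min_iff.1 hεlt
  obtain ⟨hε1, hεlt⟩ := lt_min_iff.1 hεlt
  obtain ⟨hεB, hεr⟩ := lt_min_iff.1 hεlt
  rw [lt_div_iff₀ (by positivity)] at hεB hεr
  obtain ⟨hz, hξ⟩ := h0 ε hε hεε₀ u hu x hx hmax
  have hz' : ‖base x - y₀‖ ≤ B * ε := by
    refine (pow_le_pow_iff_left₀ (norm_nonneg _) (by positivity) two_ne_zero).1 ?_
    rw [mul_pow, hB2]; exact hz
  have hξ' : |height x / ε - d (base x) / 2| ≤ B * ε := by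
    refine abs_le_of_sq_le_sq ?_ (by positivity)
    rw [mul_pow, hB2]; exact hξ
  have hxball : base x ∈ Metric.closedBall y₀ r := by
    rw [Metric.mem_closedBall, dist_eq_norm]
    nlinarith
  -- The half-thickness at the peak is `4a` in rescaled height. The offset of the maximizer from its
  -- midpoint uses at most `a/2`, the variation of the profile `2a`, and the radius of the ball `a`,
  -- so the ball stays in the domain.
  have hnear : ∀ z ∈ Metric.closedBall x (a * ε), ‖base z - y₀‖ ≤ (B + a) * ε ∧
      dist (base z) y₀ < r ∧ z ∈ thinDomain ω hminus hplus ε := by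
    intro z hz
    rw [Metric.mem_closedBall, dist_eq_norm] at hz
    have k1 : ‖base z - y₀‖ ≤ (B + a) * ε := by
      have := norm_sub_le_norm_sub_add_norm_sub (base z) (base x) y₀
      have := norm_base_sub_le z x
      linarith
    have k2 : dist (base z) y₀ < r := by
      rw [dist_eq_norm]; nlinarith
    refine ⟨k1, k2, P.ball_subset k2.le, ?_⟩
    have k3 := abs_le.1 ((abs_height_sub_le z x).trans hz)
    have k4 := abs_le.1 (P.minus_close _ k2.le)
    have k5 := abs_le.1 (P.plus_close _ k2.le)
    have k6 := abs_le.1 (P.minus_close _ hxball)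
    have k7 := abs_le.1 (P.plus_close _ hxball)
    have k8 := abs_le.1 hξ'
    have k9 : height x = ε * (height x / ε) := by field_simp
    have k10 : H y₀ = hminus y₀ + hplus y₀ := P.H_eq _
    have k11 := P.d_eq (base x)
    set ξ := height x / ε
    rw [k9] at k3
    constructor
    · have : 0 < ε * (ξ - a + hminus (base z)) := by
        refine mul_pos hε ?_
        linarith
      linarith
    · have : 0 < ε * (hplus (base z) - ξ - a) := by
        refine mul_pos hε ?_
        linarith
      linarith
  have hval : ∀ z ∈ Metric.closedBall x (a * ε), |u z - approx d p ε z| ≤ C₄ * ε ^ 6 := by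
    intro z hz
    obtain ⟨k1, k2, k3⟩ := hnear z hz
    refine (h2 ε hε hε1.le u hu z k3 k2).trans ?_
    have : ‖base z - y₀‖ ^ 2 ≤ ((B + a) * ε) ^ 2 := pow_le_pow_left₀ (norm_nonneg _) k1 2
    calc C₂ * ε ^ 2 * (ε ^ 2 + ‖base z - y₀‖ ^ 2) ^ 2
        ≤ C₂ * ε ^ 2 * (ε ^ 2 + ((B + a) * ε) ^ 2) ^ 2 := by gcongr
      _ = C₄ * ε ^ 6 := by rw [hC₄]; ring
  have hxself : x ∈ Metric.closedBall x (a * ε) := Metric.mem_closedBall_self (by positivity)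
  constructor
  · refine (hval x hxself).trans ?_
    have : 0 ≤ C₅ * ε ^ 6 := by positivity
    linarith
  · intro e he
    have hgrad := abs_fderiv_apply_le (w := u - approx d p ε) (x₀ := x) (ρ := a * ε)
      (M := C₄ * ε ^ 6) (N := (C₁ + 1) * ε ^ 4) (by positivity) he
      (fun z hz => (h1 ε hε hε1.le u hu z (hnear z hz).2.2
        (P.regular _ (hnear z hz).2.1.le)).1) hval
      (fun z hz => ((h1 ε hε hε1.le u hu z (hnear z hz).2.2
        (P.regular _ (hnear z hz).2.1.le)).2.1).trans_lt
        (by have : 0 < ε ^ 4 := by positivity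
            linarith))
    have hreg := P.regular _ hxball
    have hA := (laplacian_approx (ε := ε) hreg.contDiffAt_d hreg.contDiffAt_p
      hreg.contDiffAt_corrConst hreg.contDiffAt_corrLin).1
    have hu0 : fderiv ℝ u x = 0 :=
      (hmax.isLocalMax ((P.isOpen ε).mem_nhds hx)).fderiv_eq_zero
    rw [fderiv_sub ((hu.contDiffAt (P.isOpen ε) hx).differentiableAt (by simp))
      (hA.differentiableAt (by simp)), hu0, zero_sub, _root_.neg_apply, abs_neg] at hgrad
    refine hgrad.trans ?_
    rw [finrank_euclideanSpace_fin]
    have k1 : ((m + 1 : ℕ) : ℝ) * (C₄ * ε ^ 6) / (a * ε) + (C₁ + 1) * ε ^ 4 * (a * ε) / 2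
        = C₅ * ε ^ 5 := by
      rw [hC₅]; field_simp
    rw [k1]
    have : 0 ≤ C₄ * ε ^ 5 := by positivity
    linarith

end Maximizers

/-! ### Asymptotic algebra for almost critical points of the expansion -/

section Asymptotics

theorem isBigO_mul_sub_mul {α : Type*} {l : Filter α} {f g h : α → ℝ} {f₀ g₀ : ℝ}
    (hh : h =O[l] fun _ => (1 : ℝ)) (hf : (fun q => f q - f₀) =O[l] h)
    (hg : (fun q => g q - g₀) =O[l] h) : (fun q => f q * g q - f₀ * g₀) =O[l] h := by
  have hg1 : g =O[l] fun _ => (1 : ℝ) := by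
    have := (hg.trans hh).add (isBigO_const_const g₀ one_ne_zero l)
    exact this.congr_left fun q => by simp
  have h1 : (fun q => (f q - f₀) * g q) =O[l] h := by simpa using hf.mul hg1
  exact (h1.add (hg.const_mul_left f₀)).congr_left fun q => by ring

theorem isBigO_pow_pow {α : Type*} {l : Filter α} {ε : α → ℝ} (hε : Tendsto ε l (𝓝 0))
    {a b : ℕ} (hab : b ≤ a) : (fun q => ε q ^ a) =O[l] fun q => ε q ^ b := by
  have h : ∀ᶠ q in l, |ε q| ≤ 1 := by
    have := hε.abs
    rw [abs_zero] at this
    exact (this.eventually (gt_mem_nhds one_pos)).mono fun q hq => hq.le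
  refine IsBigO.of_bound 1 ?_
  filter_upwards [h] with q hq
  rw [norm_pow, norm_pow, one_mul, Real.norm_eq_abs]
  exact pow_le_pow_of_le_one (abs_nonneg _) hq hab

variable {m : ℕ}

theorem isBigO_of_forall_apply {α : Type*} {l : Filter α} {z : α → EuclideanSpace ℝ (Fin m)}
    {g : α → ℝ} (h : ∀ j, (fun q => z q j) =O[l] g) : z =O[l] g := by
  have h1 : (fun q => ∑ j, z q j • EuclideanSpace.single j (1 : ℝ)) =O[l] g := by
    refine IsBigO.fun_sum fun j _ => ?_
    refine IsBigO.trans (isBigO_of_le _ fun q => ?_) (h j)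
    simp [norm_smul]
  exact h1.congr_left fun q => sum_smul_single _

variable {α : Type*} {l : Filter α} {ε : α → ℝ} {y : α → EuclideanSpace ℝ (Fin m)} {ξ : α → ℝ}
  {y₀ : EuclideanSpace ℝ (Fin m)}

theorem isBigO_comp_sub {n : ℕ} {f : EuclideanSpace ℝ (Fin m) → ℝ} (hf : DifferentiableAt ℝ f y₀)
    (hy : Tendsto y l (𝓝 y₀)) (hz : (fun q => y q - y₀) =O[l] fun q => ε q ^ n) :
    (fun q => f (y q) - f y₀) =O[l] fun q => ε q ^ n :=
  (hf.hasFDerivAt.isBigO_sub.comp_tendsto hy).trans hz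

theorem isBigO_comp_taylor {n : ℕ} {f : EuclideanSpace ℝ (Fin m) → ℝ} (hf : ContDiffAt ℝ 2 f y₀)
    (hy : Tendsto y l (𝓝 y₀)) (hz : (fun q => y q - y₀) =O[l] fun q => ε q ^ n) :
    (fun q => f (y q) - f y₀ - fderiv ℝ f y₀ (y q - y₀)) =O[l] fun q => ε q ^ (2 * n) := by
  have h := ((isBigO_taylor_two hf).comp_tendsto hy)
  refine h.trans ?_
  have := hz.norm_left.pow 2
  simpa [pow_mul, mul_comm 2 n, Function.comp_def] using this

theorem isBigO_fderiv_comp_taylor {n : ℕ} {f : EuclideanSpace ℝ (Fin m) → ℝ}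
    (hf : ContDiffAt ℝ 3 f y₀)
    (hy : Tendsto y l (𝓝 y₀)) (hz : (fun q => y q - y₀) =O[l] fun q => ε q ^ n) (k : Fin m) :
    (fun q => fderiv ℝ f (y q) (EuclideanSpace.single k 1)
      - fderiv ℝ f y₀ (EuclideanSpace.single k 1)
      - 2 * ∑ i, (y q - y₀) i * halfHessian f y₀ i k) =O[l] fun q => ε q ^ (2 * n) := by
  have hf' : ContDiffAt ℝ 2 (fderiv ℝ f) y₀ := hf.fderiv_right (by norm_num)
  have hg : ContDiffAt ℝ 2 (fun y => fderiv ℝ f y (EuclideanSpace.single k 1)) y₀ :=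
    hf'.clm_apply contDiffAt_const
  refine (isBigO_comp_taylor hg hy hz).congr_left fun q => ?_
  have hd := ((hf'.differentiableAt (by simp)).hasFDerivAt.clm_apply
    (hasFDerivAt_const (EuclideanSpace.single k (1 : ℝ)) y₀)).fderiv
  rw [hd, ← fderiv_fderiv_apply_single]
  simp

theorem differentiableAt_fderiv_apply {f : EuclideanSpace ℝ (Fin m) → ℝ} (hf : ContDiffAt ℝ 2 f y₀)
    (v : EuclideanSpace ℝ (Fin m)) : DifferentiableAt ℝ (fun y => fderiv ℝ f y v) y₀ :=
  ((hf.fderiv_right (m := 1) (by norm_num)).differentiableAt (by simp)).clm_apply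
    (differentiableAt_const v)

/-- Points `(y, ξ)` which, along the filter `l`, are almost critical for the two-term expansion. -/
structure AlmostCritical (H d p : EuclideanSpace ℝ (Fin m) → ℝ) (y₀ : EuclideanSpace ℝ (Fin m))
    (l : Filter α) (ε : α → ℝ) (y : α → EuclideanSpace ℝ (Fin m)) (ξ v : α → ℝ) : Prop where
  tendsto : Tendsto ε l (𝓝 0)
  base_isBigO : (fun q => y q - y₀) =O[l] fun q => ε q ^ 1
  height_isBigO : (fun q => ξ q - d (y q) / 2) =O[l] fun q => ε q ^ 1
  fderiv_base : ∀ k, (fun q => (fderiv ℝ p (y q) (EuclideanSpace.single k 1)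
      + ξ q * fderiv ℝ d (y q) (EuclideanSpace.single k 1))
        * (1 + ε q ^ 2 * (corrConst d p (y q) + corrLin d (y q) * ξ q))
      + ε q ^ 2 * ((p (y q) + d (y q) * ξ q - ξ q ^ 2)
        * (fderiv ℝ (corrConst d p) (y q) (EuclideanSpace.single k 1)
          + ξ q * fderiv ℝ (corrLin d) (y q) (EuclideanSpace.single k 1))))
      =O[l] fun q => ε q ^ 3
  fderiv_height : (fun q => (d (y q) - 2 * ξ q)
        * (1 + ε q ^ 2 * (corrConst d p (y q) + corrLin d (y q) * ξ q))
      + ε q ^ 2 * ((p (y q) + d (y q) * ξ q - ξ q ^ 2) * corrLin d (y q))) =O[l] fun q => ε q ^ 3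
  value : (fun q => v q - ε q ^ 2 * ((p (y q) + d (y q) * ξ q - ξ q ^ 2)
        * (1 + ε q ^ 2 * (corrConst d p (y q) + corrLin d (y q) * ξ q)))) =O[l] fun q => ε q ^ 5
  contDiffAt_H : ContDiffAt ℝ 5 H y₀
  contDiffAt_d : ContDiffAt ℝ 5 d y₀
  p_eq : ∀ y, p y = H y ^ 2 / 4 - d y ^ 2 / 4
  fderiv_H : fderiv ℝ H y₀ = 0
  H_pos : 0 < H y₀
  posDef : (-halfHessian H y₀).PosDef

variable {H d p : EuclideanSpace ℝ (Fin m) → ℝ} {v : α → ℝ}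

namespace AlmostCritical

theorem tendsto_base (A : AlmostCritical H d p y₀ l ε y ξ v) : Tendsto y l (𝓝 y₀) := by
  have h1 : Tendsto (fun q => ε q ^ 1) l (𝓝 0) := by simpa using A.tendsto
  have := (A.base_isBigO.trans_tendsto h1).add_const y₀
  simpa using this

theorem contDiffAt_p (A : AlmostCritical H d p y₀ l ε y ξ v) : ContDiffAt ℝ 5 p y₀ := by
  have : p = fun y => H y ^ 2 / 4 - d y ^ 2 / 4 := funext A.p_eq
  rw [this]
  exact ((A.contDiffAt_H.pow 2).div_const 4).sub ((A.contDiffAt_d.pow 2).div_const 4)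

theorem pow_isBigO_one (A : AlmostCritical H d p y₀ l ε y ξ v) (n : ℕ) :
    (fun q => ε q ^ n) =O[l] fun _ => (1 : ℝ) := by
  simpa using isBigO_pow_pow A.tendsto (Nat.zero_le n)

theorem comp_sub (A : AlmostCritical H d p y₀ l ε y ξ v) {f : EuclideanSpace ℝ (Fin m) → ℝ}
    (hf : DifferentiableAt ℝ f y₀) : (fun q => f (y q) - f y₀) =O[l] fun q => ε q ^ 1 :=
  isBigO_comp_sub hf A.tendsto_base A.base_isBigO

theorem height_sub (A : AlmostCritical H d p y₀ l ε y ξ v) :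
    (fun q => ξ q - d y₀ / 2) =O[l] fun q => ε q ^ 1 := by
  have h := A.comp_sub (A.contDiffAt_d.differentiableAt (by simp))
  exact (A.height_isBigO.add (h.const_mul_left (1 / 2))).congr_left fun q => by ring

theorem contDiffAt_corrLin (A : AlmostCritical H d p y₀ l ε y ξ v) :
    ContDiffAt ℝ 3 (corrLin d) y₀ := ThinDomain.contDiffAt_corrLin A.contDiffAt_d

theorem contDiffAt_corrConst (A : AlmostCritical H d p y₀ l ε y ξ v) :
    ContDiffAt ℝ 3 (corrConst d p) y₀ :=
  ThinDomain.contDiffAt_corrConst A.contDiffAt_d A.contDiffAt_p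

theorem leading_sub (A : AlmostCritical H d p y₀ l ε y ξ v) :
    (fun q => (p (y q) + d (y q) * ξ q - ξ q ^ 2) - H y₀ ^ 2 / 4) =O[l] fun q => ε q ^ 1 := by
  have h1 := A.comp_sub (A.contDiffAt_p.differentiableAt (by simp))
  have h2 := isBigO_mul_sub_mul (A.pow_isBigO_one 1)
    (A.comp_sub (A.contDiffAt_d.differentiableAt (by simp))) A.height_sub
  have h3 := isBigO_mul_sub_mul (A.pow_isBigO_one 1) A.height_sub A.height_sub
  refine ((h1.add h2).sub h3).congr_left fun q => ?_
  rw [A.p_eq y₀]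
  ring

/-- Expansion of the second factor. -/
theorem factor_sub (A : AlmostCritical H d p y₀ l ε y ξ v) :
    (fun q => (corrConst d p (y q) + corrLin d (y q) * ξ q)
      - (corrConst d p y₀ + corrLin d y₀ * (d y₀ / 2))) =O[l] fun q => ε q ^ 1 := by
  have h1 := A.comp_sub (A.contDiffAt_corrConst.differentiableAt (by simp))
  have h2 := isBigO_mul_sub_mul (A.pow_isBigO_one 1)
    (A.comp_sub (A.contDiffAt_corrLin.differentiableAt (by simp))) A.height_sub
  exact (h1.add h2).congr_left fun q => by ring

theorem factor_isBigO (A : AlmostCritical H d p y₀ l ε y ξ v) :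
    (fun q => corrConst d p (y q) + corrLin d (y q) * ξ q) =O[l] fun _ => (1 : ℝ) := by
  have h := (A.factor_sub.trans (A.pow_isBigO_one 1)).add
    (isBigO_const_const (corrConst d p y₀ + corrLin d y₀ * (d y₀ / 2)) one_ne_zero l)
  exact h.congr_left fun q => by ring

/-- In the vertical equation the correction factor multiplies `d - 2ξ`, already `O(ε)`, by `ε²`. Up
to third order only the derivative of that factor remains, evaluated at the peak. -/
theorem height_deviation (A : AlmostCritical H d p y₀ l ε y ξ v) :
    (fun q => (d (y q) - 2 * ξ q) + ε q ^ 2 * (H y₀ ^ 2 / 4 * corrLin d y₀))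
      =O[l] fun q => ε q ^ 3 := by
  have hS : (fun q => d (y q) - 2 * ξ q) =O[l] fun q => ε q ^ 1 :=
    (A.height_isBigO.const_mul_left (-2)).congr_left fun q => by ring
  have h1 : (fun q => (d (y q) - 2 * ξ q)
      * (ε q ^ 2 * (corrConst d p (y q) + corrLin d (y q) * ξ q))) =O[l] fun q => ε q ^ 3 := by
    have := hS.mul ((isBigO_refl (fun q => ε q ^ 2) l).mul A.factor_isBigO)
    exact this.congr_right fun q => by ring
  have h2 : (fun q => ε q ^ 2 * ((p (y q) + d (y q) * ξ q - ξ q ^ 2) * corrLin d (y q)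
      - H y₀ ^ 2 / 4 * corrLin d y₀)) =O[l] fun q => ε q ^ 3 := by
    have := (isBigO_refl (fun q => ε q ^ 2) l).mul (isBigO_mul_sub_mul (A.pow_isBigO_one 1)
      A.leading_sub (A.comp_sub (A.contDiffAt_corrLin.differentiableAt (by simp))))
    exact this.congr_right fun q => by ring
  exact ((A.fderiv_height.sub h1).sub h2).congr_left fun q => by ring

theorem height_deviation_isBigO (A : AlmostCritical H d p y₀ l ε y ξ v) :
    (fun q => d (y q) - 2 * ξ q) =O[l] fun q => ε q ^ 2 := by
  have h1 := A.height_deviation.trans (isBigO_pow_pow A.tendsto (by norm_num : 2 ≤ 3))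
  have h2 := (isBigO_refl (fun q => ε q ^ 2) l).const_mul_left (H y₀ ^ 2 / 4 * corrLin d y₀)
  exact (h1.sub h2).congr_left fun q => by ring

theorem fderiv_H_isBigO (A : AlmostCritical H d p y₀ l ε y ξ v) (k : Fin m) :
    (fun q => fderiv ℝ H (y q) (EuclideanSpace.single k 1)) =O[l] fun q => ε q ^ 1 := by
  have := A.comp_sub (differentiableAt_fderiv_apply (A.contDiffAt_H.of_le (by norm_num))
    (EuclideanSpace.single k 1))
  exact this.congr_left fun q => by simp [A.fderiv_H]

/-- The exponent doubles because `y₀` is a critical point of `H`. -/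
theorem H_sub_isBigO (A : AlmostCritical H d p y₀ l ε y ξ v) {n : ℕ}
    (hz : (fun q => y q - y₀) =O[l] fun q => ε q ^ n) :
    (fun q => H (y q) - H y₀) =O[l] fun q => ε q ^ (2 * n) :=
  (isBigO_comp_taylor (A.contDiffAt_H.of_le (by norm_num)) A.tendsto_base hz).congr_left
    fun q => by simp [A.fderiv_H]

/-- From `p = (H² - d²)/4` one has `∂p + ξ ∂d = (H/2) ∂H - (1/2)(d - 2ξ) ∂d`. The second term is
known from `height_deviation`, so the horizontal equation determines `∂H` to third order. -/
theorem fderiv_H_expansion (A : AlmostCritical H d p y₀ l ε y ξ v) (k : Fin m) :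
    (fun q => H y₀ / 2 * fderiv ℝ H (y q) (EuclideanSpace.single k 1)
      + ε q ^ 2 * (H y₀ ^ 2 / 4 * (fderiv ℝ (corrConst d p) y₀ (EuclideanSpace.single k 1)
          + d y₀ / 2 * fderiv ℝ (corrLin d) y₀ (EuclideanSpace.single k 1))
        + 1 / 2 * (H y₀ ^ 2 / 4 * corrLin d y₀) * fderiv ℝ d y₀ (EuclideanSpace.single k 1)))
      =O[l] fun q => ε q ^ 3 := by
  set e : EuclideanSpace ℝ (Fin m) := EuclideanSpace.single k 1
  have hDd := A.comp_sub (differentiableAt_fderiv_apply (A.contDiffAt_d.of_le (by norm_num)) e)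
  have hDa := A.comp_sub (differentiableAt_fderiv_apply
    (A.contDiffAt_corrConst.of_le (by norm_num)) e)
  have hDb := A.comp_sub (differentiableAt_fderiv_apply
    (A.contDiffAt_corrLin.of_le (by norm_num)) e)
  have hDd1 : (fun q => fderiv ℝ d (y q) e) =O[l] fun _ => (1 : ℝ) := by
    have h := (hDd.trans (A.pow_isBigO_one 1)).add
      (isBigO_const_const (fderiv ℝ d y₀ e) one_ne_zero l)
    exact h.congr_left fun q => by ring
  have hH1 : (fun q => H (y q)) =O[l] fun _ => (1 : ℝ) := by
    have h := ((A.H_sub_isBigO A.base_isBigO).trans (A.pow_isBigO_one _)).add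
      (isBigO_const_const (H y₀) one_ne_zero l)
    exact h.congr_left fun q => by ring
  have hDH := A.fderiv_H_isBigO k
  have hDp : ∀ᶠ q in l, fderiv ℝ p (y q) e
      = H (y q) / 2 * fderiv ℝ H (y q) e - d (y q) / 2 * fderiv ℝ d (y q) e := by
    have h1 := A.tendsto_base.eventually ((A.contDiffAt_H.of_le
      (by norm_num : (1 : WithTop ℕ∞) ≤ 5)).eventually (by simp))
    have h2 := A.tendsto_base.eventually ((A.contDiffAt_d.of_le
      (by norm_num : (1 : WithTop ℕ∞) ≤ 5)).eventually (by simp))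
    filter_upwards [h1, h2] with q g1 g2
    have hp : p = fun y => H y ^ 2 * (1 / 4) - d y ^ 2 * (1 / 4) := by
      funext y; rw [A.p_eq]; ring
    rw [hp]
    have k1 := (((g1.differentiableAt (by simp)).hasFDerivAt.pow 2).mul_const (1 / 4 : ℝ)).fun_sub
      (((g2.differentiableAt (by simp)).hasFDerivAt.pow 2).mul_const (1 / 4 : ℝ))
    rw [k1.fderiv]
    simp
    ring
  have hS := A.height_deviation_isBigO
  have hX : (fun q => fderiv ℝ p (y q) e + ξ q * fderiv ℝ d (y q) e) =O[l] fun q => ε q ^ 1 := by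
    have h1 : (fun q => H (y q) / 2 * fderiv ℝ H (y q) e) =O[l] fun q => ε q ^ 1 :=
      ((hH1.mul hDH).const_mul_left (1 / 2)).congr (fun q => by ring) (fun q => by ring)
    have h2 : (fun q => (d (y q) - 2 * ξ q) / 2 * fderiv ℝ d (y q) e) =O[l] fun q => ε q ^ 1 :=
      (((hS.trans (isBigO_pow_pow A.tendsto (by norm_num : 1 ≤ 2))).mul hDd1).const_mul_left
        (1 / 2)).congr (fun q => by ring) (fun q => by ring)
    refine (h1.sub h2).congr' ?_ EventuallyEq.rfl
    filter_upwards [hDp] with q hq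
    rw [hq]
    ring
  have h1 : (fun q => (fderiv ℝ p (y q) e + ξ q * fderiv ℝ d (y q) e)
      * (ε q ^ 2 * (corrConst d p (y q) + corrLin d (y q) * ξ q))) =O[l] fun q => ε q ^ 3 :=
    (hX.mul ((isBigO_refl (fun q => ε q ^ 2) l).mul A.factor_isBigO)).congr_right
      fun q => by ring
  have h2 : (fun q => ε q ^ 2 * ((p (y q) + d (y q) * ξ q - ξ q ^ 2)
        * (fderiv ℝ (corrConst d p) (y q) e + ξ q * fderiv ℝ (corrLin d) (y q) e)
      - H y₀ ^ 2 / 4 * (fderiv ℝ (corrConst d p) y₀ e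
        + d y₀ / 2 * fderiv ℝ (corrLin d) y₀ e))) =O[l] fun q => ε q ^ 3 := by
    have g : (fun q => (fderiv ℝ (corrConst d p) (y q) e + ξ q * fderiv ℝ (corrLin d) (y q) e)
        - (fderiv ℝ (corrConst d p) y₀ e + d y₀ / 2 * fderiv ℝ (corrLin d) y₀ e))
        =O[l] fun q => ε q ^ 1 :=
      (hDa.add (isBigO_mul_sub_mul (A.pow_isBigO_one 1) A.height_sub hDb)).congr_left
        fun q => by ring
    exact ((isBigO_refl (fun q => ε q ^ 2) l).mul (isBigO_mul_sub_mul (A.pow_isBigO_one 1)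
      A.leading_sub g)).congr_right fun q => by ring
  have h3 : (fun q => ((d (y q) - 2 * ξ q) + ε q ^ 2 * (H y₀ ^ 2 / 4 * corrLin d y₀))
      * fderiv ℝ d (y q) e) =O[l] fun q => ε q ^ 3 :=
    (A.height_deviation.mul hDd1).congr_right fun q => by ring
  have h4 : (fun q => ε q ^ 2 * (H y₀ ^ 2 / 4 * corrLin d y₀)
      * (fderiv ℝ d (y q) e - fderiv ℝ d y₀ e)) =O[l] fun q => ε q ^ 3 :=
    (((isBigO_refl (fun q => ε q ^ 2) l).mul hDd).const_mul_left
      (H y₀ ^ 2 / 4 * corrLin d y₀)).congr (fun q => by ring) (fun q => by ring)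
  have h5 : (fun q => (H (y q) - H y₀) / 2 * fderiv ℝ H (y q) e) =O[l] fun q => ε q ^ 3 :=
    (((A.H_sub_isBigO A.base_isBigO).mul hDH).const_mul_left (1 / 2)).congr
      (fun q => by ring) (fun q => by ring)
  refine (((((A.fderiv_base k).sub h1).sub h2).add (h3.const_mul_left (1 / 2))).sub
    ((h4.const_mul_left (1 / 2)).add h5)).congr' ?_ EventuallyEq.rfl
  filter_upwards [hDp] with q hq
  change (fderiv ℝ p (y q) e + ξ q * fderiv ℝ d (y q) e)
        * (1 + ε q ^ 2 * (corrConst d p (y q) + corrLin d (y q) * ξ q))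
      + ε q ^ 2 * ((p (y q) + d (y q) * ξ q - ξ q ^ 2)
        * (fderiv ℝ (corrConst d p) (y q) e
          + ξ q * fderiv ℝ (corrLin d) (y q) e)) - _ - _ + _ - _ = _
  rw [hq]
  ring

end AlmostCritical

end Asymptotics

/-! ### Solving for the base point, the height and the value -/

section Conclusions

variable {m : ℕ} {α : Type*} {l : Filter α} {ε : α → ℝ} {y : α → EuclideanSpace ℝ (Fin m)}
  {ξ v : α → ℝ} {y₀ : EuclideanSpace ℝ (Fin m)} {H d p : EuclideanSpace ℝ (Fin m) → ℝ}

/-- The bracket `(tr D₂ / 2) d₁ + 3 (Σ_π + (1/2) d₀ Σ_δ)`. -/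
noncomputable def drift (d p : EuclideanSpace ℝ (Fin m) → ℝ) (y : EuclideanSpace ℝ (Fin m)) :
    Fin m → ℝ :=
  ((halfHessian d y).trace / 2) • grad d y
    + (3 : ℝ) • (cubicSum p y + ((1 / 2 : ℝ) * d y) • cubicSum d y)

theorem baseCorrection_eq (H d p : EuclideanSpace ℝ (Fin m) → ℝ) (y : EuclideanSpace ℝ (Fin m)) :
    baseCorrection H d p y
      = WithLp.toLp 2 (-(1 / 4 * H y) • Matrix.mulVec (halfHessian H y)⁻¹ (drift d p y)) := by
  simp only [baseCorrection, drift, Matrix.mulVec_add, Matrix.mulVec_smul]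

/-- This form shows the two sources of the shift: the midpoint `d/2` moves with the base point, and
the maximizer deviates from the midpoint of its own fibre. -/
theorem heightCorrection_eq (H d p : EuclideanSpace ℝ (Fin m) → ℝ)
    (y : EuclideanSpace ℝ (Fin m)) :
    heightCorrection H d p y = 1 / 2 * dotProduct (grad d y) (baseCorrection H d p y).ofLp
      + 1 / 24 * H y ^ 2 * (halfHessian d y).trace := by
  rw [heightCorrection, baseCorrection]
  simp only [dotProduct_smul, dotProduct_add, smul_eq_mul]
  ring

theorem corrLin_eq (d : EuclideanSpace ℝ (Fin m) → ℝ) (y : EuclideanSpace ℝ (Fin m)) :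
    corrLin d y = (halfHessian d y).trace / 3 := by
  rw [corrLin, laplacian_eq_two_mul_trace]; ring

theorem corrConst_eq (d p : EuclideanSpace ℝ (Fin m) → ℝ) (y : EuclideanSpace ℝ (Fin m)) :
    corrConst d p y = (halfHessian p y).trace + d y * (halfHessian d y).trace / 3 := by
  rw [corrConst, laplacian_eq_two_mul_trace, laplacian_eq_two_mul_trace]; ring

theorem fderiv_corrLin_single (hd : ContDiffAt ℝ 5 d y₀) (k : Fin m) :
    fderiv ℝ (corrLin d) y₀ (EuclideanSpace.single k 1) = cubicSum d y₀ k := by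
  have h1 : DifferentiableAt ℝ (Laplacian.laplacian d) y₀ :=
    (contDiffAt_laplacian (k := 4) (l := 3) hd (by norm_num) (by norm_num)).differentiableAt
      (by simp)
  have e : corrLin d = fun y => Laplacian.laplacian d y * (1 / 6) := by
    funext y; rw [corrLin]; ring
  rw [e, (h1.hasFDerivAt.mul_const (1 / 6 : ℝ)).fderiv, _root_.smul_apply,
    fderiv_laplacian_single (hd.of_le (by norm_num)), smul_eq_mul]
  ring

theorem fderiv_corrConst_single (hd : ContDiffAt ℝ 5 d y₀) (hp : ContDiffAt ℝ 5 p y₀)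
    (k : Fin m) :
    fderiv ℝ (corrConst d p) y₀ (EuclideanSpace.single k 1)
      = 3 * cubicSum p y₀ k + d y₀ * cubicSum d y₀ k
        + (halfHessian d y₀).trace / 3 * grad d y₀ k := by
  have h1 : DifferentiableAt ℝ (Laplacian.laplacian d) y₀ :=
    (contDiffAt_laplacian (k := 4) (l := 3) hd (by norm_num) (by norm_num)).differentiableAt
      (by simp)
  have h2 : DifferentiableAt ℝ (Laplacian.laplacian p) y₀ :=
    (contDiffAt_laplacian (k := 4) (l := 3) hp (by norm_num) (by norm_num)).differentiableAt
      (by simp)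
  have h3 : DifferentiableAt ℝ d y₀ := hd.differentiableAt (by simp)
  have e : corrConst d p = fun y => Laplacian.laplacian p y * (1 / 2)
      + d y * Laplacian.laplacian d y * (1 / 6) := by
    funext y; rw [corrConst]; ring
  have h4 := (h2.hasFDerivAt.mul_const (1 / 2 : ℝ)).fun_add
    ((h3.hasFDerivAt.fun_mul h1.hasFDerivAt).mul_const (1 / 6 : ℝ))
  rw [e, h4.fderiv]
  simp only [_root_.add_apply, _root_.smul_apply, smul_eq_mul,
    fderiv_laplacian_single (hd.of_le (by norm_num : (3 : WithTop ℕ∞) ≤ 5)),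
    fderiv_laplacian_single (hp.of_le (by norm_num : (3 : WithTop ℕ∞) ≤ 5)),
    laplacian_eq_two_mul_trace, grad]
  ring

namespace AlmostCritical

theorem fderiv_H_expansion_drift (A : AlmostCritical H d p y₀ l ε y ξ v) (k : Fin m) :
    (fun q => H y₀ / 2 * fderiv ℝ H (y q) (EuclideanSpace.single k 1)
      + ε q ^ 2 * (H y₀ ^ 2 / 4 * drift d p y₀ k)) =O[l] fun q => ε q ^ 3 := by
  refine (A.fderiv_H_expansion k).congr_left fun q => ?_
  rw [fderiv_corrConst_single A.contDiffAt_d A.contDiffAt_p, fderiv_corrLin_single A.contDiffAt_d,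
    corrLin_eq]
  simp only [drift, grad, Pi.add_apply, Pi.smul_apply, smul_eq_mul]
  ring

/-- Linearizing `∇H` at `y₀` costs `O(ε^(2n))` when the base deviation is `O(ε^n)`, and the
resulting system is solved with the inverse Hessian. It is used twice: `n = 1`, `N = 2` improves the
deviation to `O(ε²)`, after which `n = 2`, `N = 3` gives the expansion. -/
theorem base_expansion_apply (A : AlmostCritical H d p y₀ l ε y ξ v) {n N : ℕ} (hN : N ≤ 3)
    (hNn : N ≤ 2 * n) (hz : (fun q => y q - y₀) =O[l] fun q => ε q ^ n) (j : Fin m) :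
    (fun q => (y q - y₀) j - ε q ^ 2 * baseCorrection H d p y₀ j) =O[l] fun q => ε q ^ N := by
  set B := halfHessian H y₀ with hB
  have hB0 : IsUnit B.det := by
    have := (Matrix.isUnit_iff_isUnit_det _).1 A.posDef.isUnit
    rw [Matrix.det_neg] at this
    exact isUnit_of_mul_isUnit_right this
  have hBs : B.transpose = B := by
    have h := A.posDef.1.neg
    rw [neg_neg] at h
    simpa [Matrix.IsHermitian, Matrix.conjTranspose_eq_transpose_of_trivial] using h
  have h1 : ∀ k, (fun q => H y₀ * (∑ i, (y q - y₀) i * B i k)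
      + ε q ^ 2 * (H y₀ ^ 2 / 4 * drift d p y₀ k)) =O[l] fun q => ε q ^ N := by
    intro k
    have g1 := (A.fderiv_H_expansion_drift k).trans (isBigO_pow_pow A.tendsto hN)
    have g2 := ((isBigO_fderiv_comp_taylor (A.contDiffAt_H.of_le (by norm_num)) A.tendsto_base hz
      k).trans (isBigO_pow_pow A.tendsto hNn)).const_mul_left (H y₀ / 2)
    refine (g1.sub g2).congr_left fun q => ?_
    simp only [A.fderiv_H, _root_.zero_apply, hB]
    ring
  have hH := A.H_pos.ne'
  -- Contracting the `m` equations with the `j`-th column of the inverse, divided by `H y₀`,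
  -- isolates the `j`-th coordinate.
  have h2 := IsBigO.fun_sum (s := Finset.univ)
    fun k (_ : k ∈ Finset.univ) => (h1 k).const_mul_left (B⁻¹ k j / H y₀)
  refine h2.congr_left fun q => ?_
  have hinv : ∑ k, (∑ i, (y q - y₀) i * B i k) * B⁻¹ k j = (y q - y₀) j := by
    have : Matrix.vecMul (Matrix.vecMul (y q - y₀).ofLp B) B⁻¹ = (y q - y₀).ofLp := by
      rw [Matrix.vecMul_vecMul, Matrix.mul_nonsing_inv _ hB0, Matrix.vecMul_one]
    exact congrFun this j
  have hsym : ∀ k, B⁻¹ k j = B⁻¹ j k := by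
    intro k
    have : (B⁻¹).transpose = B⁻¹ := by rw [Matrix.transpose_nonsing_inv, hBs]
    conv_rhs => rw [← this]
    rfl
  have hcorr : baseCorrection H d p y₀ j = -(1 / 4 * H y₀) * ∑ k, B⁻¹ k j * drift d p y₀ k := by
    rw [baseCorrection_eq]
    simp only [Pi.smul_apply, smul_eq_mul, Matrix.mulVec, dotProduct, hsym]
    rfl
  rw [hcorr, ← hinv, Finset.mul_sum, Finset.mul_sum, ← Finset.sum_sub_distrib]
  refine Finset.sum_congr rfl fun k _ => ?_
  field_simp
  ring

theorem base_isBigO_sq (A : AlmostCritical H d p y₀ l ε y ξ v) :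
    (fun q => y q - y₀) =O[l] fun q => ε q ^ 2 := by
  refine isBigO_of_forall_apply fun j => ?_
  have h1 := A.base_expansion_apply (by norm_num) le_rfl A.base_isBigO j
  have h2 := (isBigO_refl (fun q => ε q ^ 2) l).const_mul_left (baseCorrection H d p y₀ j)
  exact (h1.add h2).congr_left fun q => by ring

theorem base_expansion (A : AlmostCritical H d p y₀ l ε y ξ v) :
    (fun q => y q - (y₀ + ε q ^ 2 • baseCorrection H d p y₀)) =O[l] fun q => ε q ^ 3 := by
  refine isBigO_of_forall_apply fun j => ?_
  refine (A.base_expansion_apply (n := 2) le_rfl (by norm_num) A.base_isBigO_sq j).congr_left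
    fun q => ?_
  simp
  ring

theorem height_expansion (A : AlmostCritical H d p y₀ l ε y ξ v) :
    (fun q => ξ q - (d y₀ / 2 + heightCorrection H d p y₀ * ε q ^ 2)) =O[l] fun q => ε q ^ 3 := by
  have h1 := (isBigO_comp_taylor (A.contDiffAt_d.of_le (by norm_num)) A.tendsto_base
    A.base_isBigO_sq).trans (isBigO_pow_pow A.tendsto (by norm_num : 3 ≤ 2 * 2))
  have h2 := IsBigO.fun_sum (s := Finset.univ) fun j (_ : j ∈ Finset.univ) =>
    (A.base_expansion_apply (n := 2) le_rfl (by norm_num) A.base_isBigO_sq j).const_mul_left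
      (grad d y₀ j)
  refine (((h1.add h2).sub A.height_deviation).const_mul_left (1 / 2)).congr_left fun q => ?_
  have h3 : fderiv ℝ d y₀ (y q - y₀) = ∑ j, grad d y₀ j * (y q - y₀) j := by
    rw [sum_mul_apply_single]
    exact Finset.sum_congr rfl fun j _ => mul_comm _ _
  have h4 : ∑ j, grad d y₀ j * ((y q - y₀) j - ε q ^ 2 * baseCorrection H d p y₀ j)
      = ∑ j, grad d y₀ j * (y q - y₀) j
        - ε q ^ 2 * dotProduct (grad d y₀) (baseCorrection H d p y₀).ofLp := by
    rw [dotProduct, Finset.mul_sum, ← Finset.sum_sub_distrib]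
    exact Finset.sum_congr rfl fun j _ => by ring
  rw [h3, h4, heightCorrection_eq, corrLin_eq]
  ring

/-- At second-order accuracy in position, both `H - H₀` and `(d - 2ξ)²` are `O(ε⁴)`, so the parabola
contributes only `H₀²/4`. The `ε⁴` coefficient comes entirely from the correction factor at the
peak. -/
theorem value_expansion (A : AlmostCritical H d p y₀ l ε y ξ v) :
    (fun q => v q - (1 / 4 * H y₀ ^ 2 * ε q ^ 2
      + 1 / 8 * H y₀ ^ 2 * (d y₀ * (halfHessian d y₀).trace + 2 * (halfHessian p y₀).trace)
        * ε q ^ 4)) =O[l] fun q => ε q ^ 5 := by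
  have hH2 : (fun q => H (y q) - H y₀) =O[l] fun q => ε q ^ 4 := A.H_sub_isBigO A.base_isBigO_sq
  have hHsq := isBigO_mul_sub_mul (A.pow_isBigO_one 4) hH2 hH2
  have hS : (fun q => (d (y q) - 2 * ξ q) ^ 2) =O[l] fun q => ε q ^ 4 :=
    (A.height_deviation_isBigO.pow 2).congr_right fun q => by ring
  have hV : (fun q => (p (y q) + d (y q) * ξ q - ξ q ^ 2) - H y₀ ^ 2 / 4)
      =O[l] fun q => ε q ^ 4 := by
    refine ((hHsq.sub hS).const_mul_left (1 / 4)).congr_left fun q => ?_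
    rw [A.p_eq]
    ring
  have hF : (fun q => 1 + ε q ^ 2 * (corrConst d p (y q) + corrLin d (y q) * ξ q))
      =O[l] fun _ => (1 : ℝ) := by
    have := (isBigO_const_const (1 : ℝ) one_ne_zero l).add
      (((A.pow_isBigO_one 2).mul A.factor_isBigO).congr_right fun q => by norm_num)
    exact this
  have h1 : (fun q => ε q ^ 2 * (((p (y q) + d (y q) * ξ q - ξ q ^ 2) - H y₀ ^ 2 / 4)
      * (1 + ε q ^ 2 * (corrConst d p (y q) + corrLin d (y q) * ξ q)))) =O[l] fun q => ε q ^ 5 := by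
    have := (isBigO_refl (fun q => ε q ^ 2) l).mul (hV.mul hF)
    exact (this.congr_right fun q => by ring : _ =O[l] fun q => ε q ^ 6).trans
      (isBigO_pow_pow A.tendsto (by norm_num))
  have h2 : (fun q => H y₀ ^ 2 / 4 * (ε q ^ 2 * (ε q ^ 2
      * ((corrConst d p (y q) + corrLin d (y q) * ξ q)
      - (corrConst d p y₀ + corrLin d y₀ * (d y₀ / 2)))))) =O[l] fun q => ε q ^ 5 :=
    (((isBigO_refl (fun q => ε q ^ 2) l).mul ((isBigO_refl (fun q => ε q ^ 2) l).mul
      A.factor_sub)).const_mul_left _).congr_right fun q => by ring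
  refine ((A.value.add h1).add h2).congr_left fun q => ?_
  rw [corrLin_eq d y₀, corrConst_eq d p y₀]
  ring

end AlmostCritical

end Conclusions

/-! ### From analytic estimates to uniform asymptotics -/

section Assembly

variable {m : ℕ} {ω : Set (EuclideanSpace ℝ (Fin m))}
  {hminus hplus H d p : EuclideanSpace ℝ (Fin m) → ℝ} {y₀ : EuclideanSpace ℝ (Fin m)}
  {M K r c : ℝ}

theorem fderiv_approx {ε : ℝ} {x : EuclideanSpace ℝ (Fin (m + 1))}
    (h : ApproxRegular d p K (base x)) (w : EuclideanSpace ℝ (Fin (m + 1))) :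
    fderiv ℝ (approx d p ε) x w =
      (ε ^ 2 * fderiv ℝ p (base x) (base w)
        + ε * (fderiv ℝ d (base x) (base w) * height x + d (base x) * height w)
        - 2 * height x * height w)
        * (1 + ε ^ 2 * corrConst d p (base x) + ε * corrLin d (base x) * height x)
      + (ε ^ 2 * p (base x) + ε * d (base x) * height x - height x ^ 2)
        * (ε ^ 2 * fderiv ℝ (corrConst d p) (base x) (base w)
          + ε * (fderiv ℝ (corrLin d) (base x) (base w) * height x
            + corrLin d (base x) * height w)) := by
  have hcomp : ∀ {f : EuclideanSpace ℝ (Fin m) → ℝ}, ContDiffAt ℝ 2 f (base x) →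
      HasFDerivAt (fun x => f (base x)) ((fderiv ℝ f (base x)).comp (baseL m)) x := fun hf =>
    (hf.differentiableAt (by simp)).hasFDerivAt.comp x (baseL m).hasFDerivAt
  have hp := hcomp h.contDiffAt_p
  have hd := hcomp h.contDiffAt_d
  have ha := hcomp h.contDiffAt_corrConst
  have hb := hcomp h.contDiffAt_corrLin
  have hh : HasFDerivAt (height : EuclideanSpace ℝ (Fin (m + 1)) → ℝ) (heightL m) x :=
    (heightL m).hasFDerivAt
  have h1 := ((hp.const_mul (ε ^ 2)).fun_add ((hd.const_mul ε).fun_mul hh)).fun_sub (hh.pow 2)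
  have h2 := ((ha.const_mul (ε ^ 2)).const_add 1).fun_add ((hb.const_mul ε).fun_mul hh)
  have h3 := h1.fun_mul h2
  have e : approx d p ε = fun x => (ε ^ 2 * p (base x) + ε * d (base x) * height x - height x ^ 2)
    * (1 + ε ^ 2 * corrConst d p (base x) + ε * corrLin d (base x) * height x) := rfl
  rw [e, h3.fderiv]
  simp only [_root_.add_apply, _root_.sub_apply, _root_.smul_apply, smul_eq_mul,
    ContinuousLinearMap.comp_apply, baseL_apply, heightL_apply, nsmul_eq_mul]
  norm_num
  ring

/-- The filter of solutions in thin domains together with a maximizer, as `ε → 0`. -/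
def maximizerFilter (ω : Set (EuclideanSpace ℝ (Fin m)))
    (hminus hplus : EuclideanSpace ℝ (Fin m) → ℝ) :
    Filter (ℝ × (EuclideanSpace ℝ (Fin (m + 1)) → ℝ) × EuclideanSpace ℝ (Fin (m + 1))) :=
  comap Prod.fst (𝓝[>] 0) ⊓ 𝓟 {q | IsTorsionSolution (thinDomain ω hminus hplus q.1) q.2.1 ∧
    q.2.2 ∈ thinDomain ω hminus hplus q.1 ∧ IsMaxOn q.2.1 (thinDomain ω hminus hplus q.1) q.2.2}

/-- Translates a statement along the filter into one threshold `ε₀` valid for all solutions and all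
maximizers; this is where uniformity of the constants comes from. -/
theorem eventually_maximizerFilter {P : ℝ → (EuclideanSpace ℝ (Fin (m + 1)) → ℝ) →
      EuclideanSpace ℝ (Fin (m + 1)) → Prop} :
    (∀ᶠ q in maximizerFilter ω hminus hplus, P q.1 q.2.1 q.2.2) ↔
      ∃ ε₀ > 0, ∀ ε : ℝ, 0 < ε → ε < ε₀ → ∀ u : EuclideanSpace ℝ (Fin (m + 1)) → ℝ,
        IsTorsionSolution (thinDomain ω hminus hplus ε) u →
        ∀ x ∈ thinDomain ω hminus hplus ε, IsMaxOn u (thinDomain ω hminus hplus ε) x → P ε u x := by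
  rw [maximizerFilter, eventually_inf_principal, eventually_comap]
  constructor
  · intro h
    obtain ⟨ε₀, hε₀, hsub⟩ := mem_nhdsGT_iff_exists_Ioo_subset.1 h
    exact ⟨ε₀, hε₀, fun ε h0 h1 u hu x hx hmax => hsub ⟨h0, h1⟩ (ε, u, x) rfl ⟨hu, hx, hmax⟩⟩
  · rintro ⟨ε₀, hε₀, h⟩
    filter_upwards [Ioo_mem_nhdsGT hε₀] with ε hε q hq hqS
    subst hq
    exact h q.1 hε.1 hε.2 q.2.1 hqS.1 q.2.2 hqS.2.1 hqS.2.2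

theorem Peak.almostCritical (P : Peak ω hminus hplus H d p y₀ M K r c)
    (hH5 : ContDiffAt ℝ 5 H y₀) (hd5 : ContDiffAt ℝ 5 d y₀)
    (hpos : (-halfHessian H y₀).PosDef) :
    AlmostCritical H d p y₀ (maximizerFilter ω hminus hplus) (fun q => q.1)
      (fun q => base q.2.2) (fun q => height q.2.2 / q.1) (fun q => q.2.1 q.2.2) := by
  obtain ⟨C, hC, ε₁, hε₁, h1⟩ := P.exists_maximizer_close
  obtain ⟨C', hC', ε₂, hε₂, h2⟩ := P.exists_abs_fderiv_approx_le
  have hr := P.r_pos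
  have hev0 : ∀ᶠ q in maximizerFilter ω hminus hplus, 0 < q.1 ∧ q.1 < 1 :=
    (eventually_maximizerFilter (P := fun ε _ _ => 0 < ε ∧ ε < 1)).2
      ⟨1, one_pos, fun ε h0 h1 _ _ _ _ _ => ⟨h0, h1⟩⟩
  have hev1 : ∀ᶠ q in maximizerFilter ω hminus hplus, ‖base q.2.2 - y₀‖ ≤ √C * q.1 ∧
      |height q.2.2 / q.1 - d (base q.2.2) / 2| ≤ √C * q.1 := by
    refine (eventually_maximizerFilter (P := fun ε _ x => ‖base x - y₀‖ ≤ √C * ε ∧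
      |height x / ε - d (base x) / 2| ≤ √C * ε)).2 ⟨ε₁, hε₁, fun ε h0 hε u hu x hx hmax => ?_⟩
    obtain ⟨g1, g2⟩ := h1 ε h0 hε u hu x hx hmax
    rw [← Real.sq_sqrt hC.le, ← mul_pow] at g1 g2
    exact ⟨(pow_le_pow_iff_left₀ (norm_nonneg _) (by positivity) two_ne_zero).1 g1,
      abs_le_of_sq_le_sq g2 (by positivity)⟩
  have hev2 : ∀ᶠ q in maximizerFilter ω hminus hplus, |q.2.1 q.2.2 - approx d p q.1 q.2.2|
      ≤ C' * q.1 ^ 6 ∧ ∀ e, ‖e‖ = 1 → |fderiv ℝ (approx d p q.1) q.2.2 e| ≤ C' * q.1 ^ 5 :=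
    (eventually_maximizerFilter (P := fun ε u x => |u x - approx d p ε x| ≤ C' * ε ^ 6 ∧
      ∀ e, ‖e‖ = 1 → |fderiv ℝ (approx d p ε) x e| ≤ C' * ε ^ 5)).2 ⟨ε₂, hε₂, h2⟩
  have hε : Tendsto (fun q : ℝ × (EuclideanSpace ℝ (Fin (m + 1)) → ℝ)
      × EuclideanSpace ℝ (Fin (m + 1)) => q.1) (maximizerFilter ω hminus hplus) (𝓝 0) :=
    (tendsto_comap.mono_left inf_le_left).mono_right nhdsWithin_le_nhds
  have hbase : (fun q => base q.2.2 - y₀) =O[maximizerFilter ω hminus hplus]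
      fun q => q.1 ^ 1 := by
    refine IsBigO.of_bound √C ?_
    filter_upwards [hev0, hev1] with q g0 g1
    rw [pow_one, Real.norm_eq_abs, abs_of_pos g0.1]
    exact g1.1
  have hevr : ∀ᶠ q in maximizerFilter ω hminus hplus, ApproxRegular d p K (base q.2.2) := by
    have h0 : Tendsto (fun q : ℝ × (EuclideanSpace ℝ (Fin (m + 1)) → ℝ)
      × EuclideanSpace ℝ (Fin (m + 1)) => q.1 ^ 1) (maximizerFilter ω hminus hplus) (𝓝 0) := by
      simpa using hε
    have h3 := ((hbase.trans_tendsto h0).norm.eventually (gt_mem_nhds (by simpa using hr)))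
    filter_upwards [h3] with q hq
    exact P.regular _ (by rw [Metric.mem_closedBall, dist_eq_norm]; exact hq.le)
  have hev := hev0.and (hev2.and hevr)
  refine
    { tendsto := hε
      base_isBigO := hbase
      height_isBigO := ?_
      fderiv_base := fun k => ?_
      fderiv_height := ?_
      value := ?_
      contDiffAt_H := hH5
      contDiffAt_d := hd5
      p_eq := fun y => by rw [P.p_eq, P.H_eq, P.d_eq]; ring
      fderiv_H := ?_
      H_pos := P.pos
      posDef := hpos }
  · refine IsBigO.of_bound √C ?_
    filter_upwards [hev0, hev1] with q g0 g1
    rw [pow_one, Real.norm_eq_abs, Real.norm_eq_abs, abs_of_pos g0.1]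
    exact g1.2
  · refine IsBigO.of_bound C' ?_
    filter_upwards [hev] with q ⟨⟨g0, _⟩, ⟨_, g2⟩, g3⟩
    have g4 := g2 (join (EuclideanSpace.single k 1) 0) (by rw [norm_join_zero]; simp)
    rw [fderiv_approx g3] at g4
    simp only [base_join, height_join] at g4
    rw [Real.norm_eq_abs, Real.norm_eq_abs, abs_of_pos (pow_pos g0 3)]
    -- With `s = ε ξ`, horizontal derivatives of `approx` carry a factor `ε²`, so the bound `C' ε⁵`
    -- becomes `C' ε³`.
    refine le_of_mul_le_mul_left ?_ (pow_pos g0 2)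
    rw [← abs_of_pos (pow_pos g0 2), ← abs_mul, abs_of_pos (pow_pos g0 2)]
    refine le_trans (le_of_eq (congrArg _ ?_)) (g4.trans_eq (by ring))
    field_simp
    ring
  · refine IsBigO.of_bound C' ?_
    filter_upwards [hev] with q ⟨⟨g0, g1⟩, ⟨_, g2⟩, g3⟩
    have g4 := g2 (join 0 1) (by rw [norm_join_base_zero]; simp)
    rw [fderiv_approx g3] at g4
    simp only [base_join, height_join, map_zero] at g4
    rw [Real.norm_eq_abs, Real.norm_eq_abs, abs_of_pos (pow_pos g0 3)]
    -- The vertical derivative carries a single factor `ε`. Division would give order `ε⁴`, which is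
    -- weakened to `ε³`.
    refine le_of_mul_le_mul_left ?_ g0
    rw [← abs_of_pos g0, ← abs_mul, abs_of_pos g0]
    have g5 : C' * q.1 ^ 5 ≤ q.1 * (C' * q.1 ^ 3) := by
      have : q.1 ^ 5 ≤ q.1 ^ 4 := pow_le_pow_of_le_one g0.le g1.le (by norm_num)
      calc C' * q.1 ^ 5 ≤ C' * q.1 ^ 4 := by gcongr
        _ = _ := by ring
    refine le_trans (le_of_eq (congrArg _ ?_)) (g4.trans g5)
    field_simp
    ring
  · refine IsBigO.of_bound C' ?_
    filter_upwards [hev] with q ⟨⟨g0, g1⟩, ⟨g2, _⟩, _⟩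
    rw [Real.norm_eq_abs, Real.norm_eq_abs, abs_of_pos (pow_pos g0 5)]
    have g5 : C' * q.1 ^ 6 ≤ C' * q.1 ^ 5 := by
      have : q.1 ^ 6 ≤ q.1 ^ 5 := pow_le_pow_of_le_one g0.le g1.le (by norm_num)
      gcongr
    refine le_trans (le_of_eq (congrArg _ ?_)) (g2.trans g5)
    rw [approx]
    field_simp
    ring
  · have hmax : IsLocalMax H y₀ := by
      filter_upwards [Metric.closedBall_mem_nhds y₀ hr] with z hz
      have := P.H_le z hz
      have : 0 ≤ c * ‖z - y₀‖ ^ 2 := mul_nonneg P.c_pos.le (sq_nonneg _)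
      linarith
    exact hmax.fderiv_eq_zero

/-- All local properties hold eventually near `y₀`, so one closed ball serves them all. Boundary
points cannot compete with the peak because `H` vanishes there. -/
theorem exists_peak (hω_open : IsOpen ω) (hω_bdd : Bornology.IsBounded ω)
    (hH : H = fun x => hminus x + hplus x) (hd : d = fun x => hplus x - hminus x)
    (hp : p = fun x => hplus x * hminus x)
    (hminus_cont : ContinuousOn hminus (closure ω)) (hplus_cont : ContinuousOn hplus (closure ω))
    (hH_pos : ∀ x ∈ ω, 0 < H x) (hH_bdry : ∀ x ∈ frontier ω, H x = 0) (hy₀ : y₀ ∈ ω)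
    (hH1 : ∀ x ∈ ω, x ≠ y₀ → H x < H y₀) (hH2 : (-halfHessian H y₀).PosDef)
    (hminus_C5 : ContDiffAt ℝ 5 hminus y₀) (hplus_C5 : ContDiffAt ℝ 5 hplus y₀) :
    ContDiffAt ℝ 5 H y₀ ∧ ContDiffAt ℝ 5 d y₀ ∧
      ∃ M K r c, Peak ω hminus hplus H d p y₀ M K r c := by
  have hH5 : ContDiffAt ℝ 5 H y₀ := by rw [hH]; exact hminus_C5.add hplus_C5
  have hd5 : ContDiffAt ℝ 5 d y₀ := by rw [hd]; exact hplus_C5.sub hminus_C5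
  have hp5 : ContDiffAt ℝ 5 p y₀ := by rw [hp]; exact hplus_C5.mul hminus_C5
  refine ⟨hH5, hd5, ?_⟩
  obtain ⟨M₁, hM₁⟩ := hω_bdd.isCompact_closure.exists_bound_of_continuousOn hminus_cont
  obtain ⟨M₂, hM₂⟩ := hω_bdd.isCompact_closure.exists_bound_of_continuousOn hplus_cont
  obtain ⟨K, hK, hreg⟩ := exists_eventually_approxRegular hd5 hp5
  obtain ⟨c, hc, hneg⟩ := exists_fderiv_fderiv_le_of_posDef hH2
  have hpos := hH_pos y₀ hy₀
  have hmax : IsLocalMax H y₀ := by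
    filter_upwards [hω_open.mem_nhds hy₀] with z hz
    rcases eq_or_ne z y₀ with rfl | hne
    · exact le_rfl
    · exact (hH1 z hz hne).le
  have hquad := eventually_le_sub_sq (hH5.of_le (by norm_num)) hmax.fderiv_eq_zero hc hneg
  have hclose : ∀ {f : EuclideanSpace ℝ (Fin m) → ℝ}, ContDiffAt ℝ 5 f y₀ →
      ∀ᶠ y in 𝓝 y₀, |f y - f y₀| ≤ H y₀ / 8 := fun {f} hf => by
    have := Metric.continuousAt_iff'.1 hf.continuousAt (H y₀ / 8) (by positivity)
    filter_upwards [this] with y hy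
    rw [Real.dist_eq] at hy
    exact hy.le
  obtain ⟨r, hr, hball⟩ := Metric.nhds_basis_closedBall.eventually_iff.1
    ((hω_open.eventually_mem hy₀).and (hreg.and (hquad.and
      ((hclose hminus_C5).and (hclose hplus_C5)))))
  refine ⟨|M₁| + |M₂| + 1, K, r, c / 4, ?_⟩
  exact
    { profile :=
        { isOpen := hω_open
          isBounded := hω_bdd
          continuousOn_minus := hminus_cont
          continuousOn_plus := hplus_cont
          abs_minus_le := fun y hy => by
            have := hM₁ y hy
            rw [Real.norm_eq_abs] at this
            linarith [le_abs_self M₁, abs_nonneg M₂]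
          abs_plus_le := fun y hy => by
            have := hM₂ y hy
            rw [Real.norm_eq_abs] at this
            linarith [le_abs_self M₂, abs_nonneg M₁]
          pos := by positivity }
      H_eq := fun y => by rw [hH]
      d_eq := fun y => by rw [hd]
      p_eq := fun y => by rw [hp]
      K_pos := hK
      r_pos := hr
      c_pos := by positivity
      ball_subset := fun y hy => (hball hy).1
      regular := fun y hy => (hball hy).2.1
      H_pos := hH_pos
      H_lt := fun y hy hne => by
        by_cases hyω : y ∈ ω
        · exact hH1 y hyω hne
        · rw [hH_bdry y (by rw [hω_open.frontier_eq]; exact ⟨hy, hyω⟩)]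
          exact hpos
      H_le := fun y hy => (hball hy).2.2.1
      minus_close := fun y hy => (hball hy).2.2.2.1
      plus_close := fun y hy => (hball hy).2.2.2.2 }

end Assembly

end ThinDomain

theorem theorem4p3 (m : ℕ) (hm : 1 ≤ m)
    (ω : Set (EuclideanSpace ℝ (Fin m)))
    (hω_open : IsOpen ω) (hω_conn : IsConnected ω) (hω_bdd : Bornology.IsBounded ω)
    (hω_bdry : ThinDomain.HasC1Boundary ω)
    (hminus hplus H d p : EuclideanSpace ℝ (Fin m) → ℝ)
    (hH : H = fun x => hminus x + hplus x)
    (hd : d = fun x => hplus x - hminus x)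
    (hp : p = fun x => hplus x * hminus x)
    (hminus_cont : ContinuousOn hminus (closure ω)) (hminus_C1 : ContDiffOn ℝ 1 hminus ω)
    (hplus_cont : ContinuousOn hplus (closure ω)) (hplus_C1 : ContDiffOn ℝ 1 hplus ω)
    (hH_pos : ∀ x ∈ ω, 0 < H x) (hH_bdry : ∀ x ∈ frontier ω, H x = 0)
    (xbar : EuclideanSpace ℝ (Fin m)) (hxbar : xbar ∈ ω)
    (hH1 : ∀ x ∈ ω, x ≠ xbar → H x < H xbar)
    (hH2 : (-ThinDomain.halfHessian H xbar).PosDef)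
    (hminus_C5 : ContDiffAt ℝ 5 hminus xbar) (hplus_C5 : ContDiffAt ℝ 5 hplus xbar) :
    ∃ C : ℝ, ∃ ε₀ : ℝ, 0 < ε₀ ∧ ∀ ε : ℝ, 0 < ε → ε < ε₀ →
      ∀ u : EuclideanSpace ℝ (Fin (m + 1)) → ℝ,
        ThinDomain.IsTorsionSolution (ThinDomain.thinDomain ω hminus hplus ε) u →
        (∃ x ∈ ThinDomain.thinDomain ω hminus hplus ε,
          IsMaxOn u (ThinDomain.thinDomain ω hminus hplus ε) x) ∧
        ∀ x ∈ ThinDomain.thinDomain ω hminus hplus ε,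
          IsMaxOn u (ThinDomain.thinDomain ω hminus hplus ε) x →
          ‖ThinDomain.base x - (xbar + ε ^ 2 • ThinDomain.baseCorrection H d p xbar)‖
              ≤ C * ε ^ 3 ∧
          |ThinDomain.height x / ε
              - (d xbar / 2 + ThinDomain.heightCorrection H d p xbar * ε ^ 2)| ≤ C * ε ^ 3 ∧
          |u x - ((1 / 4 : ℝ) * H xbar ^ 2 * ε ^ 2
              + (1 / 8 : ℝ) * H xbar ^ 2
                * (d xbar * (ThinDomain.halfHessian d xbar).trace
                    + 2 * (ThinDomain.halfHessian p xbar).trace) * ε ^ 4)| ≤ C * ε ^ 5 := by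
  obtain ⟨hH5, hd5, M, K, r, c, P⟩ := ThinDomain.exists_peak hω_open hω_bdd hH hd hp hminus_cont
    hplus_cont hH_pos hH_bdry hxbar hH1 hH2 hminus_C5 hplus_C5
  have A := P.almostCritical hH5 hd5 hH2
  obtain ⟨ε₀, hε₀, hex⟩ := P.exists_isMaxOn
  obtain ⟨C₁, h1⟩ := A.base_expansion.bound
  obtain ⟨C₂, h2⟩ := A.height_expansion.bound
  obtain ⟨C₃, h3⟩ := A.value_expansion.bound
  obtain ⟨ε₁, hε₁, h⟩ := (ThinDomain.eventually_maximizerFilter (P := fun ε u x =>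
    ‖ThinDomain.base x - (xbar + ε ^ 2 • ThinDomain.baseCorrection H d p xbar)‖ ≤ C₁ * ‖ε ^ 3‖ ∧
    ‖ThinDomain.height x / ε - (d xbar / 2 + ThinDomain.heightCorrection H d p xbar * ε ^ 2)‖
      ≤ C₂ * ‖ε ^ 3‖ ∧
    ‖u x - ((1 / 4 : ℝ) * H xbar ^ 2 * ε ^ 2
      + (1 / 8 : ℝ) * H xbar ^ 2 * (d xbar * (ThinDomain.halfHessian d xbar).trace
        + 2 * (ThinDomain.halfHessian p xbar).trace) * ε ^ 4)‖ ≤ C₃ * ‖ε ^ 5‖)).1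
    (h1.and (h2.and h3))
  refine ⟨|C₁| + |C₂| + |C₃|, min ε₀ ε₁, lt_min hε₀ hε₁, fun ε hε hεlt u hu =>
    ⟨hex ε hε (hεlt.trans_le (min_le_left _ _)) u hu, fun x hx hmax => ?_⟩⟩
  obtain ⟨g1, g2, g3⟩ := h ε hε (hεlt.trans_le (min_le_right _ _)) u hu x hx hmax
  rw [Real.norm_eq_abs (ε ^ _), abs_of_pos (pow_pos hε _)] at g1 g2 g3
  rw [Real.norm_eq_abs] at g2 g3
  refine ⟨g1.trans ?_, g2.trans ?_, g3.trans ?_⟩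
  · refine mul_le_mul_of_nonneg_right ?_ (pow_pos hε _).le
    linarith [le_abs_self C₁, abs_nonneg C₂, abs_nonneg C₃]
  · refine mul_le_mul_of_nonneg_right ?_ (pow_pos hε _).le
    linarith [le_abs_self C₂, abs_nonneg C₁, abs_nonneg C₃]
  · refine mul_le_mul_of_nonneg_right ?_ (pow_pos hε _).le
    linarith [le_abs_self C₃, abs_nonneg C₁, abs_nonneg C₂]
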